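/- Let $(M,g)$ be a spacetime: a smooth (Hausdorff) manifold with a smooth Lorentzian metric $g$ of signature $(+,-,\dots,-)$, time-oriented by a smooth timelike vector field $X$. A vector $v$ is timelike if $g(v,v)>0$ and causal if $g(v,v)\ge 0$; a causal $v$ is future-directed if $g(v,X)\ge 0$ and past-directed if $g(v,X)\le 0$. Write $x\le y$ (resp. $x\ll y$) if there is a piecewise $C^1$ future-directed causal (resp. timelike) curve from $x$ to $y$, and let $$\ell(x,y)=\sup_\gamma\int_0^1\sqrt{g(\dot\gamma_t,\dot\gamma_t)}\,dt\in[0,\infty],$$ where the supremum runs over the piecewise $C^1$ future-directed causal curves $\gamma:[0,1]\to M$ from $x$ to $y$, and $\ell(x,y)=0$ if there are none. Assume that $(M,g)$ is strongly causal, i.e. the sets $\{z : x\ll z\ll y\}$, $x,y\in M$, form a subbase of the topology of $M$, and Ptolemaic, i.e. (with $0\cdot\infty=0$) $$\ell(x,z)\,\ell(y,w)\ \ge\ \ell(x,y)\,\ell(z,w)+\ell(x,w)\,\ell(y,z)\qquad\text{whenever } x\le y\le z\le w .$$ A geodesic is an (affinely parametrised) solution of the geodesic equation of the Levi-Civita connection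 on an interval of positive length; it is timelike if its velocities are timelike. A timelike geodesic $\gamma:J\to M$ is maximising if it is future-directed and $\ell(\gamma_s,\gamma_t)$ equals the length of $\gamma|_{[s,t]}$ for all $s\le t$ in $J$, or if it is past-directed and its time reversal has this property. The future timelike cut locus of $p$ is the set of all points $\gamma_a$, where $\gamma:[0,b)\to M$ is a future-directed timelike geodesic parametrised by proper time with $\gamma_0=p$, $0<a<b$, and $a=\sup\{t\in[0,b):\ell(p,\gamma_t)=t\}$. The past timelike cut locus is defined dually, with past-directed geodesics and $\ell(\gamma_t,p)$, and the timelike cut locus is the union of the two. Lemma 4.5 (Globally maximising geodesics and empty cut locus). Under these assumptions: 1. every timelike geodesic of $M$ is maximising; 2. the timelike cut locus of every point of $M$ is empty; 3. any two points $x,y\in M$ are joined by at most one future-directed maximising timelike geodesic: if $\sigma,\gamma:[0,1]\to M$ are two such geodesics from $x$ to $y$, then $\sigma=\gamma$. -/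

import Mathlib

open Set MeasureTheory
open scoped Manifold ContDiff ENNReal

noncomputable section

/-- The Ptolemy inequality for a causal relation `le` and a time separation function `ℓ` with values
in `[0, ∞]` (with the convention `0 * ∞ = 0`). -/
def IsPtolemaic {X : Type*} (le : X → X → Prop) (ℓ : X → X → ℝ≥0∞) : Prop :=
  ∀ x y z w : X, le x y → le y z → le z w →
    ℓ x y * ℓ z w + ℓ x w * ℓ y z ≤ ℓ x z * ℓ y w

/-- The data turning a smooth manifold `M` (modelled on the finite-dimensional space `E`) into a
spacetime: a smooth Lorentzian metric of signature `(+, -, …, -)`, and a smooth timelike vector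
field, which fixes the time orientation. -/
structure Spacetime (E : Type*) [NormedAddCommGroup E] [NormedSpace ℝ E]
    (M : Type*) [TopologicalSpace M] [ChartedSpace E M] [IsManifold 𝓘(ℝ, E) ∞ M] where
  /-- The metric tensor. -/
  g (p : M) : TangentSpace 𝓘(ℝ, E) p →L[ℝ] TangentSpace 𝓘(ℝ, E) p →L[ℝ] ℝ
  g_symm (p : M) (v w : TangentSpace 𝓘(ℝ, E) p) : g p v w = g p w v
  /-- Signature `(+, -, …, -)`: there is a vector of positive square on whose orthogonal complement
  the form is negative definite. -/
  g_signature (p : M) : ∃ e : TangentSpace 𝓘(ℝ, E) p, 0 < g p e e ∧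
    ∀ v : TangentSpace 𝓘(ℝ, E) p, g p e v = 0 → v ≠ 0 → g p v v < 0
  g_smooth : ContMDiff 𝓘(ℝ, E) (𝓘(ℝ, E).prod 𝓘(ℝ, E →L[ℝ] E →L[ℝ] ℝ)) ∞
    (fun p ↦ Bundle.TotalSpace.mk' (E →L[ℝ] E →L[ℝ] ℝ)
      (E := fun p : M ↦ TangentSpace 𝓘(ℝ, E) p →L[ℝ] TangentSpace 𝓘(ℝ, E) p →L[ℝ] ℝ) p (g p))
  /-- The vector field defining the time orientation. -/
  X (p : M) : TangentSpace 𝓘(ℝ, E) p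
  X_smooth : ContMDiff 𝓘(ℝ, E) (𝓘(ℝ, E).prod 𝓘(ℝ, E)) ∞
    (fun p ↦ Bundle.TotalSpace.mk' E (E := fun p : M ↦ TangentSpace 𝓘(ℝ, E) p) p (X p))
  X_timelike (p : M) : 0 < g p (X p) (X p)

namespace Spacetime

variable {E : Type*} [NormedAddCommGroup E] [NormedSpace ℝ E]
  {M : Type*} [TopologicalSpace M] [ChartedSpace E M] [IsManifold 𝓘(ℝ, E) ∞ M]

/-- The velocity at time `t` of the curve `γ` restricted to the set of times `J`
(one-sided at end points of `J`). -/
def velocity (γ : ℝ → M) (J : Set ℝ) (t : ℝ) : TangentSpace 𝓘(ℝ, E) (γ t) :=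
  mfderivWithin 𝓘(ℝ, ℝ) 𝓘(ℝ, E) γ J t (1 : ℝ)

variable (S : Spacetime E M)

/-! ### Causal character of vectors -/

def TimelikeVec (p : M) (v : TangentSpace 𝓘(ℝ, E) p) : Prop := 0 < S.g p v v

def CausalVec (p : M) (v : TangentSpace 𝓘(ℝ, E) p) : Prop := 0 ≤ S.g p v v

def FutureCausalVec (p : M) (v : TangentSpace 𝓘(ℝ, E) p) : Prop :=
  S.CausalVec p v ∧ 0 ≤ S.g p v (S.X p)

def FutureTimelikeVec (p : M) (v : TangentSpace 𝓘(ℝ, E) p) : Prop :=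
  S.TimelikeVec p v ∧ 0 ≤ S.g p v (S.X p)

def PastTimelikeVec (p : M) (v : TangentSpace 𝓘(ℝ, E) p) : Prop :=
  S.TimelikeVec p v ∧ S.g p v (S.X p) ≤ 0

open Classical in
/-- The hyperbolic norm: `√(g(v, v))` on future-directed causal vectors, and `0` otherwise. -/
def hyperbolicNorm (p : M) (v : TangentSpace 𝓘(ℝ, E) p) : ℝ :=
  if S.FutureCausalVec p v then √(S.g p v v) else 0

/-! ### Curves, time separation and causal relations -/

/-- `γ` is piecewise `C¹` on `[0, 1]`, and all its (one-sided, at the break points) velocities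
satisfy the condition `P`. -/
def IsPiecewiseC1With (P : ∀ p : M, TangentSpace 𝓘(ℝ, E) p → Prop) (γ : ℝ → M) : Prop :=
  ∃ (n : ℕ) (τ : Fin (n + 1) → ℝ), StrictMono τ ∧ τ 0 = 0 ∧ τ (Fin.last n) = 1 ∧
    ∀ i : Fin n,
      ContMDiffOn 𝓘(ℝ, ℝ) 𝓘(ℝ, E) 1 γ (Icc (τ i.castSucc) (τ i.succ)) ∧
      ∀ t ∈ Icc (τ i.castSucc) (τ i.succ),
        P (γ t) (velocity γ (Icc (τ i.castSucc) (τ i.succ)) t)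

/-- `γ|[0,1]` is a piecewise `C¹` future-directed causal curve from `x` to `y`. -/
def IsFutureCausalCurve (γ : ℝ → M) (x y : M) : Prop :=
  IsPiecewiseC1With S.FutureCausalVec γ ∧ γ 0 = x ∧ γ 1 = y

/-- `γ|[0,1]` is a piecewise `C¹` future-directed timelike curve from `x` to `y`. -/
def IsFutureTimelikeCurve (γ : ℝ → M) (x y : M) : Prop :=
  IsPiecewiseC1With S.FutureTimelikeVec γ ∧ γ 0 = x ∧ γ 1 = y

/-- The Lorentzian length of `γ|[a,b]`. -/
def length (γ : ℝ → M) (a b : ℝ) : ℝ≥0∞ :=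
  ∫⁻ t in Icc a b, ENNReal.ofReal (S.hyperbolicNorm (γ t) (velocity γ (Icc a b) t))

/-- The time separation function `ℓ : M × M → [0, ∞]`: the supremum of the lengths of the piecewise
`C¹` future-directed causal curves from `x` to `y` (`0` if there are none). -/
def timeSep (x y : M) : ℝ≥0∞ :=
  ⨆ (γ : ℝ → M) (_ : S.IsFutureCausalCurve γ x y), S.length γ 0 1

/-- The causal relation `x ≤ y`. -/
def CausalLE (x y : M) : Prop := ∃ γ : ℝ → M, S.IsFutureCausalCurve γ x y

/-- The timelike relation `x ≪ y`. -/
def ChronLT (x y : M) : Prop := ∃ γ : ℝ → M, S.IsFutureTimelikeCurve γ x y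

/-- Strong causality: the timelike diamonds `I⁺(x) ∩ I⁻(y)` form a subbase for the topology. -/
def StronglyCausal : Prop :=
  ‹TopologicalSpace M› =
    TopologicalSpace.generateFrom {D | ∃ x y : M, D = {z | S.ChronLT x z ∧ S.ChronLT z y}}

/-- The spacetime is Ptolemaic: its causal relation and time separation function satisfy the
Ptolemy inequality. -/
def Ptolemaic : Prop := IsPtolemaic S.CausalLE S.timeSep

/-! ### Geodesics -/

/-- The components of the metric in the chart `e`. -/
def chartMetric (e : OpenPartialHomeomorph M E) (x u v : E) : ℝ :=
  S.g (e.symm x) (mfderiv 𝓘(ℝ, E) 𝓘(ℝ, E) e.symm x u) (mfderiv 𝓘(ℝ, E) 𝓘(ℝ, E) e.symm x v)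

/-- The Christoffel symbols of the first kind of the Levi-Civita connection in the chart `e`:
`Γ(u, v; w) = g(Γ(u, v), w) = (∂_u g(v, w) + ∂_v g(u, w) - ∂_w g(u, v)) / 2`. -/
def christoffel (e : OpenPartialHomeomorph M E) (x u v w : E) : ℝ :=
  (fderiv ℝ (fun y ↦ S.chartMetric e y v w) x u
    + fderiv ℝ (fun y ↦ S.chartMetric e y u w) x v
    - fderiv ℝ (fun y ↦ S.chartMetric e y u v) x w) / 2

/-- `γ` is a geodesic on the interval `J` (of positive length; it may be open, closed, half-open,
bounded or not): it is `C²` and solves the geodesic equation `c'' + Γ(c', c') = 0` in every chart of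
the atlas. The equation is tested against all vectors `w`, which is equivalent since the metric is
nondegenerate. -/
def IsGeodesicOn (γ : ℝ → M) (J : Set ℝ) : Prop :=
  J.OrdConnected ∧ J.Nontrivial ∧ ContMDiffOn 𝓘(ℝ, ℝ) 𝓘(ℝ, E) 2 γ J ∧
  ∀ e ∈ atlas E M, ∀ t ∈ J, γ t ∈ e.source → ∀ w : E,
    S.chartMetric e (e (γ t)) (iteratedDerivWithin 2 (fun s ↦ e (γ s)) J t) w
      + S.christoffel e (e (γ t)) (derivWithin (fun s ↦ e (γ s)) J t)
          (derivWithin (fun s ↦ e (γ s)) J t) w = 0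

def IsTimelikeGeodesicOn (γ : ℝ → M) (J : Set ℝ) : Prop :=
  S.IsGeodesicOn γ J ∧ ∀ t ∈ J, S.TimelikeVec (γ t) (velocity γ J t)

def IsFutureTimelikeGeodesicOn (γ : ℝ → M) (J : Set ℝ) : Prop :=
  S.IsGeodesicOn γ J ∧ ∀ t ∈ J, S.FutureTimelikeVec (γ t) (velocity γ J t)

def IsPastTimelikeGeodesicOn (γ : ℝ → M) (J : Set ℝ) : Prop :=
  S.IsGeodesicOn γ J ∧ ∀ t ∈ J, S.PastTimelikeVec (γ t) (velocity γ J t)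

/-- The curve `γ` on `J` realises the time separation from each of its points to every later one. -/
def RealisesTimeSepOn (γ : ℝ → M) (J : Set ℝ) : Prop :=
  ∀ s ∈ J, ∀ t ∈ J, s ≤ t → S.timeSep (γ s) (γ t) = S.length γ s t

/-- A timelike geodesic is (globally) maximising: run in its future direction, it realises the time
separation between any two of its points. -/
def IsMaximisingTimelikeGeodesicOn (γ : ℝ → M) (J : Set ℝ) : Prop :=
  (S.IsFutureTimelikeGeodesicOn γ J ∧ S.RealisesTimeSepOn γ J) ∨
  (S.IsPastTimelikeGeodesicOn γ J ∧ S.RealisesTimeSepOn (fun t ↦ γ (-t)) {t | -t ∈ J})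

/-! ### Timelike cut locus -/

/-- `γ` is parametrised by proper time on `J`. -/
def IsUnitSpeedOn (γ : ℝ → M) (J : Set ℝ) : Prop :=
  ∀ t ∈ J, S.g (γ t) (velocity γ J t) (velocity γ J t) = 1

/-- The future timelike cut locus of `p`: the points `γ a`, where `γ` is a future-directed timelike
geodesic from `p` parametrised by proper time on some `[0, b)` with `0 < a < b`, and `a` is the
supremum of the times `t` with `ℓ(p, γ t) = t`. -/
def futureCutLocus (p : M) : Set M :=
  {q | ∃ (γ : ℝ → M) (a b : ℝ), 0 < a ∧ a < b ∧
    S.IsFutureTimelikeGeodesicOn γ (Ico 0 b) ∧ S.IsUnitSpeedOn γ (Ico 0 b) ∧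
    γ 0 = p ∧ γ a = q ∧
    IsLUB {t | t ∈ Ico 0 b ∧ S.timeSep p (γ t) = ENNReal.ofReal t} a}

/-- The past timelike cut locus of `p`, defined dually. -/
def pastCutLocus (p : M) : Set M :=
  {q | ∃ (γ : ℝ → M) (a b : ℝ), 0 < a ∧ a < b ∧
    S.IsPastTimelikeGeodesicOn γ (Ico 0 b) ∧ S.IsUnitSpeedOn γ (Ico 0 b) ∧
    γ 0 = p ∧ γ a = q ∧
    IsLUB {t | t ∈ Ico 0 b ∧ S.timeSep (γ t) p = ENNReal.ofReal t} a}

/-- The timelike cut locus of `p`. -/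
def timelikeCutLocus (p : M) : Set M := S.futureCutLocus p ∪ S.pastCutLocus p

end Spacetime

end

/-! A timelike geodesic maximises locally, and the Ptolemy inequality turns local maximality into
global maximality. Suppose a geodesic of speed `κ` realises the time separation on two overlapping
intervals `[p, r]` and `[q, s]` with `p ≤ q < r ≤ s`. Ptolemy for its four points, together with the
trivial lower bounds by length, gives `κ(r-p) · κ(s-q) ≥ κ(q-p) · κ(s-r) + ℓ(γ_p, γ_s) · κ(r-q)`.
Four numbers on a line satisfy this with equality when `ℓ(γ_p, γ_s)` is replaced by `κ(s-p)`, so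
`ℓ(γ_p, γ_s) ≤ κ(s-p)` after cancelling `κ(r-q) > 0`. An induction along the interval then covers
every compact piece (`timeSep_eq_of_isFutureGeodesicNear`).

Local maximality (`IsFutureGeodesicNear.timeSep_le`) is proved by calibration, without the
exponential map. Near a point of the geodesic, `IsLocalSpacetime.exists_calibration` constructs a
function `f` equal to `κ² t` along the geodesic, with `df(v) ≥ κ √g(v,v)` on future causal `v`;
integrating `df` bounds the length of every causal curve that stays in the neighbourhood. Strong
causality supplies causally convex neighbourhoods, so that no causal curve between nearby points of
the geodesic escapes. As the diamonds in strong causality are chronological and the competing curves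
only causal, this uses the push-up property and hence the openness of `I⁺`.

The cut locus is empty because a geodesic on `[0, b)` maximises beyond any `a < b`. For uniqueness,
let `σ` and `γ` run from `x` to `y`; they have the same speed, namely `ℓ(x, y)`. Extend `γ` a little
beyond `y`. The extension still maximises, so following `σ` and then the extension of `γ` also
maximises, and a corner at `y` could be cut by a longer chord, by the strict reverse triangle
inequality. Hence the velocities at `y` agree, and uniqueness for the geodesic equation, propagated
along the connected interval, gives `σ = γ`. Past-directed statements follow by reversing the time
orientation (`dual`). -/

/-! ### Lorentzian bilinear forms -/

section Lorentzian

variable {E : Type*} [NormedAddCommGroup E] [NormedSpace ℝ E]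

/-- A symmetric bilinear form of signature `(+, -, …, -)`. -/
structure IsLorentzian (B : E →L[ℝ] E →L[ℝ] ℝ) : Prop where
  symm : ∀ v w, B v w = B w v
  signature : ∃ e, 0 < B e e ∧ ∀ v, B e v = 0 → v ≠ 0 → B v v < 0

namespace IsLorentzian

variable {B : E →L[ℝ] E →L[ℝ] ℝ} (hB : IsLorentzian B)
include hB

/-- The signature is given by one vector `e`; this transfers it to any timelike `T`. If `w` were
nonzero with `B w w ≥ 0`, subtracting a multiple of `w` from `T` would produce a nonzero vector
orthogonal to `e` of positive square. -/
lemma neg_of_orthogonal {T w : E} (hT : 0 < B T T) (hw : B T w = 0) (hw0 : w ≠ 0) :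
    B w w < 0 := by
  obtain ⟨e, he, hneg⟩ := hB.signature
  by_contra! hww
  have hwT : B w T = 0 := by rw [hB.symm, hw]
  by_cases h : B e w = 0
  · exact absurd (hneg w h hw0) (not_lt.2 hww)
  · set u := T - (B e T / B e w) • w with hu
    have h1 : B e u = 0 := by
      simp [hu, div_mul_cancel₀ _ h]
    have h2 : B T u = B T T := by simp [hu, hw]
    have h3 : u ≠ 0 := by
      intro h0
      rw [h0, map_zero] at h2
      exact hT.ne h2
    have h4 : B u u = B T T + (B e T / B e w) ^ 2 * B w w := by
      simp only [hu, map_sub, map_smul, _root_.sub_apply,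
        _root_.smul_apply, smul_eq_mul, hw, hwT]
      ring
    have := hneg u h1 h3
    rw [h4] at this
    nlinarith [mul_nonneg (sq_nonneg (B e T / B e w)) hww]

lemma nonpos_of_orthogonal {T w : E} (hT : 0 < B T T) (hw : B T w = 0) : B w w ≤ 0 := by
  by_cases h : w = 0
  · simp [h]
  · exact (hB.neg_of_orthogonal hT hw h).le

lemma apply_decomp {T : E} (hT : 0 < B T T) (v : E) :
    B v v = (B T v) ^ 2 / B T T +
      B (v - (B T v / B T T) • T) (v - (B T v / B T T) • T) := by
  have := hT.ne'
  simp only [map_sub, map_smul, _root_.sub_apply,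
    _root_.smul_apply, smul_eq_mul, hB.symm v T]
  field_simp
  ring

omit hB in
lemma orthogonal_decomp {T : E} (hT : 0 < B T T) (v : E) :
    B T (v - (B T v / B T T) • T) = 0 := by
  simp [div_mul_cancel₀ _ hT.ne']

/-- The reverse Cauchy–Schwarz inequality. -/
lemma mul_le_sq {T : E} (hT : 0 < B T T) (v : E) : B T T * B v v ≤ (B T v) ^ 2 := by
  have h1 := hB.apply_decomp hT v
  have h2 := hB.nonpos_of_orthogonal hT (orthogonal_decomp hT v)
  have h3 : B v v ≤ (B T v) ^ 2 / B T T := by linarith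
  rw [le_div_iff₀ hT] at h3
  linarith

/-- The defect in the reverse Cauchy–Schwarz inequality is, up to a factor, minus the square of the
component of `v` orthogonal to `T`, on which the form is negative definite. -/
lemma eq_smul_of_sq_le {T v : E} (hT : 0 < B T T) (h : (B T v) ^ 2 ≤ B T T * B v v) :
    v = (B T v / B T T) • T := by
  by_contra hv
  have h1 := hB.apply_decomp hT v
  have h2 := hB.neg_of_orthogonal hT (orthogonal_decomp hT v) (sub_ne_zero.2 hv)
  have h3 : B v v < (B T v) ^ 2 / B T T := by linarith
  rw [lt_div_iff₀ hT] at h3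
  linarith

/-- A timelike and a nonzero causal vector in the same half cone have positive product. -/
lemma pos_of_future {X T v : E} (hX : 0 < B X X) (hT : 0 < B T T) (hTX : 0 ≤ B T X)
    (hv : 0 ≤ B v v) (hvX : 0 ≤ B v X) (hv0 : v ≠ 0) : 0 < B T v := by
  have hTX' : 0 < B T X := by
    refine lt_of_le_of_ne hTX fun h ↦ ?_
    have := hB.nonpos_of_orthogonal hX (w := T) (by rw [hB.symm, ← h])
    linarith
  by_contra! h
  -- This `s` makes `v + s • X` orthogonal to `T`, hence of negative square or zero, whereas adding
  -- a nonnegative multiple of `X` keeps `v` causal.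
  set s := -(B T v) / B T X with hs
  have hs0 : 0 ≤ s := div_nonneg (by linarith) hTX
  have h1 : B T (v + s • X) = 0 := by
    simp only [map_add, map_smul, smul_eq_mul, hs]
    field_simp
    ring
  have h2 : B (v + s • X) (v + s • X) = B v v + 2 * s * B v X + s ^ 2 * B X X := by
    simp only [map_add, map_smul, smul_eq_mul, _root_.add_apply,
      _root_.smul_apply, hB.symm X v]
    ring
  have h4 : 0 ≤ 2 * s * B v X := by positivity
  have h5 : 0 ≤ s ^ 2 * B X X := by positivity
  by_cases h3 : v + s • X = 0
  · have h6 : B (v + s • X) (v + s • X) = 0 := by simp [h3]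
    have h7 : s ^ 2 * B X X = 0 := by linarith
    have h8 : s = 0 := by simpa [hX.ne'] using h7
    exact hv0 (by simpa [h8] using h3)
  · have := hB.neg_of_orthogonal hT h1 h3
    linarith

/-- The strict reverse triangle inequality. -/
lemma exists_smul_of_norm_add_le {X u v : E} (hX : 0 < B X X) (hu : 0 < B u u) (huX : 0 ≤ B u X)
    (hv : 0 < B v v) (hvX : 0 ≤ B v X)
    (h : √(B (u + v) (u + v)) ≤ √(B u u) + √(B v v)) : ∃ k : ℝ, 0 < k ∧ v = k • u := by
  have hv0 : v ≠ 0 := by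
    rintro rfl
    simp at hv
  have huv : 0 < B u v := hB.pos_of_future hX hu huX hv.le hvX hv0
  refine ⟨B u v / B u u, div_pos huv hu, hB.eq_smul_of_sq_le hu ?_⟩
  have h1 : B (u + v) (u + v) = B u u + B v v + 2 * B u v := by
    simp only [map_add, _root_.add_apply, hB.symm v u]
    ring
  -- Squaring bounds the cross term `B u v` from above, which is the equality case of reverse
  -- Cauchy–Schwarz.
  have h2 := (Real.sqrt_le_left (by positivity)).1 h
  have h3 := Real.sq_sqrt hu.le
  have h4 := Real.sq_sqrt hv.le
  have h5 : B u v ≤ √(B u u) * √(B v v) := by nlinarith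
  calc (B u v) ^ 2 ≤ (√(B u u) * √(B v v)) ^ 2 := by gcongr
    _ = B u u * B v v := by rw [mul_pow, h3, h4]

/-- The Riemannian form obtained by flipping the sign on the orthogonal complement of `T`. -/
lemma flip_pos {T v : E} (hT : 0 < B T T) (hv : v ≠ 0) :
    0 < 2 * (B T v) ^ 2 - B T T * B v v := by
  have h := hB.mul_le_sq hT v
  by_cases h0 : B T v = 0
  · have := hB.neg_of_orthogonal hT h0 hv
    rw [h0]
    nlinarith
  · have := sq_pos_of_ne_zero h0
    linarith

lemma injective : Function.Injective B := by
  rw [injective_iff_map_eq_zero]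
  intro v hv
  obtain ⟨e, he, hneg⟩ := hB.signature
  by_contra h0
  have := hneg v (by rw [hB.symm, hv]; rfl) h0
  simp [hv] at this

end IsLorentzian

open Filter Topology in
/-- A continuous family of quadratic forms which is positive definite on `H` at `z₀` is uniformly so
near `z₀`. -/
lemma eventually_mul_sq_le [FiniteDimensional ℝ E] {Z : Type*} [TopologicalSpace Z] {z₀ : Z}
    {F : Z → E → ℝ} (H : Submodule ℝ E)
    (hF : ∀ v, ContinuousAt (fun q : Z × E ↦ F q.1 q.2) (z₀, v))
    (hsmul : ∀ z (c : ℝ) v, F z (c • v) = c ^ 2 * F z v) (hpos : ∀ v ∈ H, v ≠ 0 → 0 < F z₀ v) :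
    ∃ δ > 0, ∀ᶠ z in 𝓝 z₀, ∀ v ∈ H, δ * ‖v‖ ^ 2 ≤ F z v := by
  -- By homogeneity only the unit sphere of `H` matters. It is compact, so half the minimum at `z₀`
  -- remains a lower bound on it for all nearby `z`.
  have hK : IsCompact (Metric.sphere (0 : E) 1 ∩ H) :=
    (isCompact_sphere 0 1).inter_right (Submodule.closed_of_finiteDimensional H)
  obtain ⟨δ, hδ, hle⟩ : ∃ δ > 0, ∀ v ∈ Metric.sphere (0 : E) 1 ∩ H, δ < F z₀ v := by
    rcases (Metric.sphere (0 : E) 1 ∩ H).eq_empty_or_nonempty with he | hne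
    · exact ⟨1, one_pos, by simp [he]⟩
    · have hc : Continuous (F z₀) := continuous_iff_continuousAt.2 fun v ↦
        ContinuousAt.comp (f := fun v ↦ (z₀, v)) (hF v) (by fun_prop)
      obtain ⟨v, hv, hmin⟩ := hK.exists_isMinOn hne hc.continuousOn
      have hv0 : 0 < F z₀ v := hpos v hv.2 <| by
        rintro rfl
        simp at hv
      exact ⟨F z₀ v / 2, half_pos hv0, fun w hw ↦ (half_lt_self hv0).trans_le (hmin hw)⟩
  refine ⟨δ, hδ, ?_⟩
  have h := hK.eventually_forall_of_forall_eventually (x₀ := z₀) (P := fun z v ↦ δ < F z v)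
    fun v hv ↦ (hF v).eventually_const_lt (hle v hv)
  filter_upwards [h] with z hz v hv
  rcases eq_or_ne v 0 with rfl | h0
  · have := hsmul z 0 0
    simp at this
    simp [this]
  · have hn : ‖v‖ ≠ 0 := norm_ne_zero_iff.2 h0
    have h1 := hz (‖v‖⁻¹ • v) ⟨by simp [norm_smul, hn], H.smul_mem _ hv⟩
    rw [hsmul] at h1
    have h2 := mul_le_mul_of_nonneg_right h1.le (sq_nonneg ‖v‖)
    field_simp at h2
    exact h2

end Lorentzian

/-! ### Properties of intervals that are local and can be glued along overlaps -/

/-- Induction on the continuum: the supremum of the `u` with `Q a u` cannot stop before `b`. The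
overlap `q < r` in `hglue` is required to be strict because gluing time separations divides by the
separation across the overlap. -/
lemma interval_property_of_local {Q : ℝ → ℝ → Prop} {a b : ℝ} (hab : a < b)
    (hloc : ∀ t ∈ Icc a b, ∃ ε > 0, ∀ s ∈ Icc a b, ∀ u ∈ Icc a b, s < u → t - ε ≤ s → u ≤ t + ε →
      Q s u)
    (hglue : ∀ p q r s, a ≤ p → p ≤ q → q < r → r ≤ s → s ≤ b → Q p r → Q q s → Q p s) :
    Q a b := by
  set A := {u | u ∈ Ioc a b ∧ Q a u} with hA
  have hne : A.Nonempty := by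
    obtain ⟨ε, hε, h⟩ := hloc a (left_mem_Icc.2 hab.le)
    have h1 : a < min (a + ε) b := lt_min (by linarith) hab
    exact ⟨min (a + ε) b, ⟨h1, min_le_right _ _⟩,
      h a (left_mem_Icc.2 hab.le) _ ⟨h1.le, min_le_right _ _⟩ h1 (by linarith) (min_le_left _ _)⟩
  have hbdd : BddAbove A := ⟨b, fun u hu ↦ hu.1.2⟩
  set c := sSup A with hc
  obtain ⟨u₀, hu₀⟩ := hne
  have hac : a < c := hu₀.1.1.trans_le (le_csSup hbdd hu₀)
  have hcb : c ≤ b := csSup_le ⟨u₀, hu₀⟩ fun u hu ↦ hu.1.2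
  obtain ⟨ε, hε, h⟩ := hloc c ⟨hac.le, hcb⟩
  obtain ⟨u, hu, huc⟩ := exists_lt_of_lt_csSup ⟨u₀, hu₀⟩ (show c - ε < c by linarith)
  have huc' : u ≤ c := le_csSup hbdd hu
  set s := max a (c - ε) with hs
  have hsu : s < u := max_lt hu.1.1 huc
  set v := min b (c + ε) with hv
  have hcv : c ≤ v := le_min hcb (by linarith)
  have hQ : Q s v := h s ⟨le_max_left _ _, (hsu.le.trans huc').trans hcb⟩ v
    ⟨hac.le.trans hcv, min_le_left _ _⟩ (hsu.trans_le (huc'.trans hcv)) (le_max_right _ _)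
    (min_le_right _ _)
  have hQ' : Q a v := hglue a s u v le_rfl (le_max_left _ _) hsu (huc'.trans hcv)
    (min_le_left _ _) hu.2 hQ
  have hvA : v ∈ A := ⟨⟨hac.trans_le hcv, min_le_left _ _⟩, hQ'⟩
  have : v ≤ c := le_csSup hbdd hvA
  have hvb : v = b := by
    rcases min_choice b (c + ε) with h | h
    · exact h
    · rw [← hv] at h
      linarith
  rwa [← hvb]

/-! ### Piecewise `C¹` paths on arbitrary intervals -/

namespace Spacetime

variable {E : Type*} [NormedAddCommGroup E] [NormedSpace ℝ E]
  {M : Type*} [TopologicalSpace M] [ChartedSpace E M]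

lemma velocity_congr {γ δ : ℝ → M} {J : Set ℝ} (h : EqOn γ δ J) {t : ℝ} (ht : t ∈ J) :
    (velocity (E := E) γ J t : E) = velocity (E := E) δ J t := by
  unfold velocity
  rw [mfderivWithin_congr (I := 𝓘(ℝ, ℝ)) (I' := 𝓘(ℝ, E)) h (h ht)]
  rfl

lemma velocity_congr_set (γ : ℝ → M) {J K : Set ℝ} {t : ℝ} (h : J =ᶠ[nhds t] K) :
    velocity (E := E) γ J t = velocity (E := E) γ K t := by
  unfold velocity
  rw [mfderivWithin_congr_set h]

lemma velocity_Icc_eq_of_mem_Ioo (γ : ℝ → M) {a b c d t : ℝ} (h₁ : t ∈ Ioo a b)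
    (h₂ : t ∈ Ioo c d) : velocity (E := E) γ (Icc a b) t = velocity (E := E) γ (Icc c d) t :=
  velocity_congr_set γ <| by
    filter_upwards [Ioo_mem_nhds h₁.1 h₁.2, Ioo_mem_nhds h₂.1 h₂.2] with s hs hs'
    exact propext ⟨fun _ ↦ Ioo_subset_Icc_self hs', fun _ ↦ Ioo_subset_Icc_self hs⟩

lemma velocity_mono {γ : ℝ → M} {J K : Set ℝ} (hJK : J ⊆ K) {t : ℝ}
    (hJ : UniqueDiffWithinAt ℝ J t) (hγ : MDifferentiableWithinAt 𝓘(ℝ, ℝ) 𝓘(ℝ, E) γ K t) :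
    velocity (E := E) γ J t = velocity (E := E) γ K t := by
  unfold velocity
  rw [mfderivWithin_subset hJK hJ.uniqueMDiffWithinAt hγ]

lemma hasMFDerivWithinAt_affine (k m : ℝ) (J : Set ℝ) (t : ℝ) :
    HasMFDerivWithinAt 𝓘(ℝ, ℝ) 𝓘(ℝ, ℝ) (fun t : ℝ ↦ k * t + m) J t
      (ContinuousLinearMap.toSpanSingleton ℝ k) := by
  have h : HasDerivAt (fun t : ℝ ↦ k * t + m) k t := by
    simpa using ((hasDerivAt_id t).const_mul k).add_const m
  exact h.hasDerivWithinAt.hasFDerivWithinAt.hasMFDerivWithinAt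

lemma velocity_comp_affine (γ : ℝ → M) {k : ℝ} (hk : k ≠ 0) (m : ℝ) {J K : Set ℝ}
    (hKJ : K = (fun t ↦ k * t + m) ⁻¹' J) {t : ℝ} (hK : UniqueDiffWithinAt ℝ K t) :
    (velocity (E := E) (fun t ↦ γ (k * t + m)) K t : E)
      = k • (velocity (E := E) γ J (k * t + m) : E) := by
  set φ : ℝ → ℝ := fun t ↦ k * t + m with hφ
  by_cases h : MDifferentiableWithinAt 𝓘(ℝ, ℝ) 𝓘(ℝ, E) γ J (φ t)
  · have h1 := (h.hasMFDerivWithinAt.comp t (hasMFDerivWithinAt_affine k m K t)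
      (by rw [hKJ])).mfderivWithin hK.uniqueMDiffWithinAt
    change mfderivWithin 𝓘(ℝ, ℝ) 𝓘(ℝ, E) (γ ∘ φ) K t (1 : ℝ) =
      k • mfderivWithin 𝓘(ℝ, ℝ) 𝓘(ℝ, E) γ J (φ t) (1 : ℝ)
    rw [h1]
    change mfderivWithin 𝓘(ℝ, ℝ) 𝓘(ℝ, E) γ J (φ t) ((1 : ℝ) • k) = _
    set D : ℝ →L[ℝ] E := mfderivWithin 𝓘(ℝ, ℝ) 𝓘(ℝ, E) γ J (φ t)
    change D ((1 : ℝ) • k) = k • D 1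
    rw [← map_smul, smul_eq_mul, smul_eq_mul, mul_comm]
  -- Without differentiability both velocities take the default value `0`, so lengths can be
  -- reparametrised for arbitrary curves.
  · have h' : ¬ MDifferentiableWithinAt 𝓘(ℝ, ℝ) 𝓘(ℝ, E) (γ ∘ φ) K t := by
      intro h'
      apply h
      have ht : k⁻¹ * φ t + -(k⁻¹ * m) = t := by
        simp only [hφ]; field_simp; ring
      have h2 := (hasMFDerivWithinAt_affine k⁻¹ (-(k⁻¹ * m)) J (φ t)).mdifferentiableWithinAt
      have h3 : MDifferentiableWithinAt 𝓘(ℝ, ℝ) 𝓘(ℝ, E) (γ ∘ φ) K (k⁻¹ * φ t + -(k⁻¹ * m)) := by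
        rwa [ht]
      have hinv : ∀ s, φ (k⁻¹ * s + -(k⁻¹ * m)) = s := fun s ↦ by
        simp only [hφ]; field_simp; ring
      have h4 := h3.comp (φ t) h2 (fun s hs ↦ by
        rw [hKJ]
        change φ _ ∈ J
        rwa [hinv])
      convert! h4 using 1
      ext s
      simp [hinv]
    have e1 : velocity (E := E) (fun t ↦ γ (k * t + m)) K t = 0 := by
      change mfderivWithin 𝓘(ℝ, ℝ) 𝓘(ℝ, E) (γ ∘ φ) K t (1 : ℝ) = 0
      rw [mfderivWithin_zero_of_not_mdifferentiableWithinAt h']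
      rfl
    have e2 : velocity (E := E) γ J (φ t) = 0 := by
      change mfderivWithin 𝓘(ℝ, ℝ) 𝓘(ℝ, E) γ J (φ t) (1 : ℝ) = 0
      rw [mfderivWithin_zero_of_not_mdifferentiableWithinAt h]
      rfl
    change (velocity (E := E) (fun t ↦ γ (k * t + m)) K t : E)
      = k • (velocity (E := E) γ J (φ t) : E)
    rw [e1, e2]
    exact (smul_zero k).symm

/-- `γ|[a,b]` is `C¹`, and its velocities satisfy `P`. -/
def IsArc (P : ∀ p : M, TangentSpace 𝓘(ℝ, E) p → Prop) (γ : ℝ → M) (a b : ℝ) : Prop :=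
  ContMDiffOn 𝓘(ℝ, ℝ) 𝓘(ℝ, E) 1 γ (Icc a b) ∧
    ∀ t ∈ Icc a b, P (γ t) (velocity γ (Icc a b) t)

/-- `γ|[a,b]` is piecewise `C¹`, and its velocities satisfy `P`. -/
inductive IsPath (P : ∀ p : M, TangentSpace 𝓘(ℝ, E) p → Prop) (γ : ℝ → M) : ℝ → ℝ → Prop
  | arc {a b : ℝ} : a < b → IsArc P γ a b → IsPath P γ a b
  | snoc {a b c : ℝ} : IsPath P γ a b → b < c → IsArc P γ b c → IsPath P γ a c

variable {P P' : ∀ p : M, TangentSpace 𝓘(ℝ, E) p → Prop} {γ δ : ℝ → M} {a b c : ℝ}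

lemma vec_congr {p q : M} (h : p = q) {v w : E} (hvw : v = w) (hv : P p v) : P q w := by
  subst h hvw
  exact hv

lemma IsArc.congr (h : IsArc P γ a b) (hγδ : EqOn γ δ (Icc a b)) : IsArc P δ a b :=
  ⟨h.1.congr fun _ ht ↦ (hγδ ht).symm, fun t ht ↦
    vec_congr (P := P) (v := velocity (E := E) γ (Icc a b) t)
      (w := velocity (E := E) δ (Icc a b) t) (hγδ ht) (velocity_congr hγδ ht) (h.2 t ht)⟩

lemma IsArc.imp (h : IsArc P γ a b) (hP : ∀ p v, P p v → P' p v) : IsArc P' γ a b :=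
  ⟨h.1, fun t ht ↦ hP _ _ (h.2 t ht)⟩

lemma IsArc.mono (h : IsArc P γ a b) {s t : ℝ} (hs : a ≤ s) (hst : s < t) (ht : t ≤ b) :
    IsArc P γ s t := by
  have hsub : Icc s t ⊆ Icc a b := Icc_subset_Icc hs ht
  refine ⟨h.1.mono hsub, fun u hu ↦ ?_⟩
  rw [velocity_mono hsub (uniqueDiffOn_Icc hst u hu)
    ((h.1 u (hsub hu)).mdifferentiableWithinAt one_ne_zero)]
  exact h.2 u (hsub hu)

lemma IsArc.comp_affine (h : IsArc P γ a b) {k : ℝ} (hk : k ≠ 0) (m : ℝ) {a' b' : ℝ} (hab : a' < b')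
    (hI : Icc a' b' = (fun t ↦ k * t + m) ⁻¹' Icc a b) (hP : ∀ p (v : E), P p v → P' p (k • v)) :
    IsArc P' (fun t ↦ γ (k * t + m)) a' b' := by
  refine ⟨?_, fun t ht ↦ ?_⟩
  · refine h.1.comp (t := Icc a b) (s := Icc a' b') (f := fun t ↦ k * t + m) ?_ hI.subset
    exact (ContDiff.contMDiff (by fun_prop)).contMDiffOn
  · refine vec_congr (P := P') (q := γ (k * t + m)) rfl
      (velocity_comp_affine γ hk m hI (uniqueDiffOn_Icc hab t ht)).symm (hP _ _ (h.2 _ ?_))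
    rw [hI] at ht
    exact ht

lemma IsPath.lt (h : IsPath P γ a b) : a < b := by
  induction h with
  | arc h _ => exact h
  | snoc _ h _ ih => exact ih.trans h

lemma IsPath.trans (h : IsPath P γ a b) (h' : IsPath P γ b c) : IsPath P γ a c := by
  induction h' with
  | arc hlt h' => exact h.snoc hlt h'
  | snoc _ hlt h' ih => exact ih.snoc hlt h'

lemma IsPath.congr (h : IsPath P γ a b) (hγδ : EqOn γ δ (Icc a b)) : IsPath P δ a b := by
  induction h with
  | arc hlt h => exact .arc hlt (h.congr hγδ)
  | snoc h₁ hlt h ih =>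
    exact (ih (hγδ.mono (Icc_subset_Icc_right hlt.le))).snoc hlt
      (h.congr (hγδ.mono (Icc_subset_Icc_left h₁.lt.le)))

lemma IsPath.imp (h : IsPath P γ a b) (hP : ∀ p v, P p v → P' p v) : IsPath P' γ a b := by
  induction h with
  | arc hlt h => exact .arc hlt (h.imp hP)
  | snoc _ hlt h ih => exact ih.snoc hlt (h.imp hP)

lemma IsPath.mono_right (h : IsPath P γ a b) {t : ℝ} (hat : a < t) (htb : t ≤ b) :
    IsPath P γ a t := by
  induction h with
  | arc hlt h => exact .arc hat (h.mono le_rfl hat htb)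
  | snoc h₁ hlt h ih =>
    rename_i b' c'
    rcases le_or_gt t b' with htb' | htb'
    · exact ih htb'
    · exact h₁.snoc htb' (h.mono le_rfl htb' htb)

lemma IsPath.mono_left (h : IsPath P γ a b) {t : ℝ}
    (hat : a ≤ t) (htb : t < b) : IsPath P γ t b := by
  induction h with
  | arc hlt h => exact .arc htb (h.mono hat htb le_rfl)
  | snoc h₁ hlt h ih =>
    rename_i b' c'
    rcases lt_or_ge t b' with htb' | htb'
    · exact (ih htb').snoc hlt h
    · exact .arc htb (h.mono htb' htb le_rfl)

lemma preimage_affine_Icc {k : ℝ} (hk : 0 < k) (m a b : ℝ) :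
    Icc a b = (fun t ↦ k * t + m) ⁻¹' Icc (k * a + m) (k * b + m) := by
  ext t
  simp [hk]

lemma IsPath.comp_affine {a' b' : ℝ} (h : IsPath P γ a' b') {k : ℝ} (hk : 0 < k) (m : ℝ)
    (hP : ∀ p (v : E), P p v → P' p (k • v)) (ha : a' = k * a + m) (hb : b' = k * b + m) :
    IsPath P' (fun t ↦ γ (k * t + m)) a b := by
  induction h generalizing b with
  | arc hlt h =>
    subst ha hb
    have hlt : a < b := by nlinarith
    exact .arc hlt (h.comp_affine hk.ne' m hlt (preimage_affine_Icc hk m a b) hP)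
  | snoc h₁ hlt h ih =>
    rename_i b₁ c₁
    have hb₁ : b₁ = k * ((b₁ - m) / k) + m := by field_simp; ring
    have hlt' : (b₁ - m) / k < b := by
      rw [div_lt_iff₀ hk]
      linarith
    refine (ih hb₁).snoc hlt' (h.comp_affine hk.ne' m hlt' ?_ hP)
    rw [hb]
    nth_rw 2 [hb₁]
    exact preimage_affine_Icc hk m _ _

lemma IsPath.comp_sub_left {a b : ℝ} (h : IsPath P γ a b) (m : ℝ)
    (hP : ∀ p (v : E), P p v → P' p (-v)) : IsPath P' (fun t ↦ γ (m - t)) (m - b) (m - a) := by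
  have key : ∀ {a b : ℝ}, a < b → IsArc P γ a b →
      IsPath P' (fun t ↦ γ (m - t)) (m - b) (m - a) := fun {a b} hlt h ↦ by
    have := h.comp_affine (P' := P') (k := -1) (by norm_num) m (a' := m - b) (b' := m - a)
      (by linarith) (by ext t; simp only [mem_Icc, mem_preimage]; constructor <;>
        (intro h; constructor <;> linarith [h.1, h.2])) (by simpa using hP)
    refine .arc (by linarith) (this.congr fun t _ ↦ ?_)
    change γ _ = γ _
    congr 1
    ring
  induction h with
  | arc hlt h => exact key hlt h
  | snoc _ hlt h ih => exact (key hlt h).trans ih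

/-- The inductive predicate replaces subdivisions indexed by `Fin`, so that restriction,
concatenation and estimates reduce to one arc at a time. -/
lemma isPiecewiseC1With_iff : IsPiecewiseC1With P γ ↔ IsPath P γ 0 1 := by
  constructor
  · rintro ⟨n, τ, hτ, h0, h1, h⟩
    have key : ∀ i : Fin (n + 1), i ≠ 0 → IsPath P γ (τ 0) (τ i) := by
      intro i
      induction i using Fin.induction with
      | zero => exact fun h ↦ absurd rfl h
      | succ i ih =>
        intro _
        have hlt : τ i.castSucc < τ i.succ := hτ i.castSucc_lt_succ
        by_cases hi : i.castSucc = 0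
        · have := h i
          rw [hi] at this hlt
          exact .arc hlt this
        · exact (ih hi).snoc hlt (h i)
    have hn : Fin.last n ≠ 0 := by
      intro hn
      rw [hn, h0] at h1
      exact zero_ne_one h1
    have := key _ hn
    rwa [h0, h1] at this
  · have key : ∀ {a b : ℝ}, IsPath P γ a b → ∃ (n : ℕ) (τ : Fin (n + 1) → ℝ), StrictMono τ ∧
        τ 0 = a ∧ τ (Fin.last n) = b ∧
        ∀ i : Fin n, IsArc P γ (τ i.castSucc) (τ i.succ) := by
      intro a b h
      induction h with
      | arc hlt h =>
        rename_i b
        refine ⟨1, ![a, b], ?_, rfl, rfl, fun i ↦ ?_⟩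
        · rw [Fin.strictMono_iff_lt_succ]
          intro i
          fin_cases i
          exact hlt
        · fin_cases i
          exact h
      | snoc _ hlt h ih =>
        rename_i b c _
        obtain ⟨n, τ, hτ, h0, h1, hi⟩ := ih
        refine ⟨n + 1, Fin.snoc τ c, ?_, ?_, ?_, fun i ↦ ?_⟩
        · rw [Fin.strictMono_iff_lt_succ]
          intro i
          induction i using Fin.lastCases with
          | last =>
            rw [Fin.succ_last, Fin.snoc_last, Fin.snoc_castSucc, h1]
            exact hlt
          | cast i =>
            rw [← Fin.castSucc_succ, Fin.snoc_castSucc, Fin.snoc_castSucc]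
            exact hτ i.castSucc_lt_succ
        · rw [← Fin.castSucc_zero, Fin.snoc_castSucc, h0]
        · rw [Fin.snoc_last]
        · induction i using Fin.lastCases with
          | last =>
            rw [Fin.succ_last, Fin.snoc_last, Fin.snoc_castSucc, h1]
            exact h
          | cast i =>
            rw [← Fin.castSucc_succ, Fin.snoc_castSucc, Fin.snoc_castSucc]
            exact hi i
    intro h
    obtain ⟨n, τ, hτ, h0, h1, hi⟩ := key h
    exact ⟨n, τ, hτ, h0, h1, hi⟩

/-- Concatenation of two paths. -/
lemma IsPath.piecewise (h : IsPath P γ a b) (h' : IsPath P δ b c) (hb : γ b = δ b) :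
    IsPath P (fun t ↦ if t ≤ b then γ t else δ t) a c := by
  refine (h.congr fun t ht ↦ ?_).trans (h'.congr fun t ht ↦ ?_)
  · simp [ht.2]
  · rcases ht.1.eq_or_lt with rfl | hlt
    · simp [hb]
    · simp [hlt.not_ge]

lemma IsArc.continuousOn (h : IsArc P γ a b) : ContinuousOn γ (Icc a b) := h.1.continuousOn

/-! ### Length -/

variable [IsManifold 𝓘(ℝ, E) ∞ M] (S : Spacetime E M)

/-- Removing the end points costs nothing in the integral, and in the interior the velocity no
longer depends on the interval; hence length is additive with no regularity assumed. -/
lemma length_eq_Ioo (γ : ℝ → M) (a b : ℝ) : S.length γ a b =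
    ∫⁻ t in Ioo a b, ENNReal.ofReal (S.hyperbolicNorm (γ t) (velocity γ (Icc a b) t)) := by
  rw [length, restrict_Ioo_eq_restrict_Icc]

lemma length_add (γ : ℝ → M) (hab : a ≤ b) (hbc : b ≤ c) :
    S.length γ a b + S.length γ b c = S.length γ a c := by
  have h : S.length γ a c =
      ∫⁻ t in Ioc a c, ENNReal.ofReal (S.hyperbolicNorm (γ t) (velocity γ (Icc a c) t)) := by
    rw [length, restrict_Ioc_eq_restrict_Icc]
  rw [h, ← Ioc_union_Ioc_eq_Ioc hab hbc, lintegral_union measurableSet_Ioc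
    (Ioc_disjoint_Ioc_of_le le_rfl), ← restrict_Ioo_eq_restrict_Ioc,
    ← restrict_Ioo_eq_restrict_Ioc, length_eq_Ioo, length_eq_Ioo]
  congr 1
  · refine setLIntegral_congr_fun measurableSet_Ioo fun t ht ↦ ?_
    rw [velocity_Icc_eq_of_mem_Ioo γ ht ⟨ht.1, ht.2.trans_le hbc⟩]
  · refine setLIntegral_congr_fun measurableSet_Ioo fun t ht ↦ ?_
    rw [velocity_Icc_eq_of_mem_Ioo γ ht ⟨hab.trans_lt ht.1, ht.2⟩]

lemma hyperbolicNorm_congr {p q : M} (h : p = q) {v w : E} (hvw : v = w) :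
    S.hyperbolicNorm p v = S.hyperbolicNorm q w := by
  subst h hvw
  rfl

lemma length_congr (h : EqOn γ δ (Icc a b)) : S.length γ a b = S.length δ a b := by
  refine setLIntegral_congr_fun measurableSet_Icc fun t ht ↦ ?_
  rw [S.hyperbolicNorm_congr (h ht) (velocity_congr h ht)]

/-- Two spacetimes occur so that one change of variables serves both orientation-preserving
rescaling, with `S' = S`, and time reversal, with `k = -1` and `S'` the dual. -/
lemma length_comp_affine (S' : Spacetime E M) (γ : ℝ → M) {k : ℝ} (hk : k ≠ 0) (m : ℝ)
    {a' b' : ℝ} (hab : a' < b') (hI : Icc a' b' = (fun t ↦ k * t + m) ⁻¹' Icc a b)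
    (hS : ∀ p (v : E), S'.hyperbolicNorm p (k • v) = |k| * S.hyperbolicNorm p v) :
    S'.length (fun t ↦ γ (k * t + m)) a' b' = S.length γ a b := by
  have himg : (fun t ↦ k * t + m) '' Icc a' b' = Icc a b := by
    rw [hI, image_preimage_eq]
    intro s
    exact ⟨(s - m) / k, by field_simp; ring⟩
  unfold length
  rw [← himg, lintegral_image_eq_lintegral_abs_deriv_mul (f' := fun _ ↦ k) measurableSet_Icc]
  · refine setLIntegral_congr_fun measurableSet_Icc fun t ht ↦ ?_
    dsimp only
    rw [himg, ← ENNReal.ofReal_mul (abs_nonneg k), S'.hyperbolicNorm_congr rfl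
      (velocity_comp_affine γ hk m hI (uniqueDiffOn_Icc hab t ht))]
    exact congrArg ENNReal.ofReal (hS (γ (k * t + m)) _)
  · intro t _
    simpa using (((hasDerivAt_id t).const_mul k).add_const m).hasDerivWithinAt
  · intro s _ t _ h
    simpa [hk] using h

/-- The metric at `p`, as a form on the model space. -/
def form (p : M) : E →L[ℝ] E →L[ℝ] ℝ := S.g p

/-- The time orientation at `p`, as a vector of the model space. -/
def orient (p : M) : E := S.X p

variable {S}

lemma futureCausalVec_iff {p : M} {v : E} :
    S.FutureCausalVec p v ↔ 0 ≤ S.form p v v ∧ 0 ≤ S.form p v (S.orient p) := Iff.rfl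

lemma futureTimelikeVec_iff {p : M} {v : E} :
    S.FutureTimelikeVec p v ↔ 0 < S.form p v v ∧ 0 ≤ S.form p v (S.orient p) := Iff.rfl

lemma hyperbolicNorm_of_futureCausalVec {p : M} {v : E} (h : S.FutureCausalVec p v) :
    S.hyperbolicNorm p v = √(S.form p v v) := if_pos h

lemma hyperbolicNorm_of_not_futureCausalVec {p : M} {v : E} (h : ¬ S.FutureCausalVec p v) :
    S.hyperbolicNorm p v = 0 := if_neg h

lemma FutureTimelikeVec.futureCausalVec {p : M} {v : E} (h : S.FutureTimelikeVec p v) :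
    S.FutureCausalVec p v := ⟨h.1.le, h.2⟩

lemma FutureCausalVec.smul {p : M} {v : E} (h : S.FutureCausalVec p v) {k : ℝ} (hk : 0 ≤ k) :
    S.FutureCausalVec p (k • v : E) := by
  rw [futureCausalVec_iff] at h ⊢
  simp only [map_smul, _root_.smul_apply, smul_eq_mul]
  exact ⟨mul_nonneg hk (mul_nonneg hk h.1), mul_nonneg hk h.2⟩

lemma FutureTimelikeVec.smul {p : M} {v : E} (h : S.FutureTimelikeVec p v) {k : ℝ} (hk : 0 < k) :
    S.FutureTimelikeVec p (k • v : E) := by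
  rw [futureTimelikeVec_iff] at h ⊢
  simp only [map_smul, _root_.smul_apply, smul_eq_mul]
  exact ⟨mul_pos hk (mul_pos hk h.1), mul_nonneg hk.le h.2⟩

lemma hyperbolicNorm_smul {p : M} (v : E) {k : ℝ} (hk : 0 < k) :
    S.hyperbolicNorm p (k • v : E) = k * S.hyperbolicNorm p v := by
  have e1 : S.form p (k • v) (k • v) = k ^ 2 * S.form p v v := by
    simp only [map_smul, _root_.smul_apply, smul_eq_mul]
    ring
  have h : S.FutureCausalVec p (k • v : E) ↔ S.FutureCausalVec p v := by
    refine ⟨fun h ↦ ?_, fun h ↦ h.smul hk.le⟩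
    have := h.smul (inv_nonneg.2 hk.le)
    rwa [inv_smul_smul₀ hk.ne'] at this
  by_cases hv : S.FutureCausalVec p v
  · rw [hyperbolicNorm_of_futureCausalVec hv, hyperbolicNorm_of_futureCausalVec (h.2 hv), e1,
      Real.sqrt_mul (sq_nonneg k), Real.sqrt_sq hk.le]
  · rw [hyperbolicNorm_of_not_futureCausalVec hv,
      hyperbolicNorm_of_not_futureCausalVec fun h' ↦ hv (h.1 h'), mul_zero]

/-! ### Causal relations and time separation -/

variable {x y z : M}

lemma isFutureCausalCurve_iff :
    S.IsFutureCausalCurve γ x y ↔ IsPath S.FutureCausalVec γ 0 1 ∧ γ 0 = x ∧ γ 1 = y := by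
  rw [IsFutureCausalCurve, isPiecewiseC1With_iff]

lemma isFutureTimelikeCurve_iff :
    S.IsFutureTimelikeCurve γ x y ↔ IsPath S.FutureTimelikeVec γ 0 1 ∧ γ 0 = x ∧ γ 1 = y := by
  rw [IsFutureTimelikeCurve, isPiecewiseC1With_iff]

lemma IsPath.rescale (h : IsPath P γ a b) (hP : ∀ p (v : E) (k : ℝ), 0 < k → P p v → P p (k • v))
    {a' b' : ℝ} (hab' : a' < b') : ∃ δ : ℝ → M, IsPath P δ a' b' ∧ δ a' = γ a ∧ δ b' = γ b ∧
      ∀ S : Spacetime E M, S.length δ a' b' = S.length γ a b := by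
  have hab := h.lt
  set k := (b - a) / (b' - a') with hk
  have hk0 : 0 < k := div_pos (by linarith) (by linarith)
  have hd : b' - a' ≠ 0 := by linarith
  have e1 : k * a' + (a - k * a') = a := by ring
  have e2 : k * b' + (a - k * a') = b := by
    have : k * (b' - a') = b - a := div_mul_cancel₀ _ hd
    linarith
  refine ⟨fun t ↦ γ (k * t + (a - k * a')), ?_, by simp only [e1], by simp only [e2], fun S ↦ ?_⟩
  · exact h.comp_affine hk0 (a - k * a') (fun p v ↦ hP p v k hk0) e1.symm e2.symm
  · refine S.length_comp_affine S γ hk0.ne' _ hab' ?_ fun p v ↦ ?_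
    · rw [preimage_affine_Icc hk0 (a - k * a'), e1, e2]
    · rw [hyperbolicNorm_smul v hk0, abs_of_pos hk0]

lemma le_timeSep_of_isPath (h : IsPath S.FutureCausalVec γ a b) :
    S.CausalLE (γ a) (γ b) ∧ S.length γ a b ≤ S.timeSep (γ a) (γ b) := by
  obtain ⟨δ, hδ, h0, h1, hl⟩ := h.rescale (fun p v k hk hv ↦ FutureCausalVec.smul hv hk.le)
    zero_lt_one
  have hc : S.IsFutureCausalCurve δ (γ a) (γ b) := isFutureCausalCurve_iff.2 ⟨hδ, h0, h1⟩
  refine ⟨⟨δ, hc⟩, ?_⟩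
  rw [← hl S]
  exact le_iSup₂ (f := fun γ _ ↦ S.length γ 0 1) δ hc

lemma chronLT_of_isPath (h : IsPath S.FutureTimelikeVec γ a b) : S.ChronLT (γ a) (γ b) := by
  obtain ⟨δ, hδ, h0, h1, hl⟩ := h.rescale (fun p v k hk hv ↦ FutureTimelikeVec.smul hv hk)
    zero_lt_one
  exact ⟨δ, isFutureTimelikeCurve_iff.2 ⟨hδ, h0, h1⟩⟩

lemma ChronLT.exists_path (h : S.ChronLT x y) {a b : ℝ} (hab : a < b) :
    ∃ γ : ℝ → M, IsPath S.FutureTimelikeVec γ a b ∧ γ a = x ∧ γ b = y := by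
  obtain ⟨γ, hγ⟩ := h
  obtain ⟨hγ', rfl, rfl⟩ := isFutureTimelikeCurve_iff.1 hγ
  obtain ⟨δ, hδ, h0, h1, hl⟩ := hγ'.rescale (fun p v k hk hv ↦ FutureTimelikeVec.smul hv hk) hab
  exact ⟨δ, hδ, h0, h1⟩

lemma exists_path_of_isFutureCausalCurve (h : S.IsFutureCausalCurve γ x y) {a b : ℝ}
    (hab : a < b) : ∃ δ : ℝ → M, IsPath S.FutureCausalVec δ a b ∧ δ a = x ∧ δ b = y ∧
      S.length δ a b = S.length γ 0 1 := by
  obtain ⟨hγ, rfl, rfl⟩ := isFutureCausalCurve_iff.1 h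
  obtain ⟨δ, hδ, h0, h1, hl⟩ :=
    hγ.rescale (fun p v k hk hv ↦ FutureCausalVec.smul hv hk.le) hab
  exact ⟨δ, hδ, h0, h1, hl S⟩

lemma ChronLT.trans (h : S.ChronLT x y) (h' : S.ChronLT y z) : S.ChronLT x z := by
  obtain ⟨γ, hγ, rfl, rfl⟩ := h.exists_path zero_lt_one
  obtain ⟨δ, hδ, h0, rfl⟩ := h'.exists_path one_lt_two
  have := chronLT_of_isPath (hγ.piecewise hδ h0.symm)
  simpa using this

lemma timeSep_concat {γ δ : ℝ → M} (hγ : S.IsFutureCausalCurve γ x y)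
    (hδ : S.IsFutureCausalCurve δ y z) :
    S.CausalLE x z ∧ S.length γ 0 1 + S.length δ 0 1 ≤ S.timeSep x z := by
  obtain ⟨δ', hδ', h1, rfl, hl⟩ := exists_path_of_isFutureCausalCurve hδ one_lt_two
  obtain ⟨hγ', rfl, hy⟩ := isFutureCausalCurve_iff.1 hγ
  have h01 : γ 1 = δ' 1 := hy.trans h1.symm
  have hp := hγ'.piecewise hδ' h01
  have h2 := le_timeSep_of_isPath hp
  rw [← S.length_add _ zero_le_one one_le_two, S.length_congr (δ := γ) (b := 1),
    S.length_congr (δ := δ') (a := 1), hl] at h2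
  · simpa using h2
  · intro t ht
    rcases ht.1.eq_or_lt with rfl | hlt
    · simp [h01]
    · simp [hlt.not_ge]
  · intro t ht
    simp [ht.2]

lemma CausalLE.trans (h : S.CausalLE x y) (h' : S.CausalLE y z) : S.CausalLE x z := by
  obtain ⟨γ, hγ⟩ := h
  obtain ⟨δ, hδ⟩ := h'
  exact (timeSep_concat hγ hδ).1

/-- The reverse triangle inequality. -/
lemma timeSep_add_le (h : S.CausalLE x y) (h' : S.CausalLE y z) :
    S.timeSep x y + S.timeSep y z ≤ S.timeSep x z := by
  obtain ⟨γ, hγ⟩ := h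
  obtain ⟨δ, hδ⟩ := h'
  exact ENNReal.biSup_add_biSup_le ⟨γ, hγ⟩ ⟨δ, hδ⟩ fun γ hγ δ hδ ↦ (timeSep_concat hγ hδ).2

/-- The zero vector counts as future causal, so constant curves are admissible. -/
lemma CausalLE.refl (x : M) : S.CausalLE x x := by
  refine ⟨fun _ ↦ x, isFutureCausalCurve_iff.2 ⟨.arc zero_lt_one ⟨contMDiffOn_const, ?_⟩, rfl, rfl⟩⟩
  intro t _
  have h : velocity (E := E) (fun _ : ℝ ↦ x) (Icc 0 1) t = 0 := by
    unfold velocity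
    rw [mfderivWithin_const]
    rfl
  rw [h]
  constructor <;> simp [CausalVec]

/-! ### Time duality -/

/-- The spacetime with the opposite time orientation. -/
noncomputable def dual (S : Spacetime E M) : Spacetime E M where
  g := S.g
  g_symm := S.g_symm
  g_signature := S.g_signature
  g_smooth := S.g_smooth
  X p := -S.X p
  X_smooth := S.X_smooth.neg_section
  X_timelike p := by simpa using S.X_timelike p

lemma dual_dual : S.dual.dual = S := by
  cases S
  simp [dual]

lemma dual_form (p : M) : S.dual.form p = S.form p := rfl

lemma dual_orient (p : M) : S.dual.orient p = -S.orient p := rfl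

lemma dual_futureCausalVec_iff {p : M} {v : E} :
    S.dual.FutureCausalVec p (-v : E) ↔ S.FutureCausalVec p v := by
  simp [futureCausalVec_iff, dual_form, dual_orient]

lemma dual_futureTimelikeVec_iff {p : M} {v : E} :
    S.dual.FutureTimelikeVec p (-v : E) ↔ S.FutureTimelikeVec p v := by
  simp [futureTimelikeVec_iff, dual_form, dual_orient]

lemma dual_hyperbolicNorm {p : M} (v : E) :
    S.dual.hyperbolicNorm p (-v : E) = S.hyperbolicNorm p v := by
  by_cases hv : S.FutureCausalVec p v
  · rw [hyperbolicNorm_of_futureCausalVec hv,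
      hyperbolicNorm_of_futureCausalVec (dual_futureCausalVec_iff.2 hv)]
    simp [dual_form]
  · rw [hyperbolicNorm_of_not_futureCausalVec hv,
      hyperbolicNorm_of_not_futureCausalVec fun h ↦ hv (dual_futureCausalVec_iff.1 h)]

lemma dual_length {γ : ℝ → M} (hab : a < b) (m : ℝ) :
    S.dual.length (fun t ↦ γ (m - t)) (m - b) (m - a) = S.length γ a b := by
  rw [← S.length_comp_affine S.dual γ (k := -1) (by norm_num) m (a' := m - b) (b' := m - a)
      (by linarith) (by ext t; simp only [mem_Icc, mem_preimage]; constructor <;>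
        (intro h; constructor <;> linarith [h.1, h.2]))]
  · congr 1
    ext t
    congr 1
    ring
  · intro p v
    rw [show ((-1 : ℝ) • v : E) = -v by simp, dual_hyperbolicNorm]
    simp

lemma dual_isFutureCausalCurve (h : S.IsFutureCausalCurve γ x y) :
    S.dual.IsFutureCausalCurve (fun t ↦ γ (1 - t)) y x := by
  obtain ⟨h', rfl, rfl⟩ := isFutureCausalCurve_iff.1 h
  refine isFutureCausalCurve_iff.2 ⟨?_, by simp, by simp⟩
  have := h'.comp_sub_left (P' := S.dual.FutureCausalVec) 1
    fun p v hv ↦ dual_futureCausalVec_iff.2 hv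
  simpa using this

lemma dual_causalLE_iff : S.dual.CausalLE x y ↔ S.CausalLE y x := by
  -- Dualising is an involution, so one implication, proved for all spacetimes, yields the other.
  have key : ∀ {S : Spacetime E M} {x y : M}, S.CausalLE y x → S.dual.CausalLE x y :=
    fun ⟨γ, hγ⟩ ↦ ⟨_, dual_isFutureCausalCurve hγ⟩
  refine ⟨fun h ↦ ?_, key⟩
  have := key h
  rwa [dual_dual] at this

lemma dual_chronLT_iff : S.dual.ChronLT x y ↔ S.ChronLT y x := by
  have key : ∀ {S : Spacetime E M} {x y : M}, S.ChronLT y x → S.dual.ChronLT x y := by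
    rintro S x y ⟨γ, hγ⟩
    obtain ⟨h, rfl, rfl⟩ := isFutureTimelikeCurve_iff.1 hγ
    have := chronLT_of_isPath (h.comp_sub_left (P' := S.dual.FutureTimelikeVec) 1
      fun p v hv ↦ dual_futureTimelikeVec_iff.2 hv)
    simpa using this
  refine ⟨fun h ↦ ?_, key⟩
  have := key h
  rwa [dual_dual] at this

lemma dual_timeSep : S.dual.timeSep x y = S.timeSep y x := by
  have key : ∀ {S : Spacetime E M} {x y : M}, S.timeSep y x ≤ S.dual.timeSep x y := by
    intro S x y
    refine iSup₂_le fun γ hγ ↦ ?_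
    have h := dual_length (S := S) (γ := γ) zero_lt_one 1
    rw [sub_self, sub_zero] at h
    rw [← h]
    exact le_iSup₂ (f := fun γ _ ↦ S.dual.length γ 0 1) _ (dual_isFutureCausalCurve hγ)
  refine le_antisymm ?_ key
  have := key (S := S.dual) (x := y) (y := x)
  rwa [dual_dual] at this

lemma StronglyCausal.dual (h : S.StronglyCausal) : S.dual.StronglyCausal := by
  have e : {D | ∃ x y : M, D = {z | S.dual.ChronLT x z ∧ S.dual.ChronLT z y}} =
      {D | ∃ x y : M, D = {z | S.ChronLT x z ∧ S.ChronLT z y}} := by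
    ext D
    constructor <;> rintro ⟨x, y, rfl⟩ <;> refine ⟨y, x, ?_⟩ <;> ext z <;>
      simp [dual_chronLT_iff, and_comm]
  unfold StronglyCausal
  rw [e]
  exact h

lemma Ptolemaic.dual (h : S.Ptolemaic) : S.dual.Ptolemaic := by
  intro x y z w hxy hyz hzw
  have := h w z y x (dual_causalLE_iff.1 hzw) (dual_causalLE_iff.1 hyz) (dual_causalLE_iff.1 hxy)
  simp only [dual_timeSep]
  rw [mul_comm (S.timeSep z x)]
  rw [mul_comm (S.timeSep y x)]
  exact this

end Spacetime

/-! ### Lorentzian metrics on open subsets of the model space -/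

/-- A smooth Lorentzian metric `G` and a continuous timelike vector field `X` on the open subset `U`
of `E`. -/
structure IsLocalSpacetime {E : Type*} [NormedAddCommGroup E] [NormedSpace ℝ E] (U : Set E)
    (G : E → E →L[ℝ] E →L[ℝ] ℝ) (X : E → E) : Prop where
  isOpen : IsOpen U
  smooth : ContDiffOn ℝ ∞ G U
  lorentzian : ∀ x ∈ U, IsLorentzian (G x)
  continuousOn : ContinuousOn X U
  timelike : ∀ x ∈ U, 0 < G x (X x) (X x)

/-! ### The spacetime read in a chart -/

namespace Spacetime

variable {E : Type*} [NormedAddCommGroup E] [NormedSpace ℝ E]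
  {M : Type*} [TopologicalSpace M] [ChartedSpace E M] [IsManifold 𝓘(ℝ, E) ∞ M]
  (S : Spacetime E M) {e : OpenPartialHomeomorph M E}

/-- The differential of a chart. -/
noncomputable def chartDeriv (e : OpenPartialHomeomorph M E) (p : M) : E →L[ℝ] E :=
  mfderiv 𝓘(ℝ, E) 𝓘(ℝ, E) e p

/-- The differential of the inverse of a chart. -/
noncomputable def chartSymmDeriv (e : OpenPartialHomeomorph M E) (x : E) : E →L[ℝ] E :=
  mfderiv 𝓘(ℝ, E) 𝓘(ℝ, E) e.symm x

/-- The metric in a chart. -/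
noncomputable def chartForm (e : OpenPartialHomeomorph M E) (x : E) : E →L[ℝ] E →L[ℝ] ℝ :=
  (S.form (e.symm x)).bilinearComp (chartSymmDeriv e x) (chartSymmDeriv e x)

/-- The time orientation in a chart. -/
noncomputable def chartOrient (e : OpenPartialHomeomorph M E) (x : E) : E :=
  chartDeriv e (e.symm x) (S.orient (e.symm x))

lemma chartMetric_eq (x u v : E) : S.chartMetric e x u v = S.chartForm e x u v := rfl

lemma chartOrient_apply {p : M} (hp : p ∈ e.source) :
    S.chartOrient e (e p) = chartDeriv e p (S.orient p) := by
  rw [chartOrient, e.left_inv hp]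

lemma isLorentzian_form (p : M) : IsLorentzian (S.form p) :=
  ⟨S.g_symm p, S.g_signature p⟩

variable (he : e ∈ atlas E M)
include he

lemma chartSymmDeriv_chartDeriv {p : M} (hp : p ∈ e.source) (v : E) :
    chartSymmDeriv e (e p) (chartDeriv e p v) = v :=
  congrArg (fun L : E →L[ℝ] E ↦ L v)
    ((mdifferentiable_of_mem_atlas (I := 𝓘(ℝ, E)) he).symm_comp_deriv hp)

lemma chartDeriv_chartSymmDeriv {x : E} (hx : x ∈ e.target) (v : E) :
    chartDeriv e (e.symm x) (chartSymmDeriv e x v) = v :=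
  congrArg (fun L : E →L[ℝ] E ↦ L v)
    ((mdifferentiable_of_mem_atlas (I := 𝓘(ℝ, E)) he).comp_symm_deriv hx)

lemma chartForm_chartDeriv {p : M} (hp : p ∈ e.source) (v w : E) :
    S.chartForm e (e p) (chartDeriv e p v) (chartDeriv e p w) = S.form p v w := by
  change S.form (e.symm (e p)) (chartSymmDeriv e (e p) (chartDeriv e p v))
    (chartSymmDeriv e (e p) (chartDeriv e p w)) = _
  rw [chartSymmDeriv_chartDeriv he hp, chartSymmDeriv_chartDeriv he hp, e.left_inv hp]

lemma isLorentzian_chartForm {x : E} (hx : x ∈ e.target) : IsLorentzian (S.chartForm e x) := by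
  obtain ⟨hs, u, hu, hneg⟩ := S.isLorentzian_form (e.symm x)
  refine ⟨fun v w ↦ hs _ _, chartDeriv e (e.symm x) u, ?_, fun v hv hv0 ↦ ?_⟩
  · have := S.chartForm_chartDeriv he (e.map_target hx) u u
    rw [e.right_inv hx] at this
    rwa [this]
  · have h1 := S.chartForm_chartDeriv he (e.map_target hx)
    rw [e.right_inv hx] at h1
    rw [← chartDeriv_chartSymmDeriv he hx v, h1] at hv ⊢
    refine hneg _ hv fun h0 ↦ hv0 ?_
    rw [← chartDeriv_chartSymmDeriv he hx v, h0, map_zero]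

lemma contMDiffOn_chart_atlas : ContMDiffOn 𝓘(ℝ, E) 𝓘(ℝ, E) ∞ e e.source :=
  contMDiffOn_of_mem_maximalAtlas (IsManifold.subset_maximalAtlas he)

lemma contMDiffOn_chart_symm_atlas : ContMDiffOn 𝓘(ℝ, E) 𝓘(ℝ, E) ∞ e.symm e.target :=
  contMDiffOn_symm_of_mem_maximalAtlas (IsManifold.subset_maximalAtlas he)

/-- The coordinate vector fields are smooth along `e.symm`: each is the tangent map of `e.symm`
applied to a constant section. Feeding two of them to the smooth bundle metric gives smooth
components. -/
lemma contMDiffOn_chartSymmDeriv (v : E) :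
    ContMDiffOn 𝓘(ℝ, E) (𝓘(ℝ, E).prod 𝓘(ℝ, E)) ∞
      (fun x ↦ Bundle.TotalSpace.mk' E (E := fun p : M ↦ TangentSpace 𝓘(ℝ, E) p) (e.symm x)
        (chartSymmDeriv e x v)) e.target := by
  have h := (contMDiffOn_chart_symm_atlas (M := M) he).contMDiffOn_tangentMapWithin
    (m := ∞) (by norm_num) e.open_target.uniqueMDiffOn
  have h2 : ContMDiff 𝓘(ℝ, E) (𝓘(ℝ, E).prod 𝓘(ℝ, E)) ∞
      (fun x : E ↦ (⟨x, v⟩ : TangentBundle 𝓘(ℝ, E) E)) := by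
    exact (contMDiff_vectorSpace_iff_contDiff (V := fun _ ↦ v)).2 contDiff_const
  refine (h.comp h2.contMDiffOn (s := e.target) fun x hx ↦ hx).congr fun x hx ↦ ?_
  simp only [Function.comp, tangentMapWithin]
  rw [mfderivWithin_of_isOpen e.open_target hx]
  rfl

lemma contDiffOn_chartForm_apply (v w : E) :
    ContDiffOn ℝ ∞ (fun x ↦ S.chartForm e x v w) e.target := by
  have h := ContMDiffOn.clm_bundle_apply₂ (F₁ := E) (F₂ := E) (F₃ := ℝ)
    (E₃ := Bundle.Trivial M ℝ) (n := ∞)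
    (S.g_smooth.comp_contMDiffOn (contMDiffOn_chart_symm_atlas (M := M) he))
    (contMDiffOn_chartSymmDeriv he v) (contMDiffOn_chartSymmDeriv he w)
  rw [← contMDiffOn_iff_contDiffOn]
  intro x hx
  have := h x hx
  simp only [Bundle.contMDiffWithinAt_totalSpace] at this
  exact this.2

lemma continuousOn_chartOrient : ContinuousOn (S.chartOrient e) e.target := by
  have h := (contMDiffOn_chart_atlas (M := M) he).continuousOn_tangentMapWithin
    (by simp) e.open_source.uniqueMDiffOn
  have h2 := h.comp (S.X_smooth.continuous.continuousOn (s := e.source)) (fun x hx ↦ hx)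
  have h3 := h2.comp e.continuousOn_symm e.mapsTo_symm
  have h4 := contMDiff_snd_tangentBundle_modelSpace E 𝓘(ℝ, E) (n := 0)
  refine (h4.continuous.comp_continuousOn h3).congr fun x hx ↦ ?_
  simp only [Function.comp, tangentMapWithin]
  rw [mfderivWithin_of_isOpen e.open_source (e.map_target hx)]
  rfl

lemma contDiffOn_chartForm [FiniteDimensional ℝ E] : ContDiffOn ℝ ∞ (S.chartForm e) e.target := by
  rw [contDiffOn_clm_apply]
  intro v
  rw [contDiffOn_clm_apply]
  exact S.contDiffOn_chartForm_apply he v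

lemma isLocalSpacetime_chart [FiniteDimensional ℝ E] :
    IsLocalSpacetime e.target (S.chartForm e) (S.chartOrient e) where
  isOpen := e.open_target
  smooth := S.contDiffOn_chartForm he
  lorentzian _ hx := S.isLorentzian_chartForm he hx
  continuousOn := S.continuousOn_chartOrient he
  timelike x hx := by
    have := S.chartForm_chartDeriv he (e.map_target hx) (S.orient (e.symm x)) (S.orient (e.symm x))
    rw [e.right_inv hx] at this
    rw [chartOrient, this]
    exact S.X_timelike (e.symm x)

variable {S}

lemma futureCausalVec_iff_chart {p : M} (hp : p ∈ e.source) {v : E} :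
    S.FutureCausalVec p v ↔ 0 ≤ S.chartForm e (e p) (chartDeriv e p v) (chartDeriv e p v) ∧
      0 ≤ S.chartForm e (e p) (chartDeriv e p v) (S.chartOrient e (e p)) := by
  rw [chartForm_chartDeriv S he hp, chartOrient_apply S hp, chartForm_chartDeriv S he hp,
    futureCausalVec_iff]

lemma futureTimelikeVec_iff_chart {p : M} (hp : p ∈ e.source) {v : E} :
    S.FutureTimelikeVec p v ↔ 0 < S.chartForm e (e p) (chartDeriv e p v) (chartDeriv e p v) ∧
      0 ≤ S.chartForm e (e p) (chartDeriv e p v) (S.chartOrient e (e p)) := by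
  rw [chartForm_chartDeriv S he hp, chartOrient_apply S hp, chartForm_chartDeriv S he hp,
    futureTimelikeVec_iff]

lemma hasDerivWithinAt_chart {γ : ℝ → M} {J : Set ℝ} {t : ℝ} (ht : γ t ∈ e.source)
    (hγ : MDifferentiableWithinAt 𝓘(ℝ, ℝ) 𝓘(ℝ, E) γ J t) :
    HasDerivWithinAt (fun s ↦ e (γ s)) (chartDeriv e (γ t) (velocity (E := E) γ J t)) J t := by
  set L : ℝ →L[ℝ] E := mfderivWithin 𝓘(ℝ, ℝ) 𝓘(ℝ, E) γ J t with hL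
  have h1 : HasFDerivWithinAt (fun s ↦ e (γ s)) ((chartDeriv e (γ t)).comp L) J t :=
    ((mdifferentiableAt_atlas (I := 𝓘(ℝ, E)) he ht).hasMFDerivAt.comp_hasMFDerivWithinAt t
      hγ.hasMFDerivWithinAt).hasFDerivWithinAt
  exact h1.hasDerivWithinAt

lemma contDiffOn_chart {γ : ℝ → M} {J : Set ℝ} {n : ℕ} (hγ : ContMDiffOn 𝓘(ℝ, ℝ) 𝓘(ℝ, E) n γ J)
    (hs : MapsTo γ J e.source) : ContDiffOn ℝ n (fun s ↦ e (γ s)) J :=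
  contMDiffOn_iff_contDiffOn.1 <|
    ((contMDiffOn_chart_atlas (M := M) he).of_le (mod_cast le_top)).comp hγ hs

/-- The arc in the manifold given by a `C¹` curve in a chart. -/
lemma isArc_chart_symm {P : ∀ p : M, TangentSpace 𝓘(ℝ, E) p → Prop} {c c' : ℝ → E} {a b : ℝ}
    (hab : a < b) (hc : ∀ t ∈ Icc a b, HasDerivWithinAt c (c' t) (Icc a b) t)
    (hc' : ContinuousOn c' (Icc a b)) (ht : MapsTo c (Icc a b) e.target)
    (hP : ∀ t ∈ Icc a b, ∀ v : E, chartDeriv e (e.symm (c t)) v = c' t → P (e.symm (c t)) v) :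
    IsArc P (fun t ↦ e.symm (c t)) a b := by
  have hu := uniqueDiffOn_Icc hab
  have h1 : ContDiffOn ℝ 1 c (Icc a b) := by
    rw [show (1 : WithTop ℕ∞) = 0 + 1 by simp, contDiffOn_succ_iff_derivWithin hu]
    refine ⟨fun t ht ↦ (hc t ht).differentiableWithinAt, by simp, ?_⟩
    rw [contDiffOn_zero]
    exact hc'.congr fun t ht ↦ (hc t ht).derivWithin (hu t ht)
  have h2 : ContMDiffOn 𝓘(ℝ, ℝ) 𝓘(ℝ, E) 1 (fun t ↦ e.symm (c t)) (Icc a b) :=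
    ((contMDiffOn_chart_symm_atlas (M := M) he).of_le (mod_cast le_top)).comp h1.contMDiffOn ht
  refine ⟨h2, fun t htI ↦ hP t htI _ ?_⟩
  have h3 := hasDerivWithinAt_chart he (e.map_target (ht htI))
    ((h2 t htI).mdifferentiableWithinAt one_ne_zero)
  refine (hu t htI).eq_deriv _ h3 ((hc t htI).congr (fun s hs ↦ e.right_inv (ht hs))
    (e.right_inv (ht htI)))

end Spacetime

/-! ### Stability of the causal cones under small perturbations -/

open Metric Filter Topology in
/-- Near `p`, timelike vectors close to a future timelike vector at `p` remain future timelike. -/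
lemma IsLocalSpacetime.exists_ball_timelike {E : Type*} [NormedAddCommGroup E] [NormedSpace ℝ E]
    {U : Set E} {G : E → E →L[ℝ] E →L[ℝ] ℝ} {X : E → E} (h : IsLocalSpacetime U G X) {p : E}
    (hp : p ∈ U) {T : E} (hT : 0 < G p T T) (hTX : 0 ≤ G p T (X p)) {m : ℝ} (hm : m < G p T T) :
    ∃ ε > 0, ball p ε ⊆ U ∧ ∀ x ∈ ball p ε, ∀ v ∈ ball T ε, 0 < G x v v ∧ m < G x v v ∧
      0 < G x v (X x) := by
  have hT0 : T ≠ 0 := by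
    rintro rfl
    simp at hT
  -- A timelike vector cannot be orthogonal to `X`, so the weak sign is in fact strict and becomes
  -- an open condition.
  have hTX' : 0 < G p T (X p) := by
    rw [(h.lorentzian p hp).symm]
    exact (h.lorentzian p hp).pos_of_future (h.timelike p hp) (h.timelike p hp)
      (h.timelike p hp).le hT.le hTX hT0
  have hU : U ∈ 𝓝 p := h.isOpen.mem_nhds hp
  have hG : ContinuousAt (fun q : E × E ↦ G q.1) (p, T) :=
    ((h.smooth.contDiffAt hU).continuousAt).comp (x := (p, T)) continuousAt_fst
  have hX : ContinuousAt (fun q : E × E ↦ X q.1) (p, T) :=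
    ((h.continuousOn.continuousAt hU)).comp (x := (p, T)) continuousAt_fst
  have h1 : ContinuousAt (fun q : E × E ↦ G q.1 q.2 q.2) (p, T) :=
    (hG.clm_apply continuousAt_snd).clm_apply continuousAt_snd
  have h2 : ContinuousAt (fun q : E × E ↦ G q.1 q.2 (X q.1)) (p, T) :=
    (hG.clm_apply continuousAt_snd).clm_apply hX
  have h3 : ∀ᶠ q : E × E in 𝓝 (p, T), 0 < G q.1 q.2 q.2 := h1.eventually_const_lt hT
  have h4 : ∀ᶠ q : E × E in 𝓝 (p, T), m < G q.1 q.2 q.2 := h1.eventually_const_lt hm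
  have h5 : ∀ᶠ q : E × E in 𝓝 (p, T), 0 < G q.1 q.2 (X q.1) := h2.eventually_const_lt hTX'
  have h6 : ∀ᶠ q : E × E in 𝓝 (p, T), q.1 ∈ U := continuousAt_fst hU
  obtain ⟨ε, hε, hall⟩ := Metric.eventually_nhds_iff_ball.1 (h3.and (h4.and (h5.and h6)))
  refine ⟨ε, hε, fun x hx ↦ (hall (x, T) ?_).2.2.2, fun x hx v hv ↦ ?_⟩
  · simpa [← ball_prod_same] using ⟨hx, hε⟩
  · have := hall (x, v) (by simpa [← ball_prod_same] using ⟨hx, hv⟩)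
    exact ⟨this.1, this.2.1, this.2.2.1⟩

open Metric Filter Topology in
/-- Uniformly near `p`, the product of a causal vector with `X p` controls its norm. -/
lemma IsLocalSpacetime.exists_cone_bound {E : Type*} [NormedAddCommGroup E] [NormedSpace ℝ E]
    [FiniteDimensional ℝ E]
    {U : Set E} {G : E → E →L[ℝ] E →L[ℝ] ℝ} {X : E → E} (h : IsLocalSpacetime U G X) {p : E}
    (hp : p ∈ U) : ∃ ε > 0, ∃ d > 0, ball p ε ⊆ U ∧ ∀ x ∈ ball p ε,
      0 < G x (X p) (X p) ∧ 0 < G x (X p) (X x) ∧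
      ∀ v, 0 ≤ G x v v → 0 ≤ G x v (X x) → d * ‖v‖ ≤ G x v (X p) := by
  set T := X p with hT
  have hTT := h.timelike p hp
  rw [← hT] at hTT
  obtain ⟨ε₁, hε₁, hU₁, h₁⟩ := h.exists_ball_timelike hp hTT hTT.le hTT
  -- This is the positive definite form obtained by flipping signs orthogonally to `T`. On causal
  -- `v` it is at most `2 (G x T v) ^ 2`, so its lower bound `δ * ‖v‖ ^ 2` yields the constant `√(δ
  -- / 2)`.
  set F : E → E → ℝ := fun x v ↦ 2 * (G x T v) ^ 2 - G x T T * G x v v with hF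
  have hU : U ∈ 𝓝 p := h.isOpen.mem_nhds hp
  have hFc : ∀ v, ContinuousAt (fun q : E × E ↦ F q.1 q.2) (p, v) := by
    intro v
    have hG : ContinuousAt (fun q : E × E ↦ G q.1) (p, v) :=
      ((h.smooth.contDiffAt hU).continuousAt).comp (x := (p, v)) continuousAt_fst
    have e1 := (hG.clm_apply (continuousAt_const (y := T))).clm_apply continuousAt_snd
    have e2 := (hG.clm_apply (continuousAt_const (y := T))).clm_apply (continuousAt_const (y := T))
    have e3 := (hG.clm_apply continuousAt_snd).clm_apply continuousAt_snd
    exact ((e1.pow 2).const_mul 2).sub (e2.mul e3)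
  obtain ⟨δ, hδ, hev⟩ := eventually_mul_sq_le ⊤ hFc
    (by intro x c v; simp only [hF, map_smul, _root_.smul_apply, smul_eq_mul]; ring)
    (fun v _ hv ↦ (h.lorentzian p hp).flip_pos hTT hv)
  obtain ⟨ε₂, hε₂, h₂⟩ := Metric.eventually_nhds_iff_ball.1 hev
  have hdd : √(δ / 2) ^ 2 = δ / 2 := Real.sq_sqrt (by positivity)
  refine ⟨min ε₁ ε₂, by positivity, √(δ / 2), by positivity,
    (ball_subset_ball (min_le_left _ _)).trans hU₁, fun x hx ↦ ?_⟩
  have hx₁ := ball_subset_ball (min_le_left _ _) hx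
  have hx₂ := ball_subset_ball (min_le_right _ _) hx
  have hxU := hU₁ hx₁
  have hTx := h₁ x hx₁ T (mem_ball_self hε₁)
  refine ⟨hTx.1, hTx.2.2, fun v hv hvX ↦ ?_⟩
  rcases eq_or_ne v 0 with rfl | hv0
  · simp
  have hpos := (h.lorentzian x hxU).pos_of_future (h.timelike x hxU) hTx.1 hTx.2.2.le hv hvX hv0
  have h6 : δ * ‖v‖ ^ 2 ≤ 2 * (G x T v) ^ 2 - G x T T * G x v v := h₂ x hx₂ v trivial
  rw [(h.lorentzian x hxU).symm T v] at hpos h6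
  have h9 : 0 ≤ G x T T * G x v v := mul_nonneg hTx.1.le hv
  refine le_of_sq_le_sq ?_ hpos.le
  rw [mul_pow, hdd]
  linarith

open Metric Filter Topology in
/-- Adding a small multiple of `T` to a causal vector and moving the base point by a much smaller
amount produces a timelike vector. -/
lemma IsLocalSpacetime.exists_push {E : Type*} [NormedAddCommGroup E] [NormedSpace ℝ E]
    [FiniteDimensional ℝ E]
    {U : Set E} {G : E → E →L[ℝ] E →L[ℝ] ℝ} {X : E → E} (h : IsLocalSpacetime U G X) {p : E}
    (hp : p ∈ U) : ∃ ε > 0, ∃ T : E, ball p ε ⊆ U ∧ ∀ M > 0, ∃ r > 0,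
      ∀ x ∈ ball p ε, ∀ x' ∈ ball p ε, ∀ (v : E) (η : ℝ), 0 < η → η ≤ 1 → 0 ≤ G x v v →
        0 ≤ G x v (X x) → ‖v‖ ≤ M → ‖x' - x‖ ≤ η * r →
        0 < G x' (v + η • T) (v + η • T) ∧ 0 < G x' (v + η • T) (X x') := by
  obtain ⟨ε₁, hε₁, d, hd0, hU₁, h₁⟩ := h.exists_cone_bound hp
  set T := X p with hT
  have hGd : ContDiffAt ℝ 1 G p :=
    (h.smooth.contDiffAt (h.isOpen.mem_nhds hp)).of_le (mod_cast le_top)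
  obtain ⟨C, s, hs, hLip⟩ := hGd.exists_lipschitzOnWith
  obtain ⟨ε₃, hε₃, h₃⟩ := Metric.mem_nhds_iff.1 hs
  have i1 : ball p (min ε₁ ε₃) ⊆ ball p ε₁ := ball_subset_ball (min_le_left _ _)
  have i3 : ball p (min ε₁ ε₃) ⊆ ball p ε₃ := ball_subset_ball (min_le_right _ _)
  refine ⟨min ε₁ ε₃, lt_min hε₁ hε₃, T, fun x hx ↦ hU₁ (i1 hx), fun M hM ↦ ?_⟩
  -- Moving the base point by `η * r` changes the metric by at most `C * (η * r)`, a loss of order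
  -- `η * ‖v‖`. Adding `η • T` gains `2 * η * G x' v T`, of the same order by the cone bound `d`;
  -- this `r` makes the gain win.
  refine ⟨d / ((C + 1) * (M + 2 * ‖T‖ + 1)), by positivity, ?_⟩
  intro x hx x' hx' v η hη hη1 hv hvX hvM hxx
  set r := d / ((C + 1) * (M + 2 * ‖T‖ + 1)) with hr
  have hr0 : 0 < r := by positivity
  have hrd : (C + 1) * (M + 2 * ‖T‖ + 1) * r = d := mul_div_cancel₀ _ (by positivity)
  have hxU' := hU₁ (i1 hx')
  have hTx' := h₁ x' (i1 hx')
  have hsymm := (h.lorentzian x' hxU').symm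
  have hdist : ‖G x' - G x‖ ≤ C * (η * r) := by
    have := hLip.dist_le_mul x' (h₃ (i3 hx')) x (h₃ (i3 hx))
    rw [dist_eq_norm, dist_eq_norm] at this
    exact this.trans (by gcongr)
  have hclose : ∀ w, |G x' v w - G x v w| ≤ C * (η * r) * ‖v‖ * ‖w‖ := by
    intro w
    have := (G x' - G x).le_opNorm₂ v w
    rw [Real.norm_eq_abs, _root_.sub_apply, _root_.sub_apply] at this
    exact this.trans (by gcongr)
  have a1 := (abs_le.1 (hclose v)).1
  have a2 := (abs_le.1 (hclose T)).1
  have a3 := (h₁ x (i1 hx)).2.2 v hv hvX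
  have hC : (0 : ℝ) ≤ C := C.2
  have hv0 := norm_nonneg v
  have hT0 := norm_nonneg T
  clear_value r
  have b0 : (C : ℝ) * r * (M + 2 * ‖T‖) ≤ d := by
    rw [← hrd]
    calc (C : ℝ) * r * (M + 2 * ‖T‖) = C * (M + 2 * ‖T‖) * r := by ring
      _ ≤ (C + 1) * (M + 2 * ‖T‖ + 1) * r :=
        mul_le_mul_of_nonneg_right (mul_le_mul (by linarith) (by linarith) (by positivity)
          (by positivity)) hr0.le
  have b1 : C * (η * r) * ‖v‖ * ‖v‖ ≤ η * (‖v‖ * (C * r * M)) := by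
    calc C * (η * r) * ‖v‖ * ‖v‖ = η * (‖v‖ * (C * r * ‖v‖)) := by ring
      _ ≤ η * (‖v‖ * (C * r * M)) := by gcongr
  have b2 : C * (η * r) * ‖v‖ * ‖T‖ ≤ ‖v‖ * (C * r * ‖T‖) := by
    calc C * (η * r) * ‖v‖ * ‖T‖ = η * (‖v‖ * (C * r * ‖T‖)) := by ring
      _ ≤ 1 * (‖v‖ * (C * r * ‖T‖)) := by gcongr
      _ = _ := one_mul _
  have c0 : ‖v‖ * (C * r * M) + 2 * (‖v‖ * (C * r * ‖T‖)) ≤ d * ‖v‖ := by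
    calc _ = (C * r * (M + 2 * ‖T‖)) * ‖v‖ := by ring
      _ ≤ _ := by gcongr
  have c3 : 0 ≤ ‖v‖ * (C * r * M) := by positivity
  have c5 : 0 ≤ ‖v‖ * (C * r * ‖T‖) := by positivity
  have c1 : 0 ≤ G x' v T := by linarith
  have c2 : ‖v‖ * (C * r * M) ≤ 2 * G x' v T := by
    have : 0 ≤ d * ‖v‖ := by positivity
    linarith
  have c4 : η * (‖v‖ * (C * r * M)) ≤ 2 * (η * G x' v T) := by
    have := mul_le_mul_of_nonneg_left c2 hη.le
    linarith
  have e1 : G x' (v + η • T) (v + η • T) =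
      G x' v v + 2 * (η * G x' v T) + η ^ 2 * G x' T T := by
    simp only [map_add, map_smul, _root_.add_apply, _root_.smul_apply, smul_eq_mul, hsymm T v]
    ring
  have e2 : G x' (v + η • T) T = G x' v T + η * G x' T T := by
    simp only [map_add, map_smul, _root_.add_apply, _root_.smul_apply, smul_eq_mul]
  have hpos1 : 0 < η ^ 2 * G x' T T := mul_pos (pow_pos hη 2) hTx'.1
  have hpos2 : 0 < η * G x' T T := mul_pos hη hTx'.1
  have f1 : 0 < G x' (v + η • T) (v + η • T) := by
    rw [e1]
    linarith
  refine ⟨f1, ?_⟩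
  rw [hsymm]
  refine (h.lorentzian x' hxU').pos_of_future hTx'.1 (h.timelike x' hxU') ?_ f1.le ?_ ?_
  · rw [hsymm]
    exact hTx'.2.1.le
  · rw [e2]
    exact (add_nonneg c1 hpos2.le)
  · intro h0
    rw [h0] at f1
    simp at f1

/-! ### Openness of the timelike relation and push-up -/

namespace Spacetime

open Metric Filter Topology

variable {E : Type*} [NormedAddCommGroup E] [NormedSpace ℝ E]
  {M : Type*} [TopologicalSpace M] [ChartedSpace E M]
  {P : ∀ p : M, TangentSpace 𝓘(ℝ, E) p → Prop} {γ : ℝ → M} {a b : ℝ}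

lemma IsPath.exists_last (h : IsPath P γ a b) :
    ∃ s, a ≤ s ∧ s < b ∧ IsArc P γ s b := by
  cases h with
  | arc hlt h => exact ⟨a, le_rfl, hlt, h⟩
  | snoc h₁ hlt h => exact ⟨_, h₁.lt.le, hlt, h⟩

/-- A curve which is continuous on `[a, b]` stays in an open set for a short time. -/
lemma exists_window (hγ : ContinuousOn γ (Icc a b)) {t₀ : ℝ} (ht₀ : t₀ ∈ Icc a b) {W : Set M}
    (hW : W ∈ 𝓝 (γ t₀)) : ∃ ε > 0, ∀ t ∈ Icc a b, |t - t₀| ≤ ε → γ t ∈ W := by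
  have := hγ t₀ ht₀ hW
  obtain ⟨ε, hε, h⟩ := Metric.mem_nhdsWithin_iff.1 this
  refine ⟨ε / 2, half_pos hε, fun t ht htt ↦ h ⟨?_, ht⟩⟩
  rw [mem_ball, Real.dist_eq]
  linarith

variable [IsManifold 𝓘(ℝ, E) ∞ M] {S : Spacetime E M} {x y z : M}

lemma length_of_hyperbolicNorm_eq {κ : ℝ} (hκ : 0 ≤ κ)
    (h : ∀ t ∈ Icc a b, S.hyperbolicNorm (γ t) (velocity γ (Icc a b) t) = κ) :
    S.length γ a b = ENNReal.ofReal (κ * (b - a)) := by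
  rw [length, setLIntegral_congr_fun (g := fun _ ↦ ENNReal.ofReal κ) measurableSet_Icc fun t ht ↦ by
    rw [h t ht]]
  rw [lintegral_const, Measure.restrict_apply_univ, Real.volume_Icc, ENNReal.ofReal_mul hκ]

lemma le_length_of_le_hyperbolicNorm {κ : ℝ} (hκ : 0 ≤ κ)
    (h : ∀ t ∈ Icc a b, κ ≤ S.hyperbolicNorm (γ t) (velocity γ (Icc a b) t)) :
    ENNReal.ofReal (κ * (b - a)) ≤ S.length γ a b := by
  rw [ENNReal.ofReal_mul hκ, ← Real.volume_Icc, ← Measure.restrict_apply_univ, ← lintegral_const]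
  exact setLIntegral_mono' measurableSet_Icc fun t ht ↦ ENNReal.ofReal_le_ofReal (h t ht)

/-- Straight segments in a chart, near a point and in directions close to a future timelike
direction, are timelike curves, and their length is controlled. -/
lemma exists_segment [FiniteDimensional ℝ E] {e : OpenPartialHomeomorph M E} (he : e ∈ atlas E M)
    {p : E} (hp : p ∈ e.target) {T : E} (hT : 0 < S.chartForm e p T T)
    (hTX : 0 ≤ S.chartForm e p T (S.chartOrient e p)) {κ : ℝ} (hκ : 0 ≤ κ)
    (hm : κ ^ 2 < S.chartForm e p T T) :
    ∃ ε > 0, ∀ x ∈ ball p ε, ∀ y ∈ ball p ε, ∀ k > 0, k⁻¹ • (y - x) ∈ ball T ε →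
      S.ChronLT (e.symm x) (e.symm y) ∧
      ENNReal.ofReal (κ * k) ≤ S.timeSep (e.symm x) (e.symm y) := by
  obtain ⟨ε, hε, hU, h⟩ := (S.isLocalSpacetime_chart he).exists_ball_timelike hp hT hTX hm
  refine ⟨ε, hε, fun x hx y hy k hk hv ↦ ?_⟩
  set v := k⁻¹ • (y - x) with hvdef
  set c : ℝ → E := fun t ↦ x + t • v with hc
  have hmem : ∀ t ∈ Icc 0 k, c t ∈ ball p ε := by
    intro t ht
    have : c t = x + (t / k) • (y - x) := by
      simp only [hc, hvdef, smul_smul, div_eq_mul_inv]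
    rw [this]
    exact (convex_ball p ε).add_smul_sub_mem hx hy
      ⟨div_nonneg ht.1 hk.le, (div_le_one hk).2 ht.2⟩
  have hd : ∀ t ∈ Icc 0 k, HasDerivWithinAt c v (Icc 0 k) t := by
    intro t _
    have h1 : HasDerivAt (fun t : ℝ ↦ x + t • v) ((1 : ℝ) • v) t :=
      ((hasDerivAt_id t).smul_const v).const_add x
    rw [one_smul] at h1
    exact h1.hasDerivWithinAt
  have harc : IsArc (fun p v ↦ S.FutureTimelikeVec p v ∧ κ ≤ S.hyperbolicNorm p v)
      (fun t ↦ e.symm (c t)) 0 k := by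
    refine isArc_chart_symm he hk hd continuousOn_const (fun t ht ↦ hU (hmem t ht)) ?_
    intro t ht w hw
    have hs := e.map_target (hU (hmem t ht))
    have h1 := h _ (hmem t ht) v hv
    have h2 := S.chartForm_chartDeriv he hs w w
    rw [hw, e.right_inv (hU (hmem t ht))] at h2
    have hft : S.FutureTimelikeVec (e.symm (c t)) w := by
      rw [futureTimelikeVec_iff_chart he hs, hw, e.right_inv (hU (hmem t ht))]
      exact ⟨h1.1, h1.2.2.le⟩
    refine ⟨hft, ?_⟩
    rw [hyperbolicNorm_of_futureCausalVec hft.futureCausalVec, ← h2]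
    exact Real.le_sqrt_of_sq_le h1.2.1.le
  have e0 : c 0 = x := by simp [hc]
  have e1 : c k = y := by
    simp [hc, hvdef, smul_smul, hk.ne']
  have h1 := chronLT_of_isPath (.arc hk (harc.imp (P' := S.FutureTimelikeVec) fun p v hv ↦ hv.1))
  have h2 := le_timeSep_of_isPath
    (.arc hk (harc.imp (P' := S.FutureCausalVec) fun p v hv ↦ hv.1.futureCausalVec))
  have h3 := le_length_of_le_hyperbolicNorm (S := S) (γ := fun t ↦ e.symm (c t)) hκ
    fun t ht ↦ (harc.2 t ht).2
  simp only [e0, e1] at h1 h2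
  rw [sub_zero] at h3
  exact ⟨h1, h3.trans h2.2⟩

/-- `I⁺(x)` is open. -/
lemma ChronLT.eventually [FiniteDimensional ℝ E] (h : S.ChronLT x y) :
    ∀ᶠ y' in 𝓝 y, S.ChronLT x y' := by
  obtain ⟨γ, hγ, rfl, rfl⟩ := h.exists_path zero_lt_one
  obtain ⟨s, hs0, hs1, harc⟩ := hγ.exists_last
  set e := chartAt E (γ 1) with he
  have hea : e ∈ atlas E M := chart_mem_atlas E _
  have hsrc : γ 1 ∈ e.source := mem_chart_source E _
  have h1s : (1 : ℝ) ∈ Icc s 1 := right_mem_Icc.2 hs1.le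
  set T : E := chartDeriv e (γ 1) (velocity (E := E) γ (Icc s 1) 1) with hT
  have hTf := (futureTimelikeVec_iff_chart hea hsrc).1 (harc.2 1 h1s)
  obtain ⟨ε, hε, hseg⟩ := exists_segment (S := S) hea (e.map_source hsrc) hTf.1 hTf.2 le_rfl
    (by simpa using hTf.1)
  have hder := hasDerivWithinAt_chart hea hsrc
    ((harc.1 1 h1s).mdifferentiableWithinAt one_ne_zero)
  rw [← hT, hasDerivWithinAt_iff_tendsto_slope] at hder
  have hbd : 𝓝[Icc s 1 \ {1}] (1 : ℝ) = 𝓝[<] 1 := by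
    rw [Icc_sdiff_right]
    exact nhdsWithin_Ico_eq_nhdsLT hs1
  rw [hbd] at hder
  have hc1 : ContinuousWithinAt (fun t ↦ e (γ t)) (Iio 1) 1 := by
    have := (e.continuousAt hsrc).comp_continuousWithinAt (harc.continuousOn 1 h1s)
    refine this.mono_of_mem_nhdsWithin ?_
    exact mem_of_superset (Ioo_mem_nhdsLT hs1) Ioo_subset_Icc_self
  have hsrc' : ∀ᶠ t in 𝓝[<] (1 : ℝ), γ t ∈ e.source := by
    have := (harc.continuousOn 1 h1s).mono_of_mem_nhdsWithin
      (mem_of_superset (Ioo_mem_nhdsLT hs1) Ioo_subset_Icc_self)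
    exact this (e.open_source.mem_nhds hsrc)
  -- For `t` just before `1` the chord from `γ t` to `γ 1` points nearly along the final velocity.
  -- So does the chord to any `y'` close to `γ 1`, and it is therefore a timelike segment.
  obtain ⟨t, ht1, ht2, ht3, ht4⟩ := ((hder.eventually (ball_mem_nhds T hε)).and
    ((hc1.eventually (ball_mem_nhds (e (γ 1)) hε)).and
      (hsrc'.and (Ioo_mem_nhdsLT hs1)))).exists
  have hxt : S.ChronLT (γ 0) (γ t) :=
    chronLT_of_isPath (hγ.mono_right (hs0.trans_lt ht4.1) ht4.2.le)
  have hcont : ContinuousAt (fun y' ↦ (1 - t)⁻¹ • (e y' - e (γ t))) (γ 1) := by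
    have := e.continuousAt hsrc
    fun_prop
  have hslope : slope (fun s ↦ e (γ s)) 1 t = (1 - t)⁻¹ • (e (γ 1) - e (γ t)) := by
    rw [slope_comm, slope_def_module]
  rw [hslope] at ht1
  filter_upwards [hcont.eventually (isOpen_ball.mem_nhds ht1),
    (e.continuousAt hsrc).eventually (ball_mem_nhds _ hε), e.open_source.mem_nhds hsrc]
    with y' h1 h2 h3
  have := (hseg _ ht2 _ h2 (1 - t) (by linarith [ht4.2]) h1).1
  rw [e.left_inv ht3, e.left_inv h3] at this
  exact hxt.trans this

/-- In a chart the causal arc is displaced backwards by a small multiple of `T` that shrinks to zero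
at its end point. The displaced arc is timelike by `exists_push`, and its starting point still lies
in the open set `I⁺(x)`. This works on short pieces, which are then chained. -/
lemma chronLT_of_chronLT_of_isArc [FiniteDimensional ℝ E] (hab : a < b)
    (hγ : IsArc S.FutureCausalVec γ a b) (h : S.ChronLT x (γ a)) : S.ChronLT x (γ b) := by
  suffices h : ∀ s u, a ≤ s → s ≤ u → u ≤ b → S.ChronLT x (γ s) → S.ChronLT x (γ u) from
    h a b le_rfl hab.le le_rfl ‹_›
  refine interval_property_of_local
    (Q := fun p q ↦ ∀ s u, p ≤ s → s ≤ u → u ≤ q → S.ChronLT x (γ s) → S.ChronLT x (γ u)) hab ?_ ?_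
  · intro t₀ ht₀
    set e := chartAt E (γ t₀) with he
    have hea : e ∈ atlas E M := chart_mem_atlas E _
    have hsrc : γ t₀ ∈ e.source := mem_chart_source E _
    obtain ⟨ε, hε, T, hU, hpush⟩ :=
      (S.isLocalSpacetime_chart hea).exists_push (e.map_source hsrc)
    have hW : e.source ∩ e ⁻¹' ball (e (γ t₀)) (ε / 2) ∈ 𝓝 (γ t₀) :=
      inter_mem (e.open_source.mem_nhds hsrc) (e.continuousAt hsrc (ball_mem_nhds _ (half_pos hε)))
    obtain ⟨ρ, hρ, hwin⟩ := exists_window hγ.continuousOn ht₀ hW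
    set a' := max a (t₀ - ρ) with ha'
    set b' := min b (t₀ + ρ) with hb'
    have hab' : a' < b' := max_lt (lt_min hab (by linarith [ht₀.1]))
      (lt_min (by linarith [ht₀.2]) (by linarith))
    have hγ' : IsArc S.FutureCausalVec γ a' b' :=
      hγ.mono (le_max_left _ _) hab' (min_le_left _ _)
    have hin : ∀ t ∈ Icc a' b', γ t ∈ e.source ∧ e (γ t) ∈ ball (e (γ t₀)) (ε / 2) := by
      intro t ht
      refine hwin t ⟨(le_max_left _ _).trans ht.1, ht.2.trans (min_le_left _ _)⟩ ?_
      have h1 := (le_max_right _ _).trans ht.1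
      have h2 := ht.2.trans (min_le_right _ _)
      exact abs_le.2 ⟨by linarith, by linarith⟩
    set c : ℝ → E := fun t ↦ e (γ t) with hc
    set c' : ℝ → E := fun t ↦ derivWithin c (Icc a' b') t with hc'
    have hcd : ContDiffOn ℝ 1 c (Icc a' b') := contDiffOn_chart (n := 1) hea hγ'.1 fun t ht ↦ (hin t ht).1
    have hc'c : ContinuousOn c' (Icc a' b') :=
      hcd.continuousOn_derivWithin (uniqueDiffOn_Icc hab') le_rfl
    obtain ⟨M₀, hM₀⟩ := isCompact_Icc.exists_bound_of_continuousOn hc'c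
    obtain ⟨r, hr, hpush⟩ := hpush (max M₀ 1) (by positivity)
    -- Pieces this short satisfy `(u - s) * ‖T‖ ≤ r`, so the displacement `(η * (u - t)) • T` stays
    -- within the `η * r` allowed by `exists_push`.
    refine ⟨min ρ (r / (2 * (‖T‖ + 1))), by positivity, ?_⟩
    intro s₁ hs₁ u₁ hu₁ _ hs₂ hu₂ s u hs hsu hu hx
    rcases hsu.eq_or_lt with rfl | hsu
    · exact hx
    have m1 := min_le_left ρ (r / (2 * (‖T‖ + 1)))
    have m2 := min_le_right ρ (r / (2 * (‖T‖ + 1)))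
    have hsub : Icc s u ⊆ Icc a' b' := by
      apply Icc_subset_Icc
      · exact max_le (hs₁.1.trans hs) (by linarith)
      · exact le_min (hu.trans hu₁.2) (by linarith)
    have hus : (u - s) * ‖T‖ ≤ r := by
      have h1 : u - s ≤ 2 * (r / (2 * (‖T‖ + 1))) := by linarith
      have h2 : 2 * (r / (2 * (‖T‖ + 1))) = r / (‖T‖ + 1) := by field_simp
      rw [h2, le_div_iff₀ (by positivity)] at h1
      nlinarith [norm_nonneg T]
    have hsI := hin s (hsub (left_mem_Icc.2 hsu.le))
    -- a slightly earlier starting point is still in the timelike future of `x`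
    have hcont : ContinuousAt (fun η : ℝ ↦ e.symm (c s - (η * (u - s)) • T)) 0 := by
      have h1 : ContinuousAt e.symm (c s - ((0 : ℝ) * (u - s)) • T) := by
        simpa using e.continuousAt_symm (e.map_source hsI.1)
      exact ContinuousAt.comp (f := fun η : ℝ ↦ c s - (η * (u - s)) • T) h1 (by fun_prop)
    have hev : ∀ᶠ η in 𝓝 (0 : ℝ), S.ChronLT x (e.symm (c s - (η * (u - s)) • T)) := by
      apply hcont.eventually
      have : e.symm (c s - ((0 : ℝ) * (u - s)) • T) = γ s := by
        simp [hc, e.left_inv hsI.1]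
      simpa only [this] using hx.eventually
    have hsmall : ∀ᶠ η in 𝓝 (0 : ℝ), η * r < ε / 2 := by
      have : ContinuousAt (fun η : ℝ ↦ η * r) 0 := by fun_prop
      exact this.eventually_lt_const (by simpa using half_pos hε)
    obtain ⟨η, hη1, hη2, hη3, hη0⟩ := ((hev.filter_mono nhdsWithin_le_nhds).and
      ((hsmall.filter_mono nhdsWithin_le_nhds).and
        (((eventually_le_nhds (show (0 : ℝ) < 1 from one_pos)).filter_mono
          nhdsWithin_le_nhds).and self_mem_nhdsWithin))).exists (f := 𝓝[>] (0 : ℝ))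
    refine hη1.trans ?_
    have hshift : ∀ t ∈ Icc s u, ‖c t - (η * (u - t)) • T - c t‖ ≤ η * r := by
      intro t ht
      rw [sub_sub_cancel_left, norm_neg, norm_smul, Real.norm_eq_abs,
        abs_of_nonneg (mul_nonneg hη0.le (by linarith [ht.2])), mul_assoc]
      refine mul_le_mul_of_nonneg_left (le_trans ?_ hus) hη0.le
      exact mul_le_mul_of_nonneg_right (by linarith [ht.1]) (norm_nonneg T)
    have hball : ∀ t ∈ Icc s u, c t - (η * (u - t)) • T ∈ ball (e (γ t₀)) ε := by
      intro t ht
      have h1 := (hin t (hsub ht)).2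
      rw [mem_ball, dist_eq_norm] at h1 ⊢
      calc ‖c t - (η * (u - t)) • T - e (γ t₀)‖
          = ‖(c t - (η * (u - t)) • T - c t) + (c t - e (γ t₀))‖ := by congr 1; abel
        _ ≤ _ := norm_add_le _ _
        _ < ε := by linarith [hshift t ht]
    -- Since the displacement decreases in `t`, differentiating it adds exactly `η • T` to the
    -- velocity; it vanishes at `u`, so the new curve ends at `γ u`.
    have harc : IsArc S.FutureTimelikeVec (fun t ↦ e.symm (c t - (η * (u - t)) • T)) s u := by
      refine isArc_chart_symm hea hsu (c' := fun t ↦ c' t + η • T) ?_ ?_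
        (fun t ht ↦ hU (hball t ht)) ?_
      · intro t ht
        have h1 : HasDerivWithinAt c (c' t) (Icc s u) t :=
          ((hcd.differentiableOn one_ne_zero t (hsub ht)).hasDerivWithinAt).mono hsub
        have h2 : HasDerivAt (fun t ↦ (η * (u - t)) • T) (-(η • T)) t := by
          have h3 : HasDerivAt (fun t ↦ η * (u - t)) (-η) t := by
            simpa using ((hasDerivAt_id t).const_sub u).const_mul η
          simpa using h3.smul_const T
        have h4 := h1.sub (h2.hasDerivWithinAt (s := Icc s u))
        rw [sub_neg_eq_add] at h4
        exact h4
      · exact (hc'c.mono hsub).add continuousOn_const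
      · intro t ht w hw
        have htar := hU (hball t ht)
        rw [futureTimelikeVec_iff_chart hea (e.map_target htar), hw, e.right_inv htar]
        have hti := hin t (hsub ht)
        have hvel := hasDerivWithinAt_chart hea hti.1
          ((hγ'.1 t (hsub ht)).mdifferentiableWithinAt one_ne_zero)
        have hvel' : c' t = chartDeriv e (γ t) (velocity (E := E) γ (Icc a' b') t) :=
          hvel.derivWithin (uniqueDiffOn_Icc hab' t (hsub ht))
        have hfc := (futureCausalVec_iff_chart hea hti.1).1 (hγ'.2 t (hsub ht))
        rw [← hvel'] at hfc
        have := hpush (c t) (ball_subset_ball (by linarith) hti.2) _ (hball t ht) (c' t) η hη0 hη3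
          hfc.1 hfc.2 ((hM₀ t (hsub ht)).trans (le_max_left _ _)) (hshift t ht)
        exact ⟨this.1, this.2.le⟩
    have := chronLT_of_isPath (.arc hsu harc)
    simpa [hc, e.left_inv (hin u (hsub (right_mem_Icc.2 hsu.le))).1] using this
  · intro p q r s _ hpq hqr hrs _ h1 h2 t u hpt htu hus ht
    rcases le_or_gt u r with hur | hur
    · exact h1 t u hpt htu hur ht
    rcases le_or_gt q t with hqt | hqt
    · exact h2 t u hqt htu hus ht
    · exact h2 q u le_rfl (hqr.le.trans hur.le) hus (h1 t q hpt hqt.le hqr.le ht)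

/-- Push-up: `x ≪ y ≤ z` implies `x ≪ z`. -/
lemma ChronLT.trans_causalLE [FiniteDimensional ℝ E] (h : S.ChronLT x y) (h' : S.CausalLE y z) :
    S.ChronLT x z := by
  obtain ⟨γ, hγ⟩ := h'
  obtain ⟨hp, rfl, rfl⟩ := isFutureCausalCurve_iff.1 hγ
  have key : ∀ {a b : ℝ}, IsPath S.FutureCausalVec γ a b → S.ChronLT x (γ a) →
      S.ChronLT x (γ b) := by
    intro a b hp h
    induction hp with
    | arc hlt hγ => exact chronLT_of_chronLT_of_isArc hlt hγ h
    | snoc _ hlt hγ ih => exact chronLT_of_chronLT_of_isArc hlt hγ ih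
  exact key hp h

lemma CausalLE.trans_chronLT [FiniteDimensional ℝ E] (h : S.CausalLE x y) (h' : S.ChronLT y z) :
    S.ChronLT x z :=
  dual_chronLT_iff.1 ((dual_chronLT_iff.2 h').trans_causalLE (dual_causalLE_iff.2 h))

/-- In a strongly causal spacetime, every neighbourhood contains a causally convex one. -/
lemma StronglyCausal.exists_causallyConvex [FiniteDimensional ℝ E] (hS : S.StronglyCausal) {p : M}
    {V : Set M} (hV : V ∈ 𝓝 p) : ∃ W ∈ 𝓝 p, W ⊆ V ∧
      ∀ x ∈ W, ∀ y ∈ W, ∀ z, S.CausalLE x z → S.CausalLE z y → z ∈ W := by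
  -- Finite intersections of diamonds form a basis, and push-up at both ends makes every diamond
  -- causally convex.
  have hb := TopologicalSpace.isTopologicalBasis_of_subbasis hS
  obtain ⟨W, hW, hpW, hWV⟩ := hb.mem_nhds_iff.1 hV
  refine ⟨W, hb.mem_nhds hW hpW, hWV, ?_⟩
  obtain ⟨f, ⟨_, hf⟩, rfl⟩ := hW
  intro x hx y hy z hxz hzy D hD
  obtain ⟨q, r, rfl⟩ := hf hD
  exact ⟨(hx _ hD).1.trans_causalLE hxz, hzy.trans_chronLT (hy _ hD).2⟩

end Spacetime

/-! ### Local calibrations by functions with timelike gradient -/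

section Calibration

open Metric Filter Topology

variable {E : Type*} [NormedAddCommGroup E] [NormedSpace ℝ E]

/-- In the variables `|α| * Y` and `W` the expression dominates a binary quadratic form whose
discriminant is nonpositive by `hABQ`. -/
lemma quadratic_nonneg {α a b q A B Q Y W : ℝ} (hQ : 0 < Q) (ha : A * Y ^ 2 ≤ a) (hb : |b| ≤ B * Y * W) (hq : Q * W ^ 2 ≤ q)
    (hABQ : B ^ 2 ≤ A * Q) : 0 ≤ α ^ 2 * a + 2 * α * b + q := by
  have h1 : |α| ^ 2 * (A * Y ^ 2) ≤ α ^ 2 * a := by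
    rw [sq_abs]
    exact mul_le_mul_of_nonneg_left ha (sq_nonneg α)
  have h2 : -(2 * |α| * (B * Y * W)) ≤ 2 * α * b := by
    have : |2 * α * b| ≤ 2 * |α| * (B * Y * W) := by
      rw [abs_mul, abs_mul, abs_two]
      exact mul_le_mul_of_nonneg_left hb (by positivity)
    exact (abs_le.1 this).1
  have h3 : (|α| * Y) ^ 2 * B ^ 2 ≤ (|α| * Y) ^ 2 * (A * Q) :=
    mul_le_mul_of_nonneg_left hABQ (sq_nonneg _)
  have h4 : 0 ≤ |α| ^ 2 * (A * Y ^ 2) - 2 * |α| * (B * Y * W) + Q * W ^ 2 := by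
    refine nonneg_of_mul_nonneg_right (b := _) (a := Q) ?_ hQ
    nlinarith [sq_nonneg (Q * W - |α| * Y * B)]
  linarith

/-- The pointwise estimate behind the calibration. Here `G₀` and `G₁` are the metrics at `c (τ x)`
and `x`, `Z` is the velocity of the geodesic, `y = x - c (τ x)`, `D` is the derivative of the metric
in direction `y`, and `τ` is the time elapsed since `t₀`. The square on the right is that of the
differential of `f` on `α • Z + w`. To first order in `y` the coefficients of `α ^ 2` cancel; the
term with `K`, positive because `Gp` is negative on `y`, absorbs the second-order Taylor error and
the mixed terms. -/
lemma calibration_inequality {G₀ G₁ Gp D : E →L[ℝ] E →L[ℝ] ℝ}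
    {Z y w : E} {κ δ N K τ : ℝ} (α : ℝ) (hsymm : ∀ v w, G₁ v w = G₁ w v) (hκ : 0 < κ)
    (hδ : 0 < δ) (hN : 1 ≤ N) (hK : 0 ≤ K) (hZZ : G₀ Z Z = κ ^ 2) (hG₀ : ‖G₀‖ ≤ N) (hGp : ‖Gp‖ ≤ N)
    (hD : ‖D‖ ≤ N * ‖y‖) (hZ : ‖Z‖ ≤ N) (hlip : ‖G₁ - G₀‖ ≤ N * ‖y‖)
    (htaylor : ‖G₁ - G₀ - D‖ ≤ N * ‖y‖ ^ 2) (hy : δ * ‖y‖ ^ 2 ≤ -Gp y y)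
    (hw : δ * ‖w‖ ^ 2 ≤ -G₁ w w) (hy1 : ‖y‖ ≤ 1) (hKy : K * ‖y‖ ≤ 1) (hKτ : K * |τ| ≤ 1)
    (hKN : (3 * κ ^ 2 * N ^ 2 + 6 * N ^ 5) ^ 2 ≤
      κ ^ 2 * (2 * K * δ - N ^ 3) * (κ ^ 2 * δ)) :
    κ ^ 2 * G₁ (α • Z + w) (α • Z + w) ≤
      (α * (κ ^ 2 + D Z Z / 2 - K * Gp y y) + (G₀ Z w - 2 * K * τ * Gp y w)) ^ 2 := by
  have hN0 : 0 ≤ N := by linarith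
  have hY := norm_nonneg y
  have hW := norm_nonneg w
  set Y := ‖y‖ with hYd
  set W := ‖w‖ with hWd
  set u := D Z Z / 2 - K * Gp y y with hu
  set s := -(2 * K * τ * Gp y w) with hs
  have hDZ : |D Z Z| ≤ N ^ 3 * Y := by
    calc |D Z Z| ≤ ‖D‖ * ‖Z‖ * ‖Z‖ := D.le_opNorm₂ Z Z
      _ ≤ (N * Y) * N * N := by gcongr
      _ = N ^ 3 * Y := by ring
  have hGyy : |Gp y y| ≤ N * Y * Y := ((Gp.le_opNorm₂ y y)).trans (by gcongr)
  have hGyw : |Gp y w| ≤ N * Y * W := ((Gp.le_opNorm₂ y w)).trans (by gcongr)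
  have hP : |G₀ Z w| ≤ N ^ 2 * W := by
    calc |G₀ Z w| ≤ ‖G₀‖ * ‖Z‖ * W := G₀.le_opNorm₂ Z w
      _ ≤ N * N * W := by gcongr
      _ = _ := by ring
  have hN13 : N ≤ N ^ 3 := le_self_pow₀ hN (by norm_num)
  have hN12 : N ≤ N ^ 2 := le_self_pow₀ hN (by norm_num)
  have hN45 : N ^ 4 ≤ N ^ 5 := pow_le_pow_right₀ hN (by norm_num)
  have hu1 : |u| ≤ 2 * N ^ 3 * Y := by
    have h1 : |K * Gp y y| ≤ N * Y := by
      rw [abs_mul, abs_of_nonneg hK]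
      calc K * |Gp y y| ≤ K * (N * Y * Y) := by gcongr
        _ = (K * Y) * (N * Y) := by ring
        _ ≤ 1 * (N * Y) := by gcongr
        _ = _ := one_mul _
    have h2 : N * Y ≤ N ^ 3 * Y := by gcongr
    have h3 : |D Z Z / 2| ≤ N ^ 3 * Y := by
      rw [abs_div, abs_two]
      linarith [abs_nonneg (D Z Z)]
    calc |u| ≤ |D Z Z / 2| + |K * Gp y y| := abs_sub _ _
      _ ≤ _ := by linarith
  have hs1 : |s| ≤ 2 * N * Y * W := by
    rw [hs, abs_neg, abs_mul, abs_mul, abs_mul, abs_two, abs_of_nonneg hK]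
    calc 2 * K * |τ| * |Gp y w| ≤ 2 * K * |τ| * (N * Y * W) := by gcongr
      _ = (K * |τ|) * (2 * N * Y * W) := by ring
      _ ≤ 1 * (2 * N * Y * W) := by gcongr
      _ = _ := one_mul _
  have hdiff : |G₁ Z w - G₀ Z w| ≤ N ^ 2 * Y * W := by
    have := (G₁ - G₀).le_opNorm₂ Z w
    rw [Real.norm_eq_abs, _root_.sub_apply, _root_.sub_apply] at this
    calc _ ≤ _ := this
      _ ≤ (N * Y) * N * W := by gcongr
      _ = _ := by ring
  have htay : |G₁ Z Z - κ ^ 2 - D Z Z| ≤ N ^ 3 * Y ^ 2 := by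
    have := (G₁ - G₀ - D).le_opNorm₂ Z Z
    rw [Real.norm_eq_abs, _root_.sub_apply, _root_.sub_apply, _root_.sub_apply,
      _root_.sub_apply, hZZ] at this
    calc _ ≤ _ := this
      _ ≤ (N * Y ^ 2) * N * N := by gcongr
      _ = _ := by ring
  have hexp : (α * (κ ^ 2 + D Z Z / 2 - K * Gp y y) + (G₀ Z w - 2 * K * τ * Gp y w)) ^ 2
      - κ ^ 2 * G₁ (α • Z + w) (α • Z + w) =
      α ^ 2 * ((κ ^ 2 + u) ^ 2 - κ ^ 2 * G₁ Z Z) +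
      2 * α * ((κ ^ 2 + u) * (G₀ Z w + s) - κ ^ 2 * G₁ Z w) +
      ((G₀ Z w + s) ^ 2 - κ ^ 2 * G₁ w w) := by
    simp only [map_add, map_smul, _root_.add_apply, _root_.smul_apply, smul_eq_mul, hsymm w Z,
      hu, hs]
    ring
  rw [← sub_nonneg, hexp]
  have hκ2 : 0 < κ ^ 2 := by positivity
  -- The first-order cancellation makes the `α ^ 2` coefficient quadratic in `Y`; the mixed
  -- coefficient is linear in `Y`, and the last one is controlled by the negativity of `G₁` on `w`.
  refine quadratic_nonneg (A := κ ^ 2 * (2 * K * δ - N ^ 3)) (Q := κ ^ 2 * δ) (Y := Y) (W := W)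
    (B := 3 * κ ^ 2 * N ^ 2 + 6 * N ^ 5) (by positivity) ?_ ?_ ?_ hKN
  · have h1 := (abs_le.1 htay).2
    have h2 : K * (δ * Y ^ 2) ≤ K * (-Gp y y) := mul_le_mul_of_nonneg_left hy hK
    have h3 : (2 * K * δ - N ^ 3) * Y ^ 2 ≤ κ ^ 2 + 2 * u - G₁ Z Z := by
      rw [hu]
      linarith only [h1, h2]
    have h4 := mul_le_mul_of_nonneg_left h3 hκ2.le
    calc _ = κ ^ 2 * ((2 * K * δ - N ^ 3) * Y ^ 2) := by ring
      _ ≤ _ := h4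
      _ ≤ κ ^ 2 * (κ ^ 2 + 2 * u - G₁ Z Z) + u ^ 2 := le_add_of_nonneg_right (sq_nonneg u)
      _ = _ := by ring
  · have e : (κ ^ 2 + u) * (G₀ Z w + s) - κ ^ 2 * G₁ Z w =
        -(κ ^ 2 * (G₁ Z w - G₀ Z w)) + κ ^ 2 * s + u * G₀ Z w + u * s := by ring
    have h1 : |-(κ ^ 2 * (G₁ Z w - G₀ Z w))| ≤ κ ^ 2 * (N ^ 2 * Y * W) := by
      rw [abs_neg, abs_mul, abs_of_pos hκ2]
      gcongr
    have h2 : |κ ^ 2 * s| ≤ κ ^ 2 * (2 * N ^ 2 * Y * W) := by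
      rw [abs_mul, abs_of_pos hκ2]
      refine mul_le_mul_of_nonneg_left (hs1.trans ?_) hκ2.le
      gcongr
    have h3 : |u * G₀ Z w| ≤ 2 * N ^ 5 * Y * W := by
      rw [abs_mul]
      calc _ ≤ (2 * N ^ 3 * Y) * (N ^ 2 * W) := by gcongr
        _ = _ := by ring
    have h4 : |u * s| ≤ 4 * N ^ 5 * Y * W := by
      rw [abs_mul]
      calc _ ≤ (2 * N ^ 3 * Y) * (2 * N * Y * W) := by gcongr
        _ = 4 * N ^ 4 * Y * W * Y := by ring
        _ ≤ 4 * N ^ 5 * Y * W * 1 := by gcongr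
        _ = _ := mul_one _
    rw [e]
    calc _ ≤ |-(κ ^ 2 * (G₁ Z w - G₀ Z w))| + |κ ^ 2 * s| + |u * G₀ Z w| + |u * s| :=
          (abs_add_le _ _).trans (add_le_add (abs_add_three _ _ _) le_rfl)
      _ ≤ _ := add_le_add (add_le_add (add_le_add h1 h2) h3) h4
      _ = _ := by ring
  · have := mul_le_mul_of_nonneg_left hw hκ2.le
    calc _ = κ ^ 2 * (δ * W ^ 2) := by ring
      _ ≤ _ := this
      _ ≤ (G₀ Z w + s) ^ 2 + κ ^ 2 * -G₁ w w := le_add_of_nonneg_left (sq_nonneg _)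
      _ = _ := by ring

/-- Taylor bounds for a `C²` function near a point. -/
lemma exists_taylor_bound {F : Type*} [NormedAddCommGroup F] [NormedSpace ℝ F] {U : Set E}
    {G : E → F} (hU : IsOpen U) (hG : ContDiffOn ℝ ∞ G U) {p : E} (hp : p ∈ U) :
    ∃ ε > 0, ∃ N ≥ (1 : ℝ), ball p ε ⊆ U ∧ ∀ x ∈ ball p ε, ‖G x‖ ≤ N ∧
      (∀ y, ‖fderiv ℝ G x y‖ ≤ N * ‖y‖) ∧
      ∀ z ∈ ball p ε, ‖G z - G x‖ ≤ N * ‖z - x‖ ∧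
        ‖G z - G x - fderiv ℝ G x (z - x)‖ ≤ N * ‖z - x‖ ^ 2 := by
  have hUp : U ∈ 𝓝 p := hU.mem_nhds hp
  have hGd : ContDiffAt ℝ 1 G p := (hG.contDiffAt hUp).of_le (mod_cast le_top)
  have hDd : ContDiffAt ℝ 1 (fderiv ℝ G) p :=
    (hG.contDiffAt hUp).fderiv_right (m := 1) (by
      rw [one_add_one_eq_two]
      exact WithTop.coe_le_coe.2 (le_top (a := (2 : ℕ∞))))
  obtain ⟨C, s, hs, hLip⟩ := hGd.exists_lipschitzOnWith
  obtain ⟨C', s', hs', hLip'⟩ := hDd.exists_lipschitzOnWith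
  have e1 : ∀ᶠ x in 𝓝 p, ‖G x‖ < ‖G p‖ + 1 := hGd.continuousAt.norm.eventually_lt_const (by simp)
  have e2 : ∀ᶠ x in 𝓝 p, ‖fderiv ℝ G x‖ < ‖fderiv ℝ G p‖ + 1 :=
    hDd.continuousAt.norm.eventually_lt_const (by simp)
  obtain ⟨ε, hε, hb⟩ := Metric.eventually_nhds_iff_ball.1
    (e1.and (e2.and ((eventually_mem_set.2 hs).and ((eventually_mem_set.2 hs').and
      (eventually_mem_set.2 hUp)))))
  refine ⟨ε, hε, max 1 (max (max (‖G p‖ + 1) (‖fderiv ℝ G p‖ + 1)) (max C C')), le_max_left _ _,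
    fun x hx ↦ (hb x hx).2.2.2.2, fun x hx ↦ ⟨?_, ?_, fun z hz ↦ ⟨?_, ?_⟩⟩⟩
  · exact (hb x hx).1.le.trans <| le_max_of_le_right <| le_max_of_le_left <| le_max_left _ _
  · refine fun y ↦ (fderiv ℝ G x).le_of_opNorm_le ?_ y
    exact (hb x hx).2.1.le.trans <| le_max_of_le_right <| le_max_of_le_left <| le_max_right _ _
  · have := hLip.dist_le_mul z (hb z hz).2.2.1 x (hb x hx).2.2.1
    rw [dist_eq_norm, dist_eq_norm] at this
    refine this.trans ?_
    gcongr
    exact le_max_of_le_right <| le_max_of_le_right <| le_max_left _ _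
  · have h1 : ‖G z - G x - fderiv ℝ G x (z - x)‖ ≤ (C' * ‖z - x‖) * ‖z - x‖ := by
      refine (convex_segment x z).norm_image_sub_le_of_norm_hasFDerivWithin_le'
        (f' := fderiv ℝ G) (fun w hw ↦ ?_) (fun w hw ↦ ?_)
        (left_mem_segment ℝ x z) (right_mem_segment ℝ x z)
      · have hwb := (convex_ball p ε).segment_subset hx hz hw
        exact ((hG.contDiffAt (hU.mem_nhds (hb w hwb).2.2.2.2)).differentiableAt
          (by simp)).hasFDerivAt.hasFDerivWithinAt
      · have hwb := (convex_ball p ε).segment_subset hx hz hw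
        have := hLip'.dist_le_mul w (hb w hwb).2.2.2.1 x (hb x hx).2.2.2.1
        rw [dist_eq_norm, dist_eq_norm] at this
        refine this.trans ?_
        gcongr
        have h2 := dist_add_dist_of_mem_segment hw
        rw [dist_comm, dist_eq_norm] at h2
        have h3 : dist x z = ‖z - x‖ := by rw [dist_comm, dist_eq_norm]
        linarith [dist_nonneg (x := w) (y := z)]
    calc _ ≤ _ := h1
      _ = C' * ‖z - x‖ ^ 2 := by ring
      _ ≤ _ := by
        gcongr
        exact le_max_of_le_right <| le_max_of_le_right <| le_max_right _ _

end Calibration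

/-! ### Construction of the calibration along a geodesic -/

section Calibration

set_option maxSynthPendingDepth 3

open Metric Filter Topology

variable {E : Type*} [NormedAddCommGroup E] [NormedSpace ℝ E]

lemma HasDerivAt.comp_hasFDerivAt_real {F : Type*} [NormedAddCommGroup F] [NormedSpace ℝ F]
    {g : ℝ → F} {g' : F} {τ : E → ℝ} {τ' : E →L[ℝ] ℝ} {x : E} (hg : HasDerivAt g g' (τ x))
    (hτ : HasFDerivAt τ τ' x) : HasFDerivAt (fun x ↦ g (τ x)) (τ'.smulRight g') x := by
  convert! hg.hasFDerivAt.comp x hτ using 1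

lemma ContinuousAt.eventually_le_of_lt {Z : Type*} [TopologicalSpace Z] {f : Z → ℝ} {p : Z} {v : ℝ}
    (hf : ContinuousAt f p) (h : f p < v) : ∀ᶠ x in 𝓝 p, f x ≤ v :=
  (Tendsto.eventually_lt_const h hf).mono fun _ h ↦ h.le

/-- A `C²` solution `c`, with derivatives `c'` and `c''`, of the geodesic equation of the metric `G`
on the set of times `J`. -/
structure IsChartGeodesic (U : Set E) (G : E → E →L[ℝ] E →L[ℝ] ℝ) (c c' c'' : ℝ → E)
    (J : Set ℝ) : Prop where
  mem : ∀ t ∈ J, c t ∈ U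
  hasDeriv : ∀ t ∈ J, HasDerivWithinAt c (c' t) J t
  hasDeriv' : ∀ t ∈ J, HasDerivWithinAt c' (c'' t) J t
  equation : ∀ t ∈ J, ∀ w, G (c t) (c'' t) w + fderiv ℝ G (c t) (c' t) (c' t) w
    - fderiv ℝ G (c t) w (c' t) (c' t) / 2 = 0

variable {U : Set E} {G : E → E →L[ℝ] E →L[ℝ] ℝ} {X : E → E} {c c' c'' : ℝ → E}

lemma IsChartGeodesic.hasDerivWithinAt_momentum {J : Set ℝ} (hG : IsLocalSpacetime U G X)
    (h : IsChartGeodesic U G c c' c'' J) {t : ℝ} (ht : t ∈ J) :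
    HasDerivWithinAt (fun t ↦ G (c t) (c' t))
      (fderiv ℝ G (c t) (c' t) (c' t) + G (c t) (c'' t)) J t := by
  have h1 : HasFDerivAt G (fderiv ℝ G (c t)) (c t) :=
    ((hG.smooth.contDiffAt (hG.isOpen.mem_nhds (h.mem t ht))).differentiableAt
      (by simp)).hasFDerivAt
  have h2 : HasDerivWithinAt (fun t ↦ G (c t)) (fderiv ℝ G (c t) (c' t)) J t :=
    h1.comp_hasDerivWithinAt (f := c) t (h.hasDeriv t ht)
  exact h2.clm_apply (h.hasDeriv' t ht)

/-- The geodesic equation in Euler–Lagrange form: the derivative of the momentum `G c'` is half the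
differential of the metric evaluated on the velocity. It eliminates `c''` from the differential of
the calibration. -/
lemma IsChartGeodesic.momentum_deriv_apply {J : Set ℝ}
    (h : IsChartGeodesic U G c c' c'' J) {t : ℝ} (ht : t ∈ J) (w : E) :
    (fderiv ℝ G (c t) (c' t) (c' t) + G (c t) (c'' t)) w =
      fderiv ℝ G (c t) w (c' t) (c' t) / 2 := by
  have := h.equation t ht w
  rw [_root_.add_apply]
  linarith

/-- The speed of a geodesic is constant. -/
lemma IsChartGeodesic.hasDerivWithinAt_speed {J : Set ℝ} (hG : IsLocalSpacetime U G X)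
    (h : IsChartGeodesic U G c c' c'' J) {t : ℝ} (ht : t ∈ J) :
    HasDerivWithinAt (fun t ↦ G (c t) (c' t) (c' t)) 0 J t := by
  have h1 := (h.hasDerivWithinAt_momentum hG ht).clm_apply (h.hasDeriv' t ht)
  convert! h1 using 1
  rw [h.momentum_deriv_apply ht, (hG.lorentzian _ (h.mem t ht)).symm]
  linarith [h.equation t ht (c' t)]

-- The differential of `f` dominates `κ` times the Lorentzian norm on future causal vectors, while
-- `f` grows at exactly the rate `κ ^ 2` along `c`. Integrating along competitors therefore shows
-- that `c` is longest among the causal curves contained in `V`.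
set_option maxHeartbeats 1000000 in
theorem IsLocalSpacetime.exists_calibration [FiniteDimensional ℝ E] (hG : IsLocalSpacetime U G X)
    {t₀ ρ : ℝ} (hρ : 0 < ρ) (hgeo : IsChartGeodesic U G c c' c'' (Ioo (t₀ - ρ) (t₀ + ρ)))
    {κ : ℝ} (hκ : 0 < κ) (hspeed : ∀ t ∈ Ioo (t₀ - ρ) (t₀ + ρ), G (c t) (c' t) (c' t) = κ ^ 2)
    (hfut : 0 ≤ G (c t₀) (c' t₀) (X (c t₀))) :
    ∃ (f : E → ℝ) (f' : E → E →L[ℝ] ℝ), ∃ V ∈ 𝓝 (c t₀), ∃ ε > 0, V ⊆ U ∧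
      (∀ x ∈ V, HasFDerivAt f (f' x) x) ∧ (∀ t, |t - t₀| < ε → f (c t) = κ ^ 2 * t) ∧
      ∀ x ∈ V, ∀ v, 0 ≤ G x v v → 0 ≤ G x v (X x) → κ * √(G x v v) ≤ f' x v := by
  set p := c t₀ with hp
  set I := Ioo (t₀ - ρ) (t₀ + ρ) with hI
  have hIo : IsOpen I := isOpen_Ioo
  have ht₀ : t₀ ∈ I := ⟨by linarith, by linarith⟩
  have hpU : p ∈ U := hgeo.mem t₀ ht₀
  have hd : ∀ t ∈ I, HasDerivAt c (c' t) t := fun t ht ↦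
    (hgeo.hasDeriv t ht).hasDerivAt (hIo.mem_nhds ht)
  have hd' : ∀ t ∈ I, HasDerivAt c' (c'' t) t := fun t ht ↦
    (hgeo.hasDeriv' t ht).hasDerivAt (hIo.mem_nhds ht)
  set Z := c' t₀ with hZ
  have hZZ : G p Z Z = κ ^ 2 := hspeed t₀ ht₀
  have hκ2 : 0 < κ ^ 2 := by positivity
  set Gp := G p with hGp
  have hlor := hG.lorentzian p hpU
  set l : E →L[ℝ] ℝ := Gp Z with hl
  set H : Submodule ℝ E := LinearMap.ker (l : E →ₗ[ℝ] ℝ) with hH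
  have hmemH : ∀ v, v ∈ H ↔ l v = 0 := fun v ↦ LinearMap.mem_ker
  have hUn : U ∈ 𝓝 p := hG.isOpen.mem_nhds hpU
  have hGc : ContinuousAt G p := (hG.smooth.contDiffAt hUn).continuousAt
  have hDc : ContinuousAt (fderiv ℝ G) p :=
    ((hG.smooth.contDiffAt hUn).fderiv_right (m := 1) (by
      rw [one_add_one_eq_two]
      exact WithTop.coe_le_coe.2 (le_top (a := (2 : ℕ∞))))).continuousAt
  obtain ⟨δ, hδ, hneg⟩ := eventually_mul_sq_le (z₀ := p) (F := fun x w ↦ -G x w w) H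
    (fun v ↦ (((hGc.comp (x := (p, v)) continuousAt_fst).clm_apply continuousAt_snd).clm_apply
      continuousAt_snd).neg)
    (fun x k v ↦ by simp only [map_smul, _root_.smul_apply, smul_eq_mul]; ring)
    (fun v hv hv0 ↦ neg_pos.2 (hlor.neg_of_orthogonal (hZZ ▸ hκ2) ((hmemH v).1 hv) hv0))
  have hnegp := hneg.self_of_nhds
  obtain ⟨ε₁, hε₁, N₁, hN₁, hball, htay⟩ := exists_taylor_bound hG.isOpen hG.smooth hpU
  obtain ⟨ε₂, hε₂, _, htl⟩ := hG.exists_ball_timelike hpU (T := Z) (hZZ ▸ hκ2) hfut (hZZ ▸ hκ2)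
  set N := max N₁ (‖Z‖ + 1) with hN
  have hN1 : 1 ≤ N := hN₁.trans (le_max_left _ _)
  have hN0 : 0 ≤ N := by linarith
  have hN₁N : N₁ ≤ N := le_max_left _ _
  set B := 3 * κ ^ 2 * N ^ 2 + 6 * N ^ 5 with hB
  -- Chosen so that the discriminant condition of `calibration_inequality` holds with equality; this
  -- is possible for any Taylor bound `N`, since `K` enters that condition linearly.
  set K := (N ^ 3 + B ^ 2 / (κ ^ 4 * δ)) / (2 * δ) with hK
  have hK0 : 0 ≤ K := by positivity
  have hKB : B ^ 2 ≤ κ ^ 2 * (2 * K * δ - N ^ 3) * (κ ^ 2 * δ) := by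
    apply le_of_eq
    rw [hK]
    field_simp
    ring
  -- the time function `τ`, constant on the hyperplanes parallel to `H`
  set φ : ℝ → ℝ := fun t ↦ l (c t) with hφ
  have hφd : ∀ t ∈ I, HasDerivAt φ (l (c' t)) t := fun t ht ↦
    l.hasFDerivAt.comp_hasDerivAt t (hd t ht)
  have hlZ : l Z ≠ 0 := by
    change Gp Z Z ≠ 0
    rw [hZZ]
    exact hκ2.ne'
  have hstrict : HasStrictDerivAt φ (l Z) t₀ := by
    refine hasStrictDerivAt_of_hasDerivAt_of_continuousAt (f' := fun t ↦ l (c' t)) ?_ ?_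
    · filter_upwards [hIo.mem_nhds ht₀] with t ht using hφd t ht
    · exact l.continuous.continuousAt.comp (hd' t₀ ht₀).continuousAt
  have hsf := hstrict.hasStrictFDerivAt_equiv hlZ
  set Φ := hsf.toOpenPartialHomeomorph φ with hΦ
  have hΦc : ∀ t, Φ t = φ t := fun t ↦ rfl
  have ht₀s : t₀ ∈ Φ.source := hsf.mem_toOpenPartialHomeomorph_source
  set τ : E → ℝ := fun x ↦ Φ.symm (l x) with hτ
  have hτp : τ p = t₀ := Φ.left_inv ht₀s
  have hlp : l p ∈ Φ.target := Φ.map_source ht₀s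
  have hτc : ContinuousAt τ p :=
    ContinuousAt.comp (f := l) (Φ.continuousAt_symm hlp) l.continuous.continuousAt
  have hcτ : ContinuousAt (fun x ↦ c (τ x)) p := by
    refine ContinuousAt.comp (g := c) (f := τ) ?_ hτc
    rw [hτp]
    exact (hd t₀ ht₀).continuousAt
  have hcτ' : ContinuousAt (fun x ↦ c' (τ x)) p := by
    refine ContinuousAt.comp (g := c') (f := τ) ?_ hτc
    rw [hτp]
    exact (hd' t₀ ht₀).continuousAt
  have hyc : ContinuousAt (fun x ↦ x - c (τ x)) p := continuousAt_id.sub hcτ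
  have hyp : p - c (τ p) = 0 := by rw [hτp, hp, sub_self]
  set u : E → ℝ := fun x ↦ κ ^ 2 + fderiv ℝ G (c (τ x)) (x - c (τ x)) (c' (τ x)) (c' (τ x)) / 2
    - K * Gp (x - c (τ x)) (x - c (τ x)) with hu
  have huc : ContinuousAt u p := by
    have h1 : ContinuousAt (fun x ↦ fderiv ℝ G (c (τ x))) p := by
      refine ContinuousAt.comp (g := fderiv ℝ G) (f := fun x ↦ c (τ x)) ?_ hcτ
      rw [hτp]
      exact hDc
    have h2 := ((h1.clm_apply hyc).clm_apply hcτ').clm_apply hcτ'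
    have h3 := ((continuousAt_const (y := Gp)).clm_apply hyc).clm_apply hyc
    exact (continuousAt_const.add (h2.div_const 2)).sub (h3.const_mul K)
  have hup : 0 < u p := by
    have : u p = κ ^ 2 := by
      simp only [hu, hyp]
      simp
    rwa [this]
  have hev : ∀ᶠ x in 𝓝 p, l x ∈ Φ.target ∧ τ x ∈ I ∧ 0 < l (c' (τ x)) ∧ x ∈ ball p ε₁ ∧
      c (τ x) ∈ ball p ε₁ ∧ ‖c' (τ x)‖ ≤ N ∧ (∀ w ∈ H, δ * ‖w‖ ^ 2 ≤ -G x w w) ∧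
      ‖x - c (τ x)‖ ≤ 1 ∧ K * ‖x - c (τ x)‖ ≤ 1 ∧ K * |τ x - t₀| ≤ 1 ∧ 0 < u x ∧
      x ∈ ball p ε₂ ∧ c' (τ x) ∈ ball Z ε₂ := by
    have h1 : ∀ᶠ x in 𝓝 p, l x ∈ Φ.target :=
      l.continuous.continuousAt.eventually (Φ.open_target.mem_nhds hlp)
    have h2 : ∀ᶠ x in 𝓝 p, τ x ∈ I := hτc.eventually (hIo.mem_nhds (by rwa [hτp]))
    have h3 : ∀ᶠ x in 𝓝 p, 0 < l (c' (τ x)) := by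
      have : ContinuousAt (fun x ↦ l (c' (τ x))) p := l.continuous.continuousAt.comp hcτ'
      refine Tendsto.eventually_const_lt ?_ this
      simp only [hτp]
      exact hZZ ▸ hκ2
    have h5 : ∀ᶠ x in 𝓝 p, c (τ x) ∈ ball p ε₁ :=
      hcτ.eventually (isOpen_ball.mem_nhds (by simpa only [hτp] using mem_ball_self hε₁))
    have h6 : ∀ᶠ x in 𝓝 p, ‖c' (τ x)‖ ≤ N := hcτ'.norm.eventually_le_of_lt (by
      simp only [hτp]
      exact (lt_add_one _).trans_le (le_max_right _ _))
    have h8 : ∀ᶠ x in 𝓝 p, ‖x - c (τ x)‖ ≤ 1 := hyc.norm.eventually_le_of_lt (by simp [hyp])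
    have h9 : ∀ᶠ x in 𝓝 p, K * ‖x - c (τ x)‖ ≤ 1 :=
      (hyc.norm.const_mul K).eventually_le_of_lt (by simp [hyp])
    have h10 : ∀ᶠ x in 𝓝 p, K * |τ x - t₀| ≤ 1 := by
      have : ContinuousAt (fun x ↦ K * |τ x - t₀|) p :=
        ((hτc.sub continuousAt_const).abs).const_mul K
      exact this.eventually_le_of_lt (by simp [hτp])
    have h11 : ∀ᶠ x in 𝓝 p, 0 < u x := Tendsto.eventually_const_lt hup huc
    have h13 : ∀ᶠ x in 𝓝 p, c' (τ x) ∈ ball Z ε₂ :=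
      hcτ'.eventually (isOpen_ball.mem_nhds (by simpa only [hτp] using mem_ball_self hε₂))
    filter_upwards [h1, h2, h3, ball_mem_nhds p hε₁, h5, h6, hneg, h8, h9, h10, h11,
      ball_mem_nhds p hε₂, h13] with x a1 a2 a3 a4 a5 a6 a7 a8 a9 a10 a11 a12 a13
    exact ⟨a1, a2, a3, a4, a5, a6, a7, a8, a9, a10, a11, a12, a13⟩
  set P : ℝ → E →L[ℝ] ℝ := fun t ↦ G (c t) (c' t) with hP
  set P' : ℝ → E →L[ℝ] ℝ := fun t ↦
    fderiv ℝ G (c t) (c' t) (c' t) + G (c t) (c'' t) with hP'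
  -- The first two terms are the value and the momentum on the geodesic, extended linearly along the
  -- hyperplanes parallel to `H`. In the third, the factor `τ x - t₀` makes the `τ`-derivative a
  -- definite quadratic gain in `y`, while the derivative along `H` has a coefficient that is small
  -- near `t₀`.
  set f : E → ℝ := fun x ↦ κ ^ 2 * τ x + P (τ x) (x - c (τ x))
    - K * (τ x - t₀) * Gp (x - c (τ x)) (x - c (τ x)) with hf
  -- the derivative of `f`
  have hfd : ∀ x, l x ∈ Φ.target → τ x ∈ I → 0 < l (c' (τ x)) →
      ∃ L : E →L[ℝ] ℝ, HasFDerivAt f L x ∧ ∀ α w, w ∈ H → L (α • c' (τ x) + w) =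
        α * u x + (G (c (τ x)) (c' (τ x)) w - 2 * K * (τ x - t₀) * Gp (x - c (τ x)) w) := by
    intro x hx1 hx2 hx3
    have hτd : HasFDerivAt τ ((l (c' (τ x)))⁻¹ • l) x :=
      (Φ.hasDerivAt_symm hx1 hx3.ne' (hφd _ hx2)).comp_hasFDerivAt x l.hasFDerivAt
    set τ' := (l (c' (τ x)))⁻¹ • l with hτ'
    have hcd : HasFDerivAt (fun x ↦ c (τ x)) (τ'.smulRight (c' (τ x))) x :=
      (hd _ hx2).comp_hasFDerivAt_real hτd
    have hyd : HasFDerivAt (fun x ↦ x - c (τ x))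
        (ContinuousLinearMap.id ℝ E - τ'.smulRight (c' (τ x))) x := (hasFDerivAt_id x).sub hcd
    have hPd : HasFDerivAt (fun x ↦ P (τ x)) (τ'.smulRight (P' (τ x))) x :=
      ((hgeo.hasDerivWithinAt_momentum hG hx2).hasDerivAt
        (hIo.mem_nhds hx2)).comp_hasFDerivAt_real hτd
    have hGd : HasFDerivAt (fun x ↦ Gp (x - c (τ x)))
        (Gp.comp (ContinuousLinearMap.id ℝ E - τ'.smulRight (c' (τ x)))) x :=
      Gp.hasFDerivAt.comp x hyd
    have h1 := hPd.clm_apply hyd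
    have h2 := hGd.clm_apply hyd
    have h3 := ((hτd.sub_const t₀).const_mul K).mul h2
    refine ⟨_, ((hτd.const_mul (κ ^ 2)).add h1).sub h3, fun α w hw ↦ ?_⟩
    -- In the splitting `α • c' (τ x) + w` with `w ∈ H`, only `α` moves `τ` and only `w` moves `x -
    -- c (τ x)`.
    have e1 : τ' (α • c' (τ x) + w) = α := by
      simp only [hτ', _root_.smul_apply, map_add, map_smul, (hmemH w).1 hw, smul_eq_mul]
      field_simp
      ring
    have e2 := hgeo.momentum_deriv_apply hx2 (x - c (τ x))
    have e3 : (ContinuousLinearMap.id ℝ E - τ'.smulRight (c' (τ x))) (α • c' (τ x) + w) = w := by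
      simp only [_root_.sub_apply, ContinuousLinearMap.id_apply,
        ContinuousLinearMap.smulRight_apply, e1]
      abel
    simp only [_root_.sub_apply, _root_.add_apply, _root_.smul_apply, smul_eq_mul,
      ContinuousLinearMap.comp_apply, ContinuousLinearMap.flip_apply,
      ContinuousLinearMap.smulRight_apply, ContinuousLinearMap.id_apply, e1] at e3 ⊢
    have e4 : (P' (τ x)) (x - c (τ x)) = fderiv ℝ G (c (τ x)) (x - c (τ x)) (c' (τ x)) (c' (τ x)) / 2 :=
      e2
    have e5 : Gp w (x - c (τ x)) = Gp (x - c (τ x)) w := hlor.symm _ _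
    simp only [e3, e4, e5, hu, hP]
    ring
  choose! f' hf' hf'' using hfd
  set V := {x | l x ∈ Φ.target ∧ τ x ∈ I ∧ 0 < l (c' (τ x)) ∧ x ∈ ball p ε₁ ∧
      c (τ x) ∈ ball p ε₁ ∧ ‖c' (τ x)‖ ≤ N ∧ (∀ w ∈ H, δ * ‖w‖ ^ 2 ≤ -G x w w) ∧
      ‖x - c (τ x)‖ ≤ 1 ∧ K * ‖x - c (τ x)‖ ≤ 1 ∧ K * |τ x - t₀| ≤ 1 ∧ 0 < u x ∧
      x ∈ ball p ε₂ ∧ c' (τ x) ∈ ball Z ε₂} with hV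
  obtain ⟨ε, hε, hεs⟩ := Metric.mem_nhds_iff.1 (Φ.open_source.mem_nhds ht₀s)
  refine ⟨f, f', V, hev, ε, hε, fun x hx ↦ hball hx.2.2.2.1, fun x hx ↦ hf' x hx.1 hx.2.1 hx.2.2.1,
    fun t ht ↦ ?_, ?_⟩
  · have e1 : τ (c t) = t := Φ.left_inv (hεs (by rwa [mem_ball, Real.dist_eq]))
    simp only [hf, e1, sub_self, map_zero]
    simp
  rintro x ⟨a1, a2, a3, a4, a5, a6, a7, a8, a9, a10, a11, a12, a13⟩ v hv hvX
  have hxU := hball a4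
  have hx := hG.lorentzian x hxU
  have hval := hf'' x a1 a2 a3
  have hdec : ∀ v : E, v - (l v / l (c' (τ x))) • c' (τ x) ∈ H := fun v ↦ by
    rw [hmemH, map_sub, map_smul, smul_eq_mul]
    field_simp
    ring
  have hyH : x - c (τ x) ∈ H := by
    rw [hmemH, map_sub]
    have : l (c (τ x)) = l x := Φ.right_inv a1
    rw [this, sub_self]
  obtain ⟨b1, -, b3⟩ := htl x a12 _ a13
  have hsq : ∀ v, κ ^ 2 * G x v v ≤ (f' x v) ^ 2 := by
    intro v
    have d1 := htay (c (τ x)) a5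
    have d2 := d1.2.2 x a4
    have d3 := hval (l v / l (c' (τ x))) _ (hdec v)
    have d4 : (l v / l (c' (τ x))) • c' (τ x) + (v - (l v / l (c' (τ x))) • c' (τ x)) = v := by abel
    have d5 := calibration_inequality (G₀ := G (c (τ x))) (G₁ := G x) (Gp := Gp)
      (D := fderiv ℝ G (c (τ x)) (x - c (τ x))) (Z := c' (τ x)) (y := x - c (τ x))
      (w := v - (l v / l (c' (τ x))) • c' (τ x)) (τ := τ x - t₀) (l v / l (c' (τ x))) hx.symm hκ hδ
      hN1 hK0 (hspeed _ a2) (d1.1.trans hN₁N) ((htay p (mem_ball_self hε₁)).1.trans hN₁N)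
      ((d1.2.1 _).trans (by gcongr)) a6 (d2.1.trans (by gcongr)) (d2.2.trans (by gcongr))
      (hnegp _ hyH) (a7 _ (hdec v)) a8 a9 a10 hKB
    rw [d4] at d3 d5
    rw [d3]
    exact d5
  -- The estimate `hsq` fixes the differential only up to sign. If it were negative on a future
  -- causal `v`, adding a positive multiple of `c' (τ x)` would give a timelike vector on which it
  -- vanishes, contradicting `hsq`.
  have hpos : 0 ≤ f' x v := by
    by_contra! hlt
    have c1 : f' x (c' (τ x)) = u x := by
      have := hval 1 0 H.zero_mem
      simpa using this
    have hv0 : v ≠ 0 := by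
      rintro rfl
      simp at hlt
    have c2 := hx.pos_of_future (hG.timelike x hxU) b1 b3.le hv hvX hv0
    set s := -f' x v / u x with hs
    have hs0 : 0 < s := div_pos (neg_pos.2 hlt) a11
    have c3 : f' x (v + s • c' (τ x)) = 0 := by
      rw [map_add, map_smul, c1, hs, smul_eq_mul]
      field_simp
      ring
    have c4 := hsq (v + s • c' (τ x))
    rw [c3] at c4
    have c5 : 0 < G x (v + s • c' (τ x)) (v + s • c' (τ x)) := by
      have : G x (v + s • c' (τ x)) (v + s • c' (τ x)) = G x v v + 2 * s * G x (c' (τ x)) v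
          + s ^ 2 * G x (c' (τ x)) (c' (τ x)) := by
        simp only [map_add, map_smul, _root_.add_apply, _root_.smul_apply, smul_eq_mul,
          hx.symm v (c' (τ x))]
        ring
      rw [this]
      positivity
    rw [zero_pow two_ne_zero] at c4
    exact absurd c4 (not_le.2 (mul_pos hκ2 c5))
  have := hsq v
  refine abs_le_of_sq_le_sq' ?_ hpos |>.2
  rw [mul_pow, Real.sq_sqrt hv]
  exact this

end Calibration

/-! ### The geodesic equation as an ordinary differential equation -/

section GeodesicFlow

set_option maxSynthPendingDepth 3

open Metric Filter Topology

variable {E : Type*} [NormedAddCommGroup E] [NormedSpace ℝ E]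
  {U : Set E} {G : E → E →L[ℝ] E →L[ℝ] ℝ} {X : E → E}

/-- The geodesic equation is solved for the second derivative by a `C¹` function. -/
lemma IsLocalSpacetime.exists_acceleration [FiniteDimensional ℝ E] (hG : IsLocalSpacetime U G X) :
    ∃ A : E × E → E, (∀ x ∈ U, ∀ v, ContDiffAt ℝ 1 A (x, v)) ∧
      ∀ x ∈ U, ∀ v a, a = A (x, v) ↔
        ∀ w, G x a w + fderiv ℝ G x v v w - fderiv ℝ G x w v v / 2 = 0 := by
  have : CompleteSpace E := FiniteDimensional.complete ℝ E
  set F : E × E → E →L[ℝ] ℝ := fun z ↦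
    (2 : ℝ)⁻¹ • (ContinuousLinearMap.apply ℝ ℝ z.2).comp
      ((ContinuousLinearMap.apply ℝ (E →L[ℝ] ℝ) z.2).comp (fderiv ℝ G z.1))
    - fderiv ℝ G z.1 z.2 z.2 with hF
  have hFv : ∀ x v w, F (x, v) w = fderiv ℝ G x w v v / 2 - fderiv ℝ G x v v w := by
    intro x v w
    simp only [hF, _root_.sub_apply, _root_.smul_apply, smul_eq_mul,
      ContinuousLinearMap.comp_apply, ContinuousLinearMap.apply_apply]
    ring
  have hequiv : ∀ x ∈ U, ∃ e : E ≃L[ℝ] (E →L[ℝ] ℝ), (e : E →L[ℝ] E →L[ℝ] ℝ) = G x := by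
    intro x hx
    have hinj : Function.Injective (G x : E →ₗ[ℝ] E →L[ℝ] ℝ) := (hG.lorentzian x hx).injective
    have hdim : Module.finrank ℝ E = Module.finrank ℝ (E →L[ℝ] ℝ) := by
      have h1 : Module.finrank ℝ (E →L[ℝ] ℝ) = Module.finrank ℝ (E →ₗ[ℝ] ℝ) :=
        (LinearMap.toContinuousLinearMap (𝕜 := ℝ) (E := E) (F' := ℝ)).finrank_eq.symm
      rw [h1]
      exact (Subspace.dual_finrank_eq (K := ℝ) (V := E)).symm
    refine ⟨(LinearEquiv.ofInjectiveOfFinrankEq _ hinj hdim).toContinuousLinearEquiv, ?_⟩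
    ext v w
    rfl
  -- Nondegeneracy makes `G x` an isomorphism onto the dual, and inversion of isomorphisms is
  -- smooth; `F` is the covector that `G x a` has to equal.
  refine ⟨fun z ↦ (G z.1).inverse (F z), fun x hx v ↦ ?_, fun x hx v a ↦ ?_⟩
  · obtain ⟨e, he⟩ := hequiv x hx
    have hGx : ContDiffAt ℝ ∞ G x := hG.smooth.contDiffAt (hG.isOpen.mem_nhds hx)
    have h1 : ContDiffAt ℝ 1 (fun z : E × E ↦ G z.1) (x, v) :=
      (hGx.of_le (by simp)).comp (x, v) contDiffAt_fst
    have h2 : ContDiffAt ℝ 1 (fun z : E × E ↦ fderiv ℝ G z.1) (x, v) :=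
      (hGx.fderiv_right (m := 1) (by
        rw [one_add_one_eq_two]
        exact WithTop.coe_le_coe.2 (le_top (a := (2 : ℕ∞))))).comp (x, v) contDiffAt_fst
    have h3 : ContDiffAt ℝ 1 (fun z : E × E ↦ (G z.1).inverse) (x, v) := by
      have := contDiffAt_map_inverse (n := 1) e
      rw [he] at this
      exact this.comp (x, v) h1
    refine h3.clm_apply (ContDiffAt.sub (ContDiffAt.const_smul (2 : ℝ)⁻¹ ?_)
      ((h2.clm_apply contDiffAt_snd).clm_apply contDiffAt_snd))
    exact ((ContinuousLinearMap.apply ℝ ℝ).contDiff.contDiffAt.comp (x, v) contDiffAt_snd).clm_comp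
      (((ContinuousLinearMap.apply ℝ (E →L[ℝ] ℝ)).contDiff.contDiffAt.comp (x, v)
        contDiffAt_snd).clm_comp h2)
  · obtain ⟨e, he⟩ := hequiv x hx
    have h1 : ∀ w, F (x, v) w - G x a w =
        -(G x a w + fderiv ℝ G x v v w - fderiv ℝ G x w v v / 2) := by
      intro w
      rw [hFv]
      ring
    simp only
    nth_rw 1 [← he]
    rw [ContinuousLinearMap.inverse_equiv]
    change a = e.symm (F (x, v)) ↔ _
    have h2 : ∀ a, e a = G x a := fun a ↦ by rw [← he]; rfl
    rw [ContinuousLinearEquiv.eq_symm_apply, h2, ContinuousLinearMap.ext_iff]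
    refine forall_congr' fun w ↦ ?_
    have := h1 w
    constructor <;> intro h <;> linarith

lemma IsLocalSpacetime.exists_isChartGeodesic [FiniteDimensional ℝ E]
    (hG : IsLocalSpacetime U G X) {p : E} (hp : p ∈ U) (v : E) (t₀ : ℝ) :
    ∃ ρ > 0, ∃ c c' c'' : ℝ → E, IsChartGeodesic U G c c' c'' (Ioo (t₀ - ρ) (t₀ + ρ)) ∧
      c t₀ = p ∧ c' t₀ = v := by
  have : CompleteSpace E := FiniteDimensional.complete ℝ E
  obtain ⟨A, hA, hAeq⟩ := hG.exists_acceleration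
  have hf : ContDiffAt ℝ 1 (fun z : E × E ↦ (z.2, A z)) (p, v) :=
    contDiffAt_snd.prodMk (hA p hp v)
  obtain ⟨z, hz₀, ε, hε, hz⟩ :=
    hf.exists_forall_mem_closedBall_exists_eq_forall_mem_Ioo_hasDerivAt₀ t₀
  have hc : ContinuousAt (fun t ↦ (z t).1) t₀ :=
    (hz t₀ ⟨by linarith, by linarith⟩).continuousAt.fst
  obtain ⟨η, hη, hηU⟩ := Metric.mem_nhds_iff.1 (hc.preimage_mem_nhds
    (hG.isOpen.mem_nhds (show (z t₀).1 ∈ U by rw [hz₀]; exact hp)))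
  have hI : Ioo (t₀ - min ε η) (t₀ + min ε η) ⊆ Ioo (t₀ - ε) (t₀ + ε) :=
    Ioo_subset_Ioo (by linarith [min_le_left ε η]) (by linarith [min_le_left ε η])
  have hU : ∀ t ∈ Ioo (t₀ - min ε η) (t₀ + min ε η), (z t).1 ∈ U := by
    rintro t ⟨h1, h2⟩
    refine hηU (mem_ball_iff_norm.2 (abs_lt.2 ⟨?_, ?_⟩)) <;> linarith [min_le_right ε η]
  refine ⟨min ε η, lt_min hε hη, fun t ↦ (z t).1, fun t ↦ (z t).2, fun t ↦ A (z t),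
    ⟨hU, fun t ht ↦ ?_, fun t ht ↦ ?_, fun t ht ↦ ?_⟩, ?_, ?_⟩
  · exact (hasFDerivAt_fst.comp_hasDerivAt t (hz t (hI ht))).hasDerivWithinAt
  · exact (hasFDerivAt_snd.comp_hasDerivAt t (hz t (hI ht))).hasDerivWithinAt
  · exact (hAeq _ (hU t ht) _ _).1 rfl
  · simp only [hz₀]
  · simp only [hz₀]

lemma IsChartGeodesic.mono {c c' c'' : ℝ → E} {J K : Set ℝ} (h : IsChartGeodesic U G c c' c'' J)
    (hK : K ⊆ J) : IsChartGeodesic U G c c' c'' K :=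
  ⟨fun t ht ↦ h.mem t (hK ht), fun t ht ↦ (h.hasDeriv t (hK ht)).mono hK,
    fun t ht ↦ (h.hasDeriv' t (hK ht)).mono hK, fun t ht ↦ h.equation t (hK ht)⟩

lemma hasDerivWithinAt_Ici_of_Icc {F : Type*} [NormedAddCommGroup F] [NormedSpace ℝ F] {f : ℝ → F}
    {f' : F} {a b t : ℝ} (ht : t ∈ Ico a b) (h : HasDerivWithinAt f f' (Icc a b) t) :
    HasDerivWithinAt f f' (Ici t) t :=
  h.mono_of_mem_nhdsWithin (Icc_mem_nhdsGE_of_mem ht)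

lemma hasDerivWithinAt_Iic_of_Icc {F : Type*} [NormedAddCommGroup F] [NormedSpace ℝ F] {f : ℝ → F}
    {f' : F} {a b t : ℝ} (ht : t ∈ Ioc a b) (h : HasDerivWithinAt f f' (Icc a b) t) :
    HasDerivWithinAt f f' (Iic t) t :=
  h.mono_of_mem_nhdsWithin (Icc_mem_nhdsLE_of_mem ht)

/-- Local uniqueness of geodesics. -/
lemma IsChartGeodesic.eq_of_eq [FiniteDimensional ℝ E] (hG : IsLocalSpacetime U G X)
    {c₁ c₁' c₁'' c₂ c₂' c₂'' : ℝ → E} {J : Set ℝ} (hJ : J.OrdConnected)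
    (h₁ : IsChartGeodesic U G c₁ c₁' c₁'' J) (h₂ : IsChartGeodesic U G c₂ c₂' c₂'' J) {t₀ : ℝ}
    (ht₀ : t₀ ∈ J) (hc : c₁ t₀ = c₂ t₀) (hc' : c₁' t₀ = c₂' t₀) :
    ∃ ε > 0, ∀ t ∈ J, |t - t₀| < ε → c₁ t = c₂ t ∧ c₁' t = c₂' t := by
  obtain ⟨A, hA, hAeq⟩ := hG.exists_acceleration
  set f : E × E → E × E := fun z ↦ (z.2, A z) with hf
  have hfC : ContDiffAt ℝ 1 f (c₁ t₀, c₁' t₀) :=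
    contDiffAt_snd.prodMk (hA _ (h₁.mem t₀ ht₀) _)
  obtain ⟨K, s, hs, hK⟩ := hfC.exists_lipschitzOnWith
  have key : ∀ c c' c'' : ℝ → E, IsChartGeodesic U G c c' c'' J → c t₀ = c₁ t₀ → c' t₀ = c₁' t₀ →
      (∀ t ∈ J, HasDerivWithinAt (fun t ↦ (c t, c' t)) (f (c t, c' t)) J t) ∧
      ∃ ε > 0, ∀ t ∈ J, |t - t₀| < ε → (c t, c' t) ∈ s := by
    intro c c' c'' h e1 e2
    have hd : ∀ t ∈ J, HasDerivWithinAt (fun t ↦ (c t, c' t)) (f (c t, c' t)) J t := by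
      intro t ht
      have := (h.hasDeriv t ht).prodMk (h.hasDeriv' t ht)
      rwa [(hAeq _ (h.mem t ht) _ _).2 (h.equation t ht)] at this
    refine ⟨hd, ?_⟩
    have hmem := (hd t₀ ht₀).continuousWithinAt.preimage_mem_nhdsWithin (t := s)
      (by rwa [e1, e2])
    obtain ⟨ε, hε, hsub⟩ := Metric.mem_nhdsWithin_iff.1 hmem
    exact ⟨ε, hε, fun t ht htε ↦ hsub ⟨by rwa [mem_ball, Real.dist_eq], ht⟩⟩
  obtain ⟨d₁, ε₁, hε₁, hs₁⟩ := key c₁ c₁' c₁'' h₁ rfl rfl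
  obtain ⟨d₂, ε₂, hε₂, hs₂⟩ := key c₂ c₂' c₂'' h₂ hc.symm hc'.symm
  refine ⟨min ε₁ ε₂, lt_min hε₁ hε₂, fun t ht htε ↦ ?_⟩
  obtain ⟨hlt1, hlt2⟩ := lt_min_iff.1 htε
  suffices (c₁ t, c₁' t) = (c₂ t, c₂' t) from Prod.mk.inj this
  have h0 : (c₁ t₀, c₁' t₀) = (c₂ t₀, c₂' t₀) := by rw [hc, hc']
  rcases le_total t₀ t with hle | hle
  · have hsub : Icc t₀ t ⊆ J := hJ.out ht₀ ht
    have hab : ∀ s ∈ Ico t₀ t, |s - t₀| < ε₁ ∧ |s - t₀| < ε₂ := by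
      intro s hs
      have : |s - t₀| ≤ |t - t₀| := by
        rw [abs_of_nonneg (by linarith [hs.1]), abs_of_nonneg (by linarith)]
        linarith [hs.2]
      exact ⟨this.trans_lt hlt1, this.trans_lt hlt2⟩
    exact ODE_solution_unique_of_mem_Icc_right (v := fun _ ↦ f) (s := fun _ ↦ s)
      (f := fun t ↦ (c₁ t, c₁' t)) (g := fun t ↦ (c₂ t, c₂' t)) (fun _ _ ↦ hK)
      (fun s hs ↦ ((d₁ s (hsub hs)).mono hsub).continuousWithinAt)
      (fun s hs ↦ hasDerivWithinAt_Ici_of_Icc hs ((d₁ s (hsub (Ico_subset_Icc_self hs))).mono hsub))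
      (fun s hs ↦ hs₁ s (hsub (Ico_subset_Icc_self hs)) (hab s hs).1)
      (fun s hs ↦ ((d₂ s (hsub hs)).mono hsub).continuousWithinAt)
      (fun s hs ↦ hasDerivWithinAt_Ici_of_Icc hs ((d₂ s (hsub (Ico_subset_Icc_self hs))).mono hsub))
      (fun s hs ↦ hs₂ s (hsub (Ico_subset_Icc_self hs)) (hab s hs).2) h0 (right_mem_Icc.2 hle)
  · have hsub : Icc t t₀ ⊆ J := hJ.out ht ht₀
    have hab : ∀ s ∈ Ioc t t₀, |s - t₀| < ε₁ ∧ |s - t₀| < ε₂ := by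
      intro s hs
      have : |s - t₀| ≤ |t - t₀| := by
        rw [abs_of_nonpos (by linarith [hs.2]), abs_of_nonpos (by linarith)]
        linarith [hs.1]
      exact ⟨this.trans_lt hlt1, this.trans_lt hlt2⟩
    exact ODE_solution_unique_of_mem_Icc_left (v := fun _ ↦ f) (s := fun _ ↦ s)
      (f := fun t ↦ (c₁ t, c₁' t)) (g := fun t ↦ (c₂ t, c₂' t)) (fun _ _ ↦ hK)
      (fun s hs ↦ ((d₁ s (hsub hs)).mono hsub).continuousWithinAt)
      (fun s hs ↦ hasDerivWithinAt_Iic_of_Icc hs ((d₁ s (hsub (Ioc_subset_Icc_self hs))).mono hsub))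
      (fun s hs ↦ hs₁ s (hsub (Ioc_subset_Icc_self hs)) (hab s hs).1)
      (fun s hs ↦ ((d₂ s (hsub hs)).mono hsub).continuousWithinAt)
      (fun s hs ↦ hasDerivWithinAt_Iic_of_Icc hs ((d₂ s (hsub (Ioc_subset_Icc_self hs))).mono hsub))
      (fun s hs ↦ hs₂ s (hsub (Ioc_subset_Icc_self hs)) (hab s hs).2) h0 (left_mem_Icc.2 hle)

end GeodesicFlow

/-! ### Timelike geodesics in charts -/

namespace Spacetime

section

set_option maxSynthPendingDepth 3

open Metric Filter Topology

variable {E : Type*} [NormedAddCommGroup E] [NormedSpace ℝ E]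
  {M : Type*} [TopologicalSpace M] [ChartedSpace E M] [IsManifold 𝓘(ℝ, E) ∞ M]
  {S : Spacetime E M} {e : OpenPartialHomeomorph M E} {κ t₀ ρ : ℝ} {c c' c'' : ℝ → E}

variable (S) in
/-- A future timelike geodesic of speed `κ` in the chart `e`, on the times `t` with `|t - t₀| < ρ`.
-/
structure IsFutureChartGeodesic (κ : ℝ) (e : OpenPartialHomeomorph M E) (t₀ ρ : ℝ)
    (c c' c'' : ℝ → E) : Prop where
  mem_atlas : e ∈ atlas E M
  pos : 0 < ρ
  speed_pos : 0 < κ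
  geodesic : IsChartGeodesic e.target (S.chartForm e) c c' c'' (Ioo (t₀ - ρ) (t₀ + ρ))
  speed : ∀ t ∈ Ioo (t₀ - ρ) (t₀ + ρ), S.chartForm e (c t) (c' t) (c' t) = κ ^ 2
  future : ∀ t ∈ Ioo (t₀ - ρ) (t₀ + ρ), 0 ≤ S.chartForm e (c t) (c' t) (S.chartOrient e (c t))

lemma IsFutureChartGeodesic.mono (h : S.IsFutureChartGeodesic κ e t₀ ρ c c' c'') {t₁ ρ' : ℝ}
    (hρ' : 0 < ρ') (hsub : Ioo (t₁ - ρ') (t₁ + ρ') ⊆ Ioo (t₀ - ρ) (t₀ + ρ)) :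
    S.IsFutureChartGeodesic κ e t₁ ρ' c c' c'' :=
  ⟨h.mem_atlas, hρ', h.speed_pos, h.geodesic.mono hsub, fun t ht ↦ h.speed t (hsub ht),
    fun t ht ↦ h.future t (hsub ht)⟩

lemma IsFutureChartGeodesic.hasDerivAt (h : S.IsFutureChartGeodesic κ e t₀ ρ c c' c'') {t : ℝ}
    (ht : t ∈ Ioo (t₀ - ρ) (t₀ + ρ)) : HasDerivAt c (c' t) t :=
  (h.geodesic.hasDeriv t ht).hasDerivAt (isOpen_Ioo.mem_nhds ht)

lemma IsFutureChartGeodesic.hasDerivAt' (h : S.IsFutureChartGeodesic κ e t₀ ρ c c' c'') {t : ℝ}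
    (ht : t ∈ Ioo (t₀ - ρ) (t₀ + ρ)) : HasDerivAt c' (c'' t) t :=
  (h.geodesic.hasDeriv' t ht).hasDerivAt (isOpen_Ioo.mem_nhds ht)

/-- The solution lives on both sides of `t₀`, whatever the domain of the curve that supplied the
initial data. This permits calibrating at end points and extending beyond them. -/
lemma exists_isFutureChartGeodesic [FiniteDimensional ℝ E] (he : e ∈ atlas E M) {x v : E}
    (hx : x ∈ e.target) (hκ : 0 < κ) (hv : S.chartForm e x v v = κ ^ 2)
    (hvX : 0 ≤ S.chartForm e x v (S.chartOrient e x)) (t₀ : ℝ) :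
    ∃ (ρ : ℝ) (c c' c'' : ℝ → E), S.IsFutureChartGeodesic κ e t₀ ρ c c' c'' ∧ c t₀ = x ∧ c' t₀ = v := by
  have hG := S.isLocalSpacetime_chart he
  obtain ⟨ρ, hρ, c, c', c'', hc, rfl, rfl⟩ := hG.exists_isChartGeodesic hx v t₀
  have ht₀ : t₀ ∈ Ioo (t₀ - ρ) (t₀ + ρ) := ⟨by linarith, by linarith⟩
  have hnhds : Ioo (t₀ - ρ) (t₀ + ρ) ∈ 𝓝 t₀ := isOpen_Ioo.mem_nhds ht₀
  have hspeed : ∀ t ∈ Ioo (t₀ - ρ) (t₀ + ρ), S.chartForm e (c t) (c' t) (c' t) = κ ^ 2 := by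
    intro t ht
    rw [← hv]
    refine (convex_Ioo _ _).is_const_of_fderivWithin_eq_zero (𝕜 := ℝ)
      (f := fun t ↦ S.chartForm e (c t) (c' t) (c' t))
      (fun s hs ↦ (hc.hasDerivWithinAt_speed hG hs).differentiableWithinAt) (fun s hs ↦ ?_) ht ht₀
    have := (hc.hasDerivWithinAt_speed hG hs).hasFDerivWithinAt.fderivWithin
      (isOpen_Ioo.uniqueDiffWithinAt hs)
    rw [this]
    ext
    simp
  obtain ⟨ε, hε, -, htl⟩ := hG.exists_ball_timelike hx (hv ▸ by positivity) hvX
    (hv ▸ by positivity : (0 : ℝ) < _)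
  have h1 := ((hc.hasDeriv t₀ ht₀).hasDerivAt hnhds).continuousAt.eventually (ball_mem_nhds _ hε)
  have h2 := ((hc.hasDeriv' t₀ ht₀).hasDerivAt hnhds).continuousAt.eventually (ball_mem_nhds _ hε)
  obtain ⟨η, hη, hηb⟩ := Metric.eventually_nhds_iff.1 (h1.and h2)
  have hsub : Ioo (t₀ - min ρ η) (t₀ + min ρ η) ⊆ Ioo (t₀ - ρ) (t₀ + ρ) :=
    Ioo_subset_Ioo (by linarith [min_le_left ρ η]) (by linarith [min_le_left ρ η])
  refine ⟨min ρ η, c, c', c'', ⟨he, lt_min hρ hη, hκ, hc.mono hsub, fun t ht ↦ hspeed t (hsub ht),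
    fun t ht ↦ ?_⟩, rfl, rfl⟩
  have : dist t t₀ < η := by
    rw [Real.dist_eq, abs_lt]
    constructor <;> linarith [ht.1, ht.2, min_le_right ρ η]
  exact (htl _ (hηb this).1 _ (hηb this).2).2.2.le

/-- Near the time `t₀`, the curve `γ|J` is a future timelike geodesic of speed `κ`, which can be
extended to a neighbourhood of `t₀`. -/
def IsFutureGeodesicNear (S : Spacetime E M) (κ : ℝ) (γ : ℝ → M) (J : Set ℝ) (t₀ : ℝ) : Prop :=
  ∃ (e : OpenPartialHomeomorph M E) (ρ : ℝ) (c c' c'' : ℝ → E),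
    S.IsFutureChartGeodesic κ e t₀ ρ c c' c'' ∧
    ∀ t ∈ J, t ∈ Ioo (t₀ - ρ) (t₀ + ρ) → γ t = e.symm (c t)

lemma uniqueDiffOn_of_ordConnected {J : Set ℝ} (hJ : J.OrdConnected) (hJ' : J.Nontrivial) :
    UniqueDiffOn ℝ J := by
  obtain ⟨a, ha, b, hb, hab⟩ := hJ'.exists_lt
  refine uniqueDiffOn_convex hJ.convex ⟨(a + b) / 2, ?_⟩
  refine mem_interior_iff_mem_nhds.2 (mem_of_superset (Ioo_mem_nhds (a := a) (b := b) ?_ ?_)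
    (Ioo_subset_Icc_self.trans (hJ.out ha hb))) <;> linarith

lemma fderiv_chartMetric [FiniteDimensional ℝ E] (he : e ∈ atlas E M) {x : E} (hx : x ∈ e.target)
    (u v w : E) :
    fderiv ℝ (fun y ↦ S.chartMetric e y v w) x u = fderiv ℝ (S.chartForm e) x u v w := by
  have hG := S.isLocalSpacetime_chart he
  have h1 : HasFDerivAt (S.chartForm e) (fderiv ℝ (S.chartForm e) x) x :=
    ((hG.smooth.contDiffAt (hG.isOpen.mem_nhds hx)).differentiableAt (by simp)).hasFDerivAt
  have h2 := ((h1.clm_apply (hasFDerivAt_const v x)).clm_apply (hasFDerivAt_const w x)).fderiv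
  change fderiv ℝ (fun y ↦ S.chartForm e y v w) x u = _
  rw [h2]
  simp

lemma christoffel_self [FiniteDimensional ℝ E] (he : e ∈ atlas E M) {x : E} (hx : x ∈ e.target)
    (v w : E) : S.christoffel e x v v w =
      fderiv ℝ (S.chartForm e) x v v w - fderiv ℝ (S.chartForm e) x w v v / 2 := by
  rw [christoffel, fderiv_chartMetric he hx, fderiv_chartMetric he hx]
  ring

/-- A geodesic, seen in a chart. -/
lemma IsGeodesicOn.isChartGeodesic [FiniteDimensional ℝ E] {γ : ℝ → M} {J : Set ℝ}
    (hγ : S.IsGeodesicOn γ J) (he : e ∈ atlas E M) {O : Set ℝ} (hO : IsOpen O)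
    (hmaps : MapsTo γ (J ∩ O) e.source) :
    ∃ c'' : ℝ → E, IsChartGeodesic e.target (S.chartForm e) (fun t ↦ e (γ t))
      (fun t ↦ chartDeriv e (γ t) (velocity (E := E) γ J t)) c'' (J ∩ O) := by
  obtain ⟨hJ, hJ', hC, heq⟩ := hγ
  have hu := uniqueDiffOn_of_ordConnected hJ hJ'
  set f : ℝ → E := fun t ↦ e (γ t) with hf
  have huK : UniqueDiffOn ℝ (J ∩ O) := hu.inter hO
  have hfC : ContDiffOn ℝ 2 f (J ∩ O) :=
    contDiffOn_chart (n := 2) he (hC.mono inter_subset_left) hmaps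
  have hdJ : ∀ t ∈ J ∩ O,
      HasDerivWithinAt f (chartDeriv e (γ t) (velocity (E := E) γ J t)) J t := fun t ht ↦
    hasDerivWithinAt_chart he (hmaps ht) ((hC t ht.1).mdifferentiableWithinAt two_ne_zero)
  have hset : ∀ t ∈ J ∩ O, (J ∩ O : Set ℝ) =ᶠ[𝓝 t] J := fun t ht ↦ by
    filter_upwards [hO.mem_nhds ht.2] with s hs
    exact propext ⟨fun h ↦ h.1, fun h ↦ ⟨h, hs⟩⟩
  have hdiff : DifferentiableOn ℝ (derivWithin f (J ∩ O)) (J ∩ O) := by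
    rw [show (2 : WithTop ℕ∞) = 1 + 1 by rw [one_add_one_eq_two],
      contDiffOn_succ_iff_derivWithin huK] at hfC
    exact hfC.2.2.differentiableOn one_ne_zero
  have hd : ∀ t ∈ J ∩ O, derivWithin f (J ∩ O) t =
      chartDeriv e (γ t) (velocity (E := E) γ J t) := fun t ht ↦
    ((hdJ t ht).mono inter_subset_left).derivWithin (huK t ht)
  refine ⟨derivWithin (derivWithin f (J ∩ O)) (J ∩ O), fun t ht ↦ e.map_source (hmaps ht),
    fun t ht ↦ (hdJ t ht).mono inter_subset_left, fun t ht ↦ ?_, fun t ht w ↦ ?_⟩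
  · exact (hdiff t ht).hasDerivWithinAt.congr (fun s hs ↦ (hd s hs).symm) (hd t ht).symm
  · have h1 := heq e he t ht.1 (hmaps ht) w
    -- The geodesic equation is stated with derivatives within `J`; near `t` the sets `J` and `J ∩
    -- O` coincide, so the derivatives agree.
    have h2 : iteratedDerivWithin 2 f J t = derivWithin (derivWithin f (J ∩ O)) (J ∩ O) t := by
      have : iteratedDerivWithin 2 f J t = iteratedDerivWithin 2 f (J ∩ O) t := by
        rw [iteratedDerivWithin, iteratedDerivWithin, iteratedFDerivWithin_congr_set (hset t ht)]
      rw [this, iteratedDerivWithin_succ]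
      refine derivWithin_congr (fun s hs ↦ ?_) ?_ <;> rw [iteratedDerivWithin_one]
    rw [h2, (hdJ t ht).derivWithin (hu t ht.1),
      christoffel_self he (e.map_source (hmaps ht)), S.chartMetric_eq] at h1
    rw [← h1]
    ring

/-- Near each of its times, a future timelike geodesic is given by a geodesic in a chart on a full
neighbourhood of this time. -/
lemma IsFutureTimelikeGeodesicOn.exists_isFutureChartGeodesic [FiniteDimensional ℝ E] {γ : ℝ → M}
    {J : Set ℝ} (hγ : S.IsFutureTimelikeGeodesicOn γ J) (he : e ∈ atlas E M) (ht₀ : t₀ ∈ J)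
    (hes : γ t₀ ∈ e.source) :
    ∃ (κ ρ : ℝ) (c c' c'' : ℝ → E), S.IsFutureChartGeodesic κ e t₀ ρ c c' c'' ∧
      ∀ t ∈ J, t ∈ Ioo (t₀ - ρ) (t₀ + ρ) → γ t ∈ e.source ∧ e (γ t) = c t ∧
        chartDeriv e (γ t) (velocity (E := E) γ J t) = c' t := by
  have hG := S.isLocalSpacetime_chart he
  have hcont := (hγ.1.2.2.1.continuousOn t₀ ht₀).preimage_mem_nhdsWithin (e.open_source.mem_nhds hes)
  obtain ⟨ε, hε, hsub⟩ := Metric.mem_nhdsWithin_iff.1 hcont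
  have hmaps : MapsTo γ (J ∩ ball t₀ ε) e.source := fun t ht ↦ hsub ⟨ht.2, ht.1⟩
  obtain ⟨b'', hb⟩ := hγ.1.isChartGeodesic he isOpen_ball hmaps
  obtain ⟨hv, hvX⟩ := (futureTimelikeVec_iff_chart he hes).1 (hγ.2 t₀ ht₀)
  obtain ⟨ρ, c, c', c'', hc, e1, e2⟩ := S.exists_isFutureChartGeodesic he (e.map_source hes)
    (Real.sqrt_pos.2 hv) (Real.sq_sqrt hv.le).symm hvX t₀
  have hK : (J ∩ ball t₀ ε ∩ Ioo (t₀ - ρ) (t₀ + ρ)).OrdConnected := by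
    have : (ball t₀ ε).OrdConnected := by
      rw [Real.ball_eq_Ioo]
      exact ordConnected_Ioo
    exact (hγ.1.1.inter this).inter ordConnected_Ioo
  have hρ := hc.pos
  -- Local uniqueness on `J` identifies the given curve with the two-sided solution having the same
  -- initial data.
  obtain ⟨η, hη, hηeq⟩ := (hb.mono inter_subset_left).eq_of_eq hG hK (hc.geodesic.mono inter_subset_right)
    (t₀ := t₀) ⟨⟨ht₀, mem_ball_self hε⟩, by linarith, by linarith⟩ e1.symm e2.symm
  have hm : 0 < min ρ (min ε η) := lt_min hρ (lt_min hε hη)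
  have hm1 := min_le_left ρ (min ε η)
  have hm2 := (min_le_right ρ (min ε η)).trans (min_le_left ε η)
  have hm3 := (min_le_right ρ (min ε η)).trans (min_le_right ε η)
  have hsubI : Ioo (t₀ - min ρ (min ε η)) (t₀ + min ρ (min ε η)) ⊆ Ioo (t₀ - ρ) (t₀ + ρ) :=
    Ioo_subset_Ioo (by linarith) (by linarith)
  refine ⟨_, min ρ (min ε η), c, c', c'', hc.mono hm hsubI, fun t ht htI ↦ ?_⟩
  have habs : |t - t₀| < min ρ (min ε η) := by
    rw [abs_lt]
    constructor <;> linarith [htI.1, htI.2]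
  have htε : t ∈ ball t₀ ε := by
    rw [mem_ball, Real.dist_eq]
    exact habs.trans_le hm2
  obtain ⟨h1, h2⟩ := hηeq t ⟨⟨ht, htε⟩, hsubI htI⟩ (habs.trans_le hm3)
  exact ⟨hmaps ⟨ht, htε⟩, h1, h2⟩

end

end Spacetime

/-! ### Timelike geodesics locally maximise the length -/

namespace Spacetime

section

set_option maxSynthPendingDepth 3

open Metric Filter Topology

variable {E : Type*} [NormedAddCommGroup E] [NormedSpace ℝ E]
  {M : Type*} [TopologicalSpace M] [ChartedSpace E M] [IsManifold 𝓘(ℝ, E) ∞ M]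
  {S : Spacetime E M} {e : OpenPartialHomeomorph M E} {κ t₀ ρ a b : ℝ} {c c' c'' : ℝ → E}
  {γ δ : ℝ → M}

lemma IsFutureChartGeodesic.isArc (h : S.IsFutureChartGeodesic κ e t₀ ρ c c' c'')
    (hab : a < b) (hsub : Icc a b ⊆ Ioo (t₀ - ρ) (t₀ + ρ)) :
    IsArc (fun p (v : E) ↦ S.FutureTimelikeVec p v ∧ S.hyperbolicNorm p v = κ)
      (fun t ↦ e.symm (c t)) a b := by
  have he := h.mem_atlas
  refine isArc_chart_symm he hab (fun t ht ↦ (h.hasDerivAt (hsub ht)).hasDerivWithinAt)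
    (fun t ht ↦ (h.hasDerivAt' (hsub ht)).continuousAt.continuousWithinAt)
    (fun t ht ↦ h.geodesic.mem t (hsub ht)) fun t ht v hv ↦ ?_
  have hct := h.geodesic.mem t (hsub ht)
  have hps := e.map_target hct
  have hspeed := h.speed t (hsub ht)
  have hft : S.FutureTimelikeVec (e.symm (c t)) v := by
    rw [futureTimelikeVec_iff_chart he hps, e.right_inv hct, hv, hspeed]
    exact ⟨pow_pos h.speed_pos 2, h.future t (hsub ht)⟩
  refine ⟨hft, ?_⟩
  rw [hyperbolicNorm_of_futureCausalVec hft.futureCausalVec, ← chartForm_chartDeriv S he hps,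
    e.right_inv hct, hv, hspeed, Real.sqrt_sq h.speed_pos.le]

/-- A curve which is near each time a future timelike geodesic of speed `κ`. -/
lemma isPath_of_isFutureGeodesicNear (hab : a < b)
    (hγ : ∀ t ∈ Icc a b, S.IsFutureGeodesicNear κ γ (Icc a b) t) :
    IsPath S.FutureTimelikeVec γ a b ∧ S.length γ a b = ENNReal.ofReal (κ * (b - a)) := by
  have hκ : 0 < κ := by
    obtain ⟨e, ρ, c, c', c'', hc, -⟩ := hγ a (left_mem_Icc.2 hab.le)
    exact hc.speed_pos
  suffices ∀ u v, a ≤ u → u < v → v ≤ b →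
      IsPath S.FutureTimelikeVec γ u v ∧ S.length γ u v = ENNReal.ofReal (κ * (v - u)) from
    this a b le_rfl hab le_rfl
  refine interval_property_of_local (Q := fun s t ↦ ∀ u v, s ≤ u → u < v → v ≤ t →
    IsPath S.FutureTimelikeVec γ u v ∧ S.length γ u v = ENNReal.ofReal (κ * (v - u))) hab ?_ ?_
  · intro t ht
    obtain ⟨e, ρ, c, c', c'', hc, heq⟩ := hγ t ht
    have hρ := hc.pos
    refine ⟨ρ / 2, half_pos hρ, fun s hs u hu hsu hts hut x y hx hxy hy ↦ ?_⟩
    have hsub : Icc x y ⊆ Ioo (t - ρ) (t + ρ) := fun r hr ↦ ⟨by linarith [hr.1], by linarith [hr.2]⟩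
    have hE : EqOn (fun t ↦ e.symm (c t)) γ (Icc x y) := fun r hr ↦
      (heq r ⟨by linarith [hr.1, hs.1], by linarith [hr.2, hu.2]⟩ (hsub hr)).symm
    have harc := (hc.isArc hxy hsub).congr hE
    exact ⟨.arc hxy (harc.imp fun _ _ h ↦ h.1),
      length_of_hyperbolicNorm_eq hκ.le fun r hr ↦ (harc.2 r hr).2⟩
  · intro p q r s hap hpq hqr hrs hsb h1 h2 u v hu huv hv
    rcases le_or_gt v r with hvr | hvr
    · exact h1 u v hu huv hvr
    rcases le_or_gt q u with hqu | hqu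
    · exact h2 u v hqu huv hv
    obtain ⟨p1, l1⟩ := h1 u q hu hqu hqr.le
    obtain ⟨p2, l2⟩ := h2 q v le_rfl (hqr.trans hvr) hv
    refine ⟨p1.trans p2, ?_⟩
    rw [← S.length_add γ hqu.le (hqr.trans hvr).le, l1, l2, ← ENNReal.ofReal_add]
    · congr 1
      ring
    · exact mul_nonneg hκ.le (by linarith)
    · exact mul_nonneg hκ.le (by linarith)

/-- The calibration inequality is integrated along the arc. Monotonicity of `f` is included so that
the truncated differences `ENNReal.ofReal` add up over successive arcs. -/
lemma length_arc_le_of_calibration [FiniteDimensional ℝ E] (he : e ∈ atlas E M) {V : Set E}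
    {f : E → ℝ} {f' : E → E →L[ℝ] ℝ} (hκ : 0 ≤ κ) (hf : ∀ x ∈ V, HasFDerivAt f (f' x) x)
    (hcal : ∀ x ∈ V, ∀ v, 0 ≤ S.chartForm e x v v → 0 ≤ S.chartForm e x v (S.chartOrient e x) →
      κ * √(S.chartForm e x v v) ≤ f' x v)
    (hab : a < b) (h : IsArc S.FutureCausalVec δ a b)
    (hmaps : ∀ t ∈ Icc a b, δ t ∈ e.source ∧ e (δ t) ∈ V) :
    f (e (δ a)) ≤ f (e (δ b)) ∧
      ENNReal.ofReal κ * S.length δ a b ≤ ENNReal.ofReal (f (e (δ b)) - f (e (δ a))) := by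
  have hG := S.isLocalSpacetime_chart he
  set z : ℝ → E := fun t ↦ e (δ t) with hz
  set z' : ℝ → E := fun t ↦ chartDeriv e (δ t) (velocity (E := E) δ (Icc a b) t) with hz'
  have hu := uniqueDiffOn_Icc hab
  have hd : ∀ t ∈ Icc a b, HasDerivWithinAt z (z' t) (Icc a b) t := fun t ht ↦
    hasDerivWithinAt_chart he (hmaps t ht).1 ((h.1 t ht).mdifferentiableWithinAt one_ne_zero)
  have hzC : ContinuousOn z (Icc a b) := fun t ht ↦ (hd t ht).continuousWithinAt
  have hz'C : ContinuousOn z' (Icc a b) := by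
    have h1 : ContDiffOn ℝ 1 z (Icc a b) := contDiffOn_chart (n := 1) he h.1 fun t ht ↦ (hmaps t ht).1
    exact (h1.continuousOn_derivWithin hu le_rfl).congr fun t ht ↦ ((hd t ht).derivWithin (hu t ht)).symm
  set φ : ℝ → ℝ := fun t ↦ κ * √(S.chartForm e (z t) (z' t) (z' t)) with hφ
  have hφC : ContinuousOn φ (Icc a b) := by
    have h1 : ContinuousOn (fun t ↦ S.chartForm e (z t)) (Icc a b) :=
      hG.smooth.continuousOn.comp hzC fun t ht ↦ e.map_source (hmaps t ht).1
    exact continuousOn_const.mul (((h1.clm_apply hz'C).clm_apply hz'C).sqrt)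
  have hφ0 : ∀ t, 0 ≤ φ t := fun t ↦ mul_nonneg hκ (Real.sqrt_nonneg _)
  have hφi : IntegrableOn φ (Icc a b) := hφC.integrableOn_Icc
  have hFd : ∀ t ∈ Icc a b, HasDerivWithinAt (fun t ↦ f (z t)) (f' (z t) (z' t)) (Icc a b) t :=
    fun t ht ↦ (hf _ (hmaps t ht).2).comp_hasDerivWithinAt t (hd t ht)
  have hint := intervalIntegral.integral_le_sub_of_hasDeriv_right_of_le (g := fun t ↦ f (z t))
    (g' := fun t ↦ f' (z t) (z' t)) (φ := φ) hab.le (fun t ht ↦ (hFd t ht).continuousWithinAt)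
    (fun t ht ↦ ((hFd t (Ioo_subset_Icc_self ht)).hasDerivAt
      (Icc_mem_nhds ht.1 ht.2)).hasDerivWithinAt) hφi fun t ht ↦ by
        have ht' := Ioo_subset_Icc_self ht
        obtain ⟨h1, h2⟩ := (futureCausalVec_iff_chart he (hmaps t ht').1).1 (h.2 t ht')
        exact hcal _ (hmaps t ht').2 _ h1 h2
  have hint' : ENNReal.ofReal κ * S.length δ a b = ENNReal.ofReal (∫ t in a..b, φ t) := by
    rw [intervalIntegral.integral_of_le hab.le, ← integral_Icc_eq_integral_Ioc,
      ofReal_integral_eq_lintegral_ofReal hφi (ae_of_all _ hφ0), length,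
      ← lintegral_const_mul' _ _ ENNReal.ofReal_ne_top]
    refine setLIntegral_congr_fun measurableSet_Icc fun t ht ↦ ?_
    have h1 : S.hyperbolicNorm (δ t) (velocity δ (Icc a b) t) =
        √(S.chartForm e (z t) (z' t) (z' t)) := by
      rw [hyperbolicNorm_of_futureCausalVec (h.2 t ht)]
      exact congrArg Real.sqrt (chartForm_chartDeriv S he (hmaps t ht).1 _ _).symm
    simp only [h1, hφ]
    rw [ENNReal.ofReal_mul hκ]
  refine ⟨?_, hint' ▸ ENNReal.ofReal_le_ofReal hint⟩
  have := intervalIntegral.integral_nonneg hab.le (μ := volume) fun t _ ↦ hφ0 t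
  linarith

lemma length_le_of_calibration [FiniteDimensional ℝ E] (he : e ∈ atlas E M) {V : Set E}
    {f : E → ℝ} {f' : E → E →L[ℝ] ℝ} (hκ : 0 ≤ κ) (hf : ∀ x ∈ V, HasFDerivAt f (f' x) x)
    (hcal : ∀ x ∈ V, ∀ v, 0 ≤ S.chartForm e x v v → 0 ≤ S.chartForm e x v (S.chartOrient e x) →
      κ * √(S.chartForm e x v v) ≤ f' x v)
    (h : IsPath S.FutureCausalVec δ a b) (hmaps : ∀ t ∈ Icc a b, δ t ∈ e.source ∧ e (δ t) ∈ V) :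
    f (e (δ a)) ≤ f (e (δ b)) ∧
      ENNReal.ofReal κ * S.length δ a b ≤ ENNReal.ofReal (f (e (δ b)) - f (e (δ a))) := by
  induction h with
  | arc hlt h => exact length_arc_le_of_calibration he hκ hf hcal hlt h hmaps
  | snoc h₁ hlt h ih =>
    have hlt' := h₁.lt
    obtain ⟨a1, a2⟩ := ih fun t ht ↦ hmaps t ⟨ht.1, ht.2.trans hlt.le⟩
    obtain ⟨b1, b2⟩ := length_arc_le_of_calibration he hκ hf hcal hlt h
      fun t ht ↦ hmaps t ⟨hlt'.le.trans ht.1, ht.2⟩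
    refine ⟨a1.trans b1, ?_⟩
    rw [← S.length_add δ hlt'.le hlt.le, mul_add]
    refine (add_le_add a2 b2).trans ?_
    rw [← ENNReal.ofReal_add (by linarith) (by linarith)]
    exact ENNReal.ofReal_le_ofReal (by linarith)

/-- In a strongly causal spacetime, timelike geodesics locally maximise the length. -/
lemma IsFutureGeodesicNear.timeSep_le [FiniteDimensional ℝ E] (hS : S.StronglyCausal) {J : Set ℝ}
    (h : S.IsFutureGeodesicNear κ γ J t₀) :
    ∃ ε > 0, ∀ s ∈ J, ∀ t ∈ J, |s - t₀| < ε → |t - t₀| < ε → s ≤ t →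
      S.timeSep (γ s) (γ t) ≤ ENNReal.ofReal (κ * (t - s)) := by
  obtain ⟨e, ρ, c, c', c'', hc, heq⟩ := h
  have hρ := hc.pos
  have he := hc.mem_atlas
  have hκ := hc.speed_pos
  have hG := S.isLocalSpacetime_chart he
  have ht₀ : t₀ ∈ Ioo (t₀ - ρ) (t₀ + ρ) := ⟨by linarith, by linarith⟩
  have hct₀ := hc.geodesic.mem t₀ ht₀
  obtain ⟨f, f', V, hV, ε₁, hε₁, -, hf, hfc, hcal⟩ := hG.exists_calibration hρ hc.geodesic hκ hc.speed
    (hc.future t₀ ht₀)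
  have hV' : e.source ∩ e ⁻¹' V ∈ 𝓝 (e.symm (c t₀)) := by
    have hs := e.map_target hct₀
    refine inter_mem (e.open_source.mem_nhds hs) ((e.continuousAt hs).preimage_mem_nhds ?_)
    rwa [e.right_inv hct₀]
  -- Causal convexity traps every competitor between points of `W` in the domain of the calibration.
  obtain ⟨W, hW, hWV, hconv⟩ := hS.exists_causallyConvex hV'
  have hcW : (fun t ↦ e.symm (c t)) ⁻¹' W ∈ 𝓝 t₀ :=
    ContinuousAt.preimage_mem_nhds (f := fun t ↦ e.symm (c t))
      (ContinuousAt.comp (f := c) (e.continuousAt_symm hct₀) (hc.hasDerivAt ht₀).continuousAt) hW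
  obtain ⟨ε₂, hε₂, hε₂W⟩ := Metric.mem_nhds_iff.1 hcW
  refine ⟨min ρ (min ε₁ ε₂), lt_min hρ (lt_min hε₁ hε₂), fun s hs t ht hsε htε hst ↦ ?_⟩
  have key : ∀ r ∈ J, |r - t₀| < min ρ (min ε₁ ε₂) → γ r ∈ W ∧ f (e (γ r)) = κ ^ 2 * r := by
    intro r hr hrε
    obtain ⟨r1, r2⟩ := lt_min_iff.1 hrε
    obtain ⟨r2, r3⟩ := lt_min_iff.1 r2
    have hrI : r ∈ Ioo (t₀ - ρ) (t₀ + ρ) := by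
      rw [abs_lt] at r1
      constructor <;> linarith
    rw [heq r hr hrI, e.right_inv (hc.geodesic.mem r hrI)]
    exact ⟨hε₂W (by rwa [mem_ball, Real.dist_eq]), hfc r r2⟩
  obtain ⟨hsW, hfs⟩ := key s hs hsε
  obtain ⟨htW, hft⟩ := key t ht htε
  refine iSup₂_le fun δ hδ ↦ ?_
  obtain ⟨hδ, h0, h1⟩ := isFutureCausalCurve_iff.1 hδ
  have hmaps : ∀ r ∈ Icc (0 : ℝ) 1, δ r ∈ e.source ∧ e (δ r) ∈ V := by
    intro r hr
    refine hWV (hconv _ hsW _ htW _ ?_ ?_)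
    · rcases hr.1.eq_or_lt with rfl | hr0
      · rw [h0]
        exact .refl _
      · exact h0 ▸ (le_timeSep_of_isPath (hδ.mono_right hr0 hr.2)).1
    · rcases hr.2.eq_or_lt with rfl | hr1
      · rw [h1]
        exact .refl _
      · exact h1 ▸ (le_timeSep_of_isPath (hδ.mono_left hr.1 hr1)).1
  obtain ⟨-, hle⟩ := length_le_of_calibration he hκ.le hf hcal hδ hmaps
  -- Both ends lie on the geodesic, where `f` is `κ ^ 2` times the parameter; one factor `κ` cancels
  -- against the one in the calibration bound.
  rw [h0, h1, hfs, hft, show κ ^ 2 * t - κ ^ 2 * s = κ * (κ * (t - s)) by ring,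
    ENNReal.ofReal_mul hκ.le] at hle
  exact (ENNReal.mul_le_mul_iff_right (ENNReal.ofReal_pos.2 hκ).ne' ENNReal.ofReal_ne_top).1 hle

/-- In a Ptolemaic spacetime, locally maximising curves are maximising. -/
lemma timeSep_eq_of_isFutureGeodesicNear [FiniteDimensional ℝ E] (hS : S.StronglyCausal)
    (hP : S.Ptolemaic) (hab : a ≤ b)
    (hγ : ∀ t ∈ Icc a b, S.IsFutureGeodesicNear κ γ (Icc a b) t) :
    S.timeSep (γ a) (γ b) = ENNReal.ofReal (κ * (b - a)) := by
  have hκ : 0 < κ := by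
    obtain ⟨e, ρ, c, c', c'', hc, -⟩ := hγ a (left_mem_Icc.2 hab)
    exact hc.speed_pos
  rcases hab.eq_or_lt with rfl | hab
  -- Even here the upper bound has content: it says that no causal loop at `γ a` has positive
  -- length.
  · obtain ⟨ε, hε, h⟩ := (hγ a (left_mem_Icc.2 le_rfl)).timeSep_le hS
    refine le_antisymm ?_ ?_
    · exact h a (left_mem_Icc.2 le_rfl) a (left_mem_Icc.2 le_rfl) (by simpa) (by simpa) le_rfl
    · simp
  have hlow : ∀ s t, a ≤ s → s ≤ t → t ≤ b → S.CausalLE (γ s) (γ t) ∧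
      ENNReal.ofReal (κ * (t - s)) ≤ S.timeSep (γ s) (γ t) := by
    intro s t hs hst ht
    rcases hst.eq_or_lt with rfl | hst
    · exact ⟨.refl _, by simp⟩
    have hsub : Icc s t ⊆ Icc a b := Icc_subset_Icc hs ht
    obtain ⟨h1, h2⟩ := isPath_of_isFutureGeodesicNear (γ := γ) (κ := κ) hst fun u hu ↦ by
      obtain ⟨e, ρ, c, c', c'', hc, heq⟩ := hγ u (hsub hu)
      exact ⟨e, ρ, c, c', c'', hc, fun t ht ↦ heq t (hsub ht)⟩
    obtain ⟨h3, h4⟩ := le_timeSep_of_isPath (h1.imp fun _ _ h ↦ FutureTimelikeVec.futureCausalVec h)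
    exact ⟨h3, h2 ▸ h4⟩
  refine le_antisymm ?_ (hlow a b le_rfl hab.le le_rfl).2
  refine interval_property_of_local
    (Q := fun s t ↦ S.timeSep (γ s) (γ t) ≤ ENNReal.ofReal (κ * (t - s))) hab ?_ ?_
  · intro t ht
    obtain ⟨ε, hε, h⟩ := (hγ t ht).timeSep_le hS
    refine ⟨ε / 2, half_pos hε, fun s hs u hu hsu h1 h2 ↦ h s hs u hu ?_ ?_ hsu.le⟩ <;>
    · rw [abs_lt]
      constructor <;> linarith
  · intro p q r s hap hpq hqr hrs hsb h1 h2
    obtain ⟨c1, l1⟩ := hlow p q hap hpq (by linarith)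
    obtain ⟨c2, l2⟩ := hlow q r (by linarith) hqr.le (by linarith)
    obtain ⟨c3, l3⟩ := hlow r s (by linarith) hrs hsb
    -- In Ptolemy's inequality the three short separations are bounded below by lengths, and the two
    -- overlapping ones above by `h1` and `h2`; only the separation from `γ p` to `γ s` remains.
    have h := hP _ _ _ _ c1 c2 c3
    have h' : ENNReal.ofReal (κ * (q - p)) * ENNReal.ofReal (κ * (s - r)) +
        S.timeSep (γ p) (γ s) * ENNReal.ofReal (κ * (r - q)) ≤
        ENNReal.ofReal (κ * (r - p)) * ENNReal.ofReal (κ * (s - q)) :=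
      (add_le_add (mul_le_mul' l1 l3) (mul_le_mul' le_rfl l2)).trans
        (h.trans (mul_le_mul' h1 h2))
    have n1 : 0 ≤ κ * (q - p) := mul_nonneg hκ.le (by linarith)
    have n2 : 0 ≤ κ * (r - p) := mul_nonneg hκ.le (by linarith)
    have n3 : 0 < κ * (r - q) := mul_pos hκ (by linarith)
    have n4 : 0 ≤ κ * (s - r) := mul_nonneg hκ.le (by linarith)
    have n5 : 0 ≤ κ * (s - p) := mul_nonneg hκ.le (by linarith)
    -- Ptolemy's identity for four points on a line: `(r-p)(s-q) = (q-p)(s-r) + (s-p)(r-q)`.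
    have e1 : ENNReal.ofReal (κ * (r - p)) * ENNReal.ofReal (κ * (s - q)) =
        ENNReal.ofReal (κ * (q - p)) * ENNReal.ofReal (κ * (s - r)) +
          ENNReal.ofReal (κ * (s - p)) * ENNReal.ofReal (κ * (r - q)) := by
      rw [← ENNReal.ofReal_mul n1, ← ENNReal.ofReal_mul n2, ← ENNReal.ofReal_mul n5,
        ← ENNReal.ofReal_add (mul_nonneg n1 n4) (mul_nonneg n5 n3.le)]
      congr 1
      ring
    rw [e1] at h'
    have h'' := (ENNReal.add_le_add_iff_left
      (ENNReal.mul_ne_top ENNReal.ofReal_ne_top ENNReal.ofReal_ne_top)).1 h'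
    exact (ENNReal.mul_le_mul_iff_left (ENNReal.ofReal_pos.2 n3).ne' ENNReal.ofReal_ne_top).1 h''

end

end Spacetime

/-! ### Timelike geodesics are maximising -/

/-- For the discrete topology on the target, local constancy is continuity, and `J` is connected. It
is applied to the squared speed and to a proposition-valued function. -/
lemma eq_of_eventually_eq {α : Type*} {f : ℝ → α} {J : Set ℝ} (hJ : J.OrdConnected)
    (hf : ∀ t₀ ∈ J, ∀ᶠ t in nhdsWithin t₀ J, f t = f t₀) {s t : ℝ} (hs : s ∈ J) (ht : t ∈ J) :
    f s = f t := by
  let _ : TopologicalSpace α := ⊥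
  have : DiscreteTopology α := ⟨rfl⟩
  refine hJ.isPreconnected.constant (f := f) (fun t₀ ht₀ ↦ ?_) hs ht
  rw [ContinuousWithinAt, nhds_discrete, Filter.tendsto_pure]
  exact hf t₀ ht₀

namespace Spacetime

section

set_option maxSynthPendingDepth 3

open Metric Filter Topology

variable {E : Type*} [NormedAddCommGroup E] [NormedSpace ℝ E]
  {M : Type*} [TopologicalSpace M] [ChartedSpace E M] [IsManifold 𝓘(ℝ, E) ∞ M]
  {S : Spacetime E M} {e : OpenPartialHomeomorph M E} {κ t₀ ρ a b : ℝ} {c c' c'' : ℝ → E}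
  {γ σ : ℝ → M} {J K : Set ℝ}

lemma IsFutureGeodesicNear.mono (h : S.IsFutureGeodesicNear κ γ J t₀) (hK : K ⊆ J) :
    S.IsFutureGeodesicNear κ γ K t₀ := by
  obtain ⟨e, ρ, c, c', c'', hc, heq⟩ := h
  exact ⟨e, ρ, c, c', c'', hc, fun t ht ↦ heq t (hK ht)⟩

lemma inter_Ioo_mem_nhdsWithin (hρ : 0 < ρ) : J ∩ Ioo (t₀ - ρ) (t₀ + ρ) ∈ 𝓝[J] t₀ :=
  inter_mem self_mem_nhdsWithin
    (mem_nhdsWithin_of_mem_nhds (Ioo_mem_nhds (by linarith) (by linarith)))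

/-- A future timelike geodesic has constant speed. -/
lemma IsFutureTimelikeGeodesicOn.exists_speed [FiniteDimensional ℝ E]
    (hγ : S.IsFutureTimelikeGeodesicOn γ J) :
    ∃ κ > 0, ∀ t ∈ J, S.form (γ t) (velocity (E := E) γ J t) (velocity (E := E) γ J t) = κ ^ 2 ∧
      ∀ e ∈ atlas E M, γ t ∈ e.source → ∃ (ρ : ℝ) (c c' c'' : ℝ → E),
        S.IsFutureChartGeodesic κ e t ρ c c' c'' ∧
        ∀ s ∈ J, s ∈ Ioo (t - ρ) (t + ρ) → γ s ∈ e.source ∧ e (γ s) = c s ∧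
          chartDeriv e (γ s) (velocity (E := E) γ J s) = c' s := by
  set F : ℝ → ℝ := fun t ↦ S.form (γ t) (velocity (E := E) γ J t) (velocity (E := E) γ J t) with hF
  have hloc : ∀ e ∈ atlas E M, ∀ t ∈ J, γ t ∈ e.source → ∃ (κ ρ : ℝ) (c c' c'' : ℝ → E),
      S.IsFutureChartGeodesic κ e t ρ c c' c'' ∧
      (∀ s ∈ J, s ∈ Ioo (t - ρ) (t + ρ) → γ s ∈ e.source ∧ e (γ s) = c s ∧
          chartDeriv e (γ s) (velocity (E := E) γ J s) = c' s) ∧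
      ∀ s ∈ J, s ∈ Ioo (t - ρ) (t + ρ) → F s = κ ^ 2 := by
    intro e he t ht hes
    obtain ⟨κ, ρ, c, c', c'', hc, heq⟩ := hγ.exists_isFutureChartGeodesic he ht hes
    refine ⟨κ, ρ, c, c', c'', hc, heq, fun s hs hsI ↦ ?_⟩
    obtain ⟨h1, h2, h3⟩ := heq s hs hsI
    rw [← hc.speed s hsI, ← h2, ← h3]
    exact (chartForm_chartDeriv S he h1 _ _).symm
  have hconst : ∀ s ∈ J, ∀ t ∈ J, F s = F t := fun s hs t ht ↦
    eq_of_eventually_eq hγ.1.1 (fun t₀ ht₀ ↦ by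
      obtain ⟨κ, ρ, c, c', c'', hc, -, h⟩ := hloc _ (chart_mem_atlas E (γ t₀)) t₀ ht₀
        (mem_chart_source E (γ t₀))
      have hρ := hc.pos
      filter_upwards [inter_Ioo_mem_nhdsWithin hρ] with s hs
      rw [h s hs.1 hs.2, h t₀ ht₀ ⟨by linarith, by linarith⟩]) hs ht
  obtain ⟨t₀, ht₀⟩ := hγ.1.2.1.nonempty
  have hpos : 0 < F t₀ := (hγ.2 t₀ ht₀).1
  refine ⟨√(F t₀), Real.sqrt_pos.2 hpos, fun t ht ↦ ⟨?_, fun e he hes ↦ ?_⟩⟩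
  · rw [Real.sq_sqrt hpos.le]
    exact hconst t ht t₀ ht₀
  · obtain ⟨κ, ρ, c, c', c'', hc, heq, h⟩ := hloc e he t ht hes
    have hρ := hc.pos
    have : √(F t₀) = κ := by
      rw [hconst t₀ ht₀ t ht, h t ht ⟨by linarith, by linarith⟩, Real.sqrt_sq hc.speed_pos.le]
    rw [this]
    exact ⟨ρ, c, c', c'', hc, heq⟩

lemma IsFutureChartGeodesic.isFutureGeodesicNear (hc : S.IsFutureChartGeodesic κ e t₀ ρ c c' c'')
    (h : ∀ t ∈ J, t ∈ Ioo (t₀ - ρ) (t₀ + ρ) → γ t ∈ e.source ∧ e (γ t) = c t) :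
    S.IsFutureGeodesicNear κ γ J t₀ := by
  refine ⟨e, ρ, c, c', c'', hc, fun t ht htI ↦ ?_⟩
  obtain ⟨h1, h2⟩ := h t ht htI
  rw [← h2, e.left_inv h1]

lemma IsFutureTimelikeGeodesicOn.exists_isFutureGeodesicNear [FiniteDimensional ℝ E]
    (hγ : S.IsFutureTimelikeGeodesicOn γ J) :
    ∃ κ > 0, (∀ t ∈ J, S.form (γ t) (velocity (E := E) γ J t) (velocity (E := E) γ J t) = κ ^ 2) ∧
      ∀ t ∈ J, S.IsFutureGeodesicNear κ γ J t := by
  obtain ⟨κ, hκ, h⟩ := hγ.exists_speed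
  refine ⟨κ, hκ, fun t ht ↦ (h t ht).1, fun t ht ↦ ?_⟩
  obtain ⟨ρ, c, c', c'', hc, heq⟩ := (h t ht).2 _ (chart_mem_atlas E (γ t))
    (mem_chart_source E (γ t))
  exact hc.isFutureGeodesicNear fun s hs hsI ↦ ⟨(heq s hs hsI).1, (heq s hs hsI).2.1⟩

lemma timeSep_eq_of_isFutureGeodesicNear_of_mem [FiniteDimensional ℝ E] (hS : S.StronglyCausal)
    (hP : S.Ptolemaic) (hJ : J.OrdConnected) (hγ : ∀ t ∈ J, S.IsFutureGeodesicNear κ γ J t)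
    {s t : ℝ} (hs : s ∈ J) (ht : t ∈ J) (hst : s ≤ t) :
    S.timeSep (γ s) (γ t) = ENNReal.ofReal (κ * (t - s)) :=
  timeSep_eq_of_isFutureGeodesicNear hS hP hst fun u hu ↦
    (hγ u (hJ.out hs ht hu)).mono (hJ.out hs ht)

lemma length_self (γ : ℝ → M) (t : ℝ) : S.length γ t t = 0 := by
  simp [length]

/-- In a strongly causal Ptolemaic spacetime, future timelike geodesics are maximising. -/
lemma IsFutureTimelikeGeodesicOn.realisesTimeSepOn [FiniteDimensional ℝ E]
    (hγ : S.IsFutureTimelikeGeodesicOn γ J) (hS : S.StronglyCausal) (hP : S.Ptolemaic) :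
    S.RealisesTimeSepOn γ J := by
  intro s hs t ht hst
  obtain ⟨κ, hκ, -, hnear⟩ := hγ.exists_isFutureGeodesicNear
  rw [timeSep_eq_of_isFutureGeodesicNear_of_mem hS hP hγ.1.1 hnear hs ht hst]
  rcases hst.eq_or_lt with rfl | hlt
  · simp [length_self]
  · have hsub := hγ.1.1.out hs ht
    exact (isPath_of_isFutureGeodesicNear hlt fun u hu ↦ (hnear u (hsub hu)).mono hsub).2.symm

lemma IsPastTimelikeGeodesicOn.dual (hγ : S.IsPastTimelikeGeodesicOn γ J) :
    S.dual.IsFutureTimelikeGeodesicOn γ J := by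
  refine ⟨hγ.1, fun t ht ↦ ⟨(hγ.2 t ht).1, ?_⟩⟩
  have := (hγ.2 t ht).2
  change 0 ≤ S.form (γ t) (velocity (E := E) γ J t) (-S.orient (γ t))
  rw [map_neg]
  exact neg_nonneg.2 this

lemma IsPastTimelikeGeodesicOn.realisesTimeSepOn [FiniteDimensional ℝ E]
    (hγ : S.IsPastTimelikeGeodesicOn γ J) (hS : S.StronglyCausal) (hP : S.Ptolemaic) :
    S.RealisesTimeSepOn (fun t ↦ γ (-t)) {t | -t ∈ J} := by
  intro s hs t ht hst
  have h := hγ.dual.realisesTimeSepOn hS.dual hP.dual (-t) ht (-s) hs (neg_le_neg hst)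
  rw [dual_timeSep] at h
  rw [h]
  rcases hst.eq_or_lt with rfl | hlt
  · rw [length_self, length_self]
  · have h2 := dual_length (S := S) (γ := fun t ↦ γ (-t)) hlt 0
    simpa using h2

/-- A timelike geodesic is either future or past directed. -/
lemma IsTimelikeGeodesicOn.future_or_past [FiniteDimensional ℝ E]
    (hγ : S.IsTimelikeGeodesicOn γ J) :
    S.IsFutureTimelikeGeodesicOn γ J ∨ S.IsPastTimelikeGeodesicOn γ J := by
  set F : ℝ → ℝ := fun t ↦ S.form (γ t) (velocity (E := E) γ J t) (S.orient (γ t)) with hF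
  -- A timelike velocity is never orthogonal to `X`, so by the intermediate value theorem the sign
  -- of `F` is constant on `J`.
  have hne : ∀ t ∈ J, F t ≠ 0 := by
    intro t ht h0
    have h1 := S.isLorentzian_form (γ t)
    have h2 := h1.nonpos_of_orthogonal (S.X_timelike (γ t)) (w := velocity (E := E) γ J t)
      ((h1.symm _ _).trans h0)
    exact absurd (hγ.2 t ht) (not_lt.2 h2)
  have hcont : ContinuousOn F J := by
    intro t₀ ht₀
    set e := chartAt E (γ t₀)
    have he : e ∈ atlas E M := chart_mem_atlas E (γ t₀)
    have hG := S.isLocalSpacetime_chart he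
    have hes : γ t₀ ∈ e.source := mem_chart_source E (γ t₀)
    have hmem := (hγ.1.2.2.1.continuousOn t₀ ht₀).preimage_mem_nhdsWithin
      (e.open_source.mem_nhds hes)
    obtain ⟨O, hO, hO₀, hsub⟩ := mem_nhdsWithin.1 hmem
    have hmaps : MapsTo γ (J ∩ O) e.source := fun t ht ↦ hsub ⟨ht.2, ht.1⟩
    obtain ⟨b'', hb⟩ := hγ.1.isChartGeodesic he hO hmaps
    have hK : J ∩ O ∈ 𝓝[J] t₀ :=
      inter_mem self_mem_nhdsWithin (mem_nhdsWithin_of_mem_nhds (hO.mem_nhds hO₀))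
    have c1 : ContinuousOn (fun t ↦ e (γ t)) (J ∩ O) := fun t ht ↦
      (hb.hasDeriv t ht).continuousWithinAt
    have c2 : ContinuousOn (fun t ↦ chartDeriv e (γ t) (velocity (E := E) γ J t)) (J ∩ O) :=
      fun t ht ↦ (hb.hasDeriv' t ht).continuousWithinAt
    have c3 := (hG.smooth.continuousOn.comp c1 fun t ht ↦ hb.mem t ht).clm_apply c2 |>.clm_apply
      (hG.continuousOn.comp c1 fun t ht ↦ hb.mem t ht)
    have c4 : ContinuousOn F (J ∩ O) := c3.congr fun t ht ↦ by
      have h1 := chartForm_chartDeriv S he (hmaps ht) (velocity (E := E) γ J t) (S.orient (γ t))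
      rw [← chartOrient_apply S (hmaps ht)] at h1
      exact h1.symm
    exact (c4 t₀ ⟨ht₀, hO₀⟩).mono_of_mem_nhdsWithin hK
  by_cases h : ∀ t ∈ J, 0 ≤ F t
  · exact .inl ⟨hγ.1, fun t ht ↦ ⟨hγ.2 t ht, h t ht⟩⟩
  · refine .inr ⟨hγ.1, fun t ht ↦ ⟨hγ.2 t ht, ?_⟩⟩
    by_contra! h'
    push Not at h
    obtain ⟨s, hs, hs0⟩ := h
    obtain ⟨r, hr, hr0⟩ := hγ.1.1.isPreconnected.intermediate_value hs ht hcont ⟨hs0.le, h'.le⟩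
    exact hne r hr hr0

lemma IsTimelikeGeodesicOn.isMaximising [FiniteDimensional ℝ E] (hγ : S.IsTimelikeGeodesicOn γ J)
    (hS : S.StronglyCausal) (hP : S.Ptolemaic) : S.IsMaximisingTimelikeGeodesicOn γ J :=
  hγ.future_or_past.imp (fun h ↦ ⟨h, h.realisesTimeSepOn hS hP⟩)
    fun h ↦ ⟨h, h.realisesTimeSepOn hS hP⟩

/-- A unit speed geodesic maximises on all of `[0, b)`, so `(a + b) / 2` belongs to the set of which
`a` would be the supremum. -/
lemma futureCutLocus_eq_empty [FiniteDimensional ℝ E] (hS : S.StronglyCausal) (hP : S.Ptolemaic)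
    (p : M) : S.futureCutLocus p = ∅ := by
  refine eq_empty_of_forall_notMem ?_
  rintro q ⟨γ, a, b, ha, hab, hγ, hunit, rfl, -, hlub⟩
  obtain ⟨κ, hκ, hspeed, hnear⟩ := hγ.exists_isFutureGeodesicNear
  have h0 : (0 : ℝ) ∈ Ico 0 b := ⟨le_rfl, ha.trans hab⟩
  have hκ1 : κ = 1 := by
    have h1 : (1 : ℝ) = κ ^ 2 := (hunit 0 h0).symm.trans (hspeed 0 h0)
    nlinarith
  have hm : (a + b) / 2 ∈ Ico 0 b := ⟨by linarith, by linarith⟩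
  have h1 := hlub.1 (show (a + b) / 2 ∈ _ from ⟨hm, by
    rw [timeSep_eq_of_isFutureGeodesicNear_of_mem hS hP hγ.1.1 hnear h0 hm hm.1, hκ1, one_mul,
      sub_zero]⟩)
  linarith

lemma pastCutLocus_subset_dual (p : M) : S.pastCutLocus p ⊆ S.dual.futureCutLocus p := by
  rintro q ⟨γ, a, b, ha, hab, hγ, hunit, h0, ha', hlub⟩
  refine ⟨γ, a, b, ha, hab, hγ.dual, hunit, h0, ha', ?_⟩
  simpa only [dual_timeSep] using hlub

lemma timelikeCutLocus_eq_empty [FiniteDimensional ℝ E] (hS : S.StronglyCausal) (hP : S.Ptolemaic)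
    (p : M) : S.timelikeCutLocus p = ∅ := by
  rw [timelikeCutLocus, futureCutLocus_eq_empty hS hP, empty_union, ← subset_empty_iff]
  exact (pastCutLocus_subset_dual p).trans (futureCutLocus_eq_empty hS.dual hP.dual p).subset

end

end Spacetime

/-! ### Uniqueness of timelike geodesics between two points -/

namespace Spacetime

section

set_option maxSynthPendingDepth 3

open Metric Filter Topology

variable {E : Type*} [NormedAddCommGroup E] [NormedSpace ℝ E]
  {M : Type*} [TopologicalSpace M] [ChartedSpace E M] [IsManifold 𝓘(ℝ, E) ∞ M]
  {S : Spacetime E M} {e : OpenPartialHomeomorph M E} {κ t₀ ρ a b : ℝ} {c c' c'' : ℝ → E}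
  {γ σ : ℝ → M} {J : Set ℝ}

lemma causalLE_of_isFutureGeodesicNear (hJ : J.OrdConnected)
    (hγ : ∀ t ∈ J, S.IsFutureGeodesicNear κ γ J t) {s t : ℝ} (hs : s ∈ J) (ht : t ∈ J)
    (hst : s ≤ t) : S.CausalLE (γ s) (γ t) := by
  rcases hst.eq_or_lt with rfl | hlt
  · exact .refl _
  · have hsub := hJ.out hs ht
    exact (le_timeSep_of_isPath ((isPath_of_isFutureGeodesicNear hlt fun u hu ↦
      (hγ u (hsub hu)).mono hsub).1.imp fun _ _ h ↦ FutureTimelikeVec.futureCausalVec h)).1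

lemma _root_.Filter.Tendsto.eventually_ne_of_ne {α β : Type*} [TopologicalSpace β] [T2Space β]
    {l : Filter α} {f g : α → β} {x y : β} (hf : Tendsto f l (𝓝 x)) (hg : Tendsto g l (𝓝 y))
    (h : x ≠ y) : ∀ᶠ t in l, f t ≠ g t :=
  (hf.prodMk_nhds hg).eventually (isClosed_diagonal.isOpen_compl.mem_nhds h)

/-- The extension of a geodesic beyond its end point. -/
lemma exists_extension (hγ : ∀ t ∈ Icc a b, S.IsFutureGeodesicNear κ γ (Icc a b) t)
    (hc : S.IsFutureChartGeodesic κ e b ρ c c' c'')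
    (heq : ∀ t ∈ Icc a b, t ∈ Ioo (b - ρ) (b + ρ) → γ t = e.symm (c t)) {h : ℝ} (hh : 0 < h)
    (hhρ : h < ρ) : ∃ δ : ℝ → M, EqOn δ γ (Icc a b) ∧ δ (b + h) = e.symm (c (b + h)) ∧
      ∀ t ∈ Icc a (b + h), S.IsFutureGeodesicNear κ δ (Icc a (b + h)) t := by
  classical
  refine ⟨fun t ↦ if t ≤ b then γ t else e.symm (c t), fun t ht ↦ if_pos ht.2,
    if_neg (by linarith), fun t ht ↦ ?_⟩
  rcases lt_or_ge t b with htb | htb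
  · obtain ⟨e₁, ρ₁, c₁, c₁', c₁'', hc₁, heq₁⟩ := hγ t ⟨ht.1, htb.le⟩
    have h1 := min_le_left ρ₁ (b - t)
    have h2 := min_le_right ρ₁ (b - t)
    have hsub : Ioo (t - min ρ₁ (b - t)) (t + min ρ₁ (b - t)) ⊆ Ioo (t - ρ₁) (t + ρ₁) :=
      Ioo_subset_Ioo (by linarith) (by linarith)
    refine ⟨e₁, min ρ₁ (b - t), c₁, c₁', c₁'',
      hc₁.mono (lt_min hc₁.pos (by linarith)) hsub, fun s hs hsI ↦ ?_⟩
    have hsb : s ≤ b := by linarith [hsI.2]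
    simp only [if_pos hsb]
    exact heq₁ s ⟨hs.1, hsb⟩ (hsub hsI)
  · have ht2 := ht.2
    -- From `b` onwards the chart solution `c` describes both pieces, and this is the largest
    -- symmetric window about `t` inside its domain. Before `b` the window was cut down to radius `b
    -- - t`, so as not to see the new piece.
    have hsub : Ioo (t - (b + ρ - t)) (t + (b + ρ - t)) ⊆ Ioo (b - ρ) (b + ρ) :=
      Ioo_subset_Ioo (by linarith) (by linarith)
    refine ⟨e, b + ρ - t, c, c', c'', hc.mono (by linarith) hsub, fun s hs hsI ↦ ?_⟩
    by_cases hsb : s ≤ b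
    · simp only [if_pos hsb]
      exact heq s ⟨hs.1, hsb⟩ (hsub hsI)
    · simp only [if_neg hsb]

/-- Two timelike geodesics of the same speed whose concatenation is maximising have the same
velocity at the corner. -/
lemma IsFutureChartGeodesic.eq_of_corner [FiniteDimensional ℝ E] {ρ₁ ρ₂ : ℝ} {c₁ c₁' c₁'' c₂ c₂' c₂'' : ℝ → E}
    (h₁ : S.IsFutureChartGeodesic κ e t₀ ρ₁ c₁ c₁' c₁'')
    (h₂ : S.IsFutureChartGeodesic κ e t₀ ρ₂ c₂ c₂' c₂'') (heq : c₁ t₀ = c₂ t₀) {η : ℝ} (hη : 0 < η)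
    (hmax : ∀ h, 0 < h → h < η → S.timeSep (e.symm (c₁ (t₀ - h))) (e.symm (c₂ (t₀ + h))) ≤
      ENNReal.ofReal (2 * κ * h)) : c₁' t₀ = c₂' t₀ := by
  have he := h₁.mem_atlas
  have hκ := h₁.speed_pos
  have hρ₁ := h₁.pos
  have hρ₂ := h₂.pos
  have hG := S.isLocalSpacetime_chart he
  have ht₁ : t₀ ∈ Ioo (t₀ - ρ₁) (t₀ + ρ₁) := ⟨by linarith, by linarith⟩
  have ht₂ : t₀ ∈ Ioo (t₀ - ρ₂) (t₀ + ρ₂) := ⟨by linarith, by linarith⟩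
  have hp := h₁.geodesic.mem t₀ ht₁
  set p := c₁ t₀ with hpdef
  set u := c₁' t₀ with hu
  set v := c₂' t₀ with hv
  have huu : S.chartForm e p u u = κ ^ 2 := h₁.speed t₀ ht₁
  have huX : 0 ≤ S.chartForm e p u (S.chartOrient e p) := h₁.future t₀ ht₁
  have hvv : S.chartForm e p v v = κ ^ 2 := by rw [heq]; exact h₂.speed t₀ ht₂
  have hvX : 0 ≤ S.chartForm e p v (S.chartOrient e p) := by rw [heq]; exact h₂.future t₀ ht₂
  have hκ2 : 0 < κ ^ 2 := by positivity
  have key : √(S.chartForm e p (u + v) (u + v)) ≤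
      √(S.chartForm e p u u) + √(S.chartForm e p v v) := by
    rw [huu, hvv, Real.sqrt_sq hκ.le]
    -- Otherwise choose `m` strictly between `2κ` and the norm of `u + v`. The chord from `c₁ (t₀ -
    -- h)` to `c₂ (t₀ + h)`, divided by `h`, tends to `u + v`, so for small `h` it is a timelike
    -- segment of length at least `m * h`, contradicting `hmax`.
    by_contra! hlt
    obtain ⟨m, hm1, hm2⟩ := exists_between hlt
    have hm0 : 0 < m := by linarith
    have hm : m ^ 2 < S.chartForm e p (u + v) (u + v) := (Real.lt_sqrt hm0.le).1 hm2
    have hTX : 0 ≤ S.chartForm e p (u + v) (S.chartOrient e p) := by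
      rw [map_add]
      exact add_nonneg huX hvX
    obtain ⟨ε, hε, hseg⟩ := exists_segment he hp ((pow_pos hm0 2).trans hm) hTX hm0.le hm
    have hd₁ := h₁.hasDerivAt ht₁
    have hd₂ := h₂.hasDerivAt ht₂
    have d1 : HasDerivAt (fun h ↦ c₁ (t₀ - h)) (-u) 0 := by
      have h1 : HasDerivAt c₁ u (t₀ - 0) := by rwa [sub_zero]
      have := h1.scomp (0 : ℝ) ((hasDerivAt_id (0 : ℝ)).const_sub t₀)
      simpa [Function.comp_def] using this
    have d2 : HasDerivAt (fun h ↦ c₂ (t₀ + h)) v 0 := by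
      have h1 : HasDerivAt c₂ v (t₀ + 0) := by rwa [add_zero]
      have := h1.scomp (0 : ℝ) ((hasDerivAt_id (0 : ℝ)).const_add t₀)
      simpa [Function.comp_def] using this
    have d3 := (d2.sub d1).tendsto_slope_zero_right
    have e1 : ∀ᶠ h in 𝓝[>] (0 : ℝ), h⁻¹ • (c₂ (t₀ + h) - c₁ (t₀ - h)) ∈ ball (u + v) ε := by
      refine (d3.eventually (ball_mem_nhds _ hε)).mono fun h hh ↦ ?_
      simpa [← hpdef, heq, add_comm] using hh
    have e2 : ∀ᶠ h in 𝓝[>] (0 : ℝ), c₁ (t₀ - h) ∈ ball p ε :=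
      (d1.continuousAt.eventually (ball_mem_nhds _ hε)).filter_mono nhdsWithin_le_nhds |>.mono
        fun h hh ↦ by simpa [← hpdef] using hh
    have e3 : ∀ᶠ h in 𝓝[>] (0 : ℝ), c₂ (t₀ + h) ∈ ball p ε :=
      (d2.continuousAt.eventually (ball_mem_nhds _ hε)).filter_mono nhdsWithin_le_nhds |>.mono
        fun h hh ↦ by simpa [heq] using hh
    have e4 : ∀ᶠ h in 𝓝[>] (0 : ℝ), h ∈ Ioo 0 η := Ioo_mem_nhdsGT hη
    obtain ⟨h, f1, f2, f3, f4⟩ := (e1.and (e2.and (e3.and e4))).exists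
    have f5 := (hseg _ f2 _ f3 h f4.1 f1).2.trans (hmax h f4.1 f4.2)
    have f6 := (ENNReal.ofReal_le_ofReal_iff (by have := f4.1; positivity)).1 f5
    nlinarith [f4.1]
  obtain ⟨k, hk, hvk⟩ := (hG.lorentzian p hp).exists_smul_of_norm_add_le (hG.timelike p hp)
    (huu ▸ hκ2) huX (hvv ▸ hκ2) hvX key
  have hk2 : k ^ 2 * κ ^ 2 = κ ^ 2 := by
    have h1 := hvv
    rw [hvk] at h1
    simp only [map_smul, _root_.smul_apply, smul_eq_mul, huu] at h1
    linarith
  have hk1 : k = 1 := by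
    have : k ^ 2 = 1 := by
      have := mul_right_cancel₀ hκ2.ne' (hk2.trans (one_mul _).symm)
      exact this
    nlinarith
  rw [hvk, hk1, one_smul]

/-- Whether two geodesics agree to first order at a given time is a locally constant condition. -/
lemma eventually_velocity_eq_iff [FiniteDimensional ℝ E] [T2Space M]
    (hσ : S.IsFutureTimelikeGeodesicOn σ J) (hγ : S.IsFutureTimelikeGeodesicOn γ J) (ht₀ : t₀ ∈ J) :
    ∀ᶠ t in 𝓝[J] t₀,
      (σ t = γ t ∧ (velocity (E := E) σ J t : E) = velocity (E := E) γ J t) =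
      (σ t₀ = γ t₀ ∧ (velocity (E := E) σ J t₀ : E) = velocity (E := E) γ J t₀) := by
  by_cases h0 : σ t₀ = γ t₀
  swap
  -- In a Hausdorff space distinct values stay distinct nearby.
  · have := Filter.Tendsto.eventually_ne_of_ne (hσ.1.2.2.1.continuousOn t₀ ht₀)
      (hγ.1.2.2.1.continuousOn t₀ ht₀) h0
    filter_upwards [this] with t ht
    simp [ht, h0]
  set e := chartAt E (γ t₀)
  have he : e ∈ atlas E M := chart_mem_atlas E (γ t₀)
  have hG := S.isLocalSpacetime_chart he
  have hes : γ t₀ ∈ e.source := mem_chart_source E (γ t₀)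
  obtain ⟨κ₁, ρ₁, c₁, c₁', c₁'', hc₁, h₁⟩ := hσ.exists_isFutureChartGeodesic he ht₀ (h0 ▸ hes)
  obtain ⟨κ₂, ρ₂, c₂, c₂', c₂'', hc₂, h₂⟩ := hγ.exists_isFutureChartGeodesic he ht₀ hes
  have hρ₁ := hc₁.pos
  have hρ₂ := hc₂.pos
  have key : ∀ t ∈ J, t ∈ Ioo (t₀ - ρ₁) (t₀ + ρ₁) → t ∈ Ioo (t₀ - ρ₂) (t₀ + ρ₂) →
      ((σ t = γ t ∧ (velocity (E := E) σ J t : E) = velocity (E := E) γ J t) ↔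
        (c₁ t, c₁' t) = (c₂ t, c₂' t)) := by
    intro t ht hI₁ hI₂
    obtain ⟨a1, a2, a3⟩ := h₁ t ht hI₁
    obtain ⟨b1, b2, b3⟩ := h₂ t ht hI₂
    rw [Prod.mk.injEq, ← a2, ← b2, ← a3, ← b3]
    constructor
    · rintro ⟨h, h'⟩
      rw [h]
      exact ⟨rfl, congrArg (chartDeriv e (γ t)) h'⟩
    · rintro ⟨h, h'⟩
      have hp := e.injOn a1 b1 h
      refine ⟨hp, ?_⟩
      rw [hp] at h'
      exact (chartSymmDeriv_chartDeriv he b1 _).symm.trans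
        ((congrArg (chartSymmDeriv e (e (γ t))) h').trans (chartSymmDeriv_chartDeriv he b1 _))
  have ht₁ : t₀ ∈ Ioo (t₀ - ρ₁) (t₀ + ρ₁) := ⟨by linarith, by linarith⟩
  have ht₂ : t₀ ∈ Ioo (t₀ - ρ₂) (t₀ + ρ₂) := ⟨by linarith, by linarith⟩
  suffices ∀ᶠ t in 𝓝 t₀, ((c₁ t, c₁' t) = (c₂ t, c₂' t)) = ((c₁ t₀, c₁' t₀) = (c₂ t₀, c₂' t₀)) by
    filter_upwards [inter_Ioo_mem_nhdsWithin hρ₁, inter_Ioo_mem_nhdsWithin hρ₂,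
      mem_nhdsWithin_of_mem_nhds this] with t hI₁ hI₂ h
    rw [propext (key t hI₁.1 hI₁.2 hI₂.2), propext (key t₀ ht₀ ht₁ ht₂)]
    exact h
  by_cases heq : (c₁ t₀, c₁' t₀) = (c₂ t₀, c₂' t₀)
  · rw [Prod.mk.injEq] at heq
    obtain ⟨ε, hε, h⟩ := (hc₁.geodesic.mono inter_subset_left).eq_of_eq hG
      (ordConnected_Ioo.inter ordConnected_Ioo) (hc₂.geodesic.mono inter_subset_right)
      (t₀ := t₀) ⟨ht₁, ht₂⟩ heq.1 heq.2
    filter_upwards [isOpen_Ioo.mem_nhds ht₁, isOpen_Ioo.mem_nhds ht₂, ball_mem_nhds t₀ hε]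
      with t i1 i2 i3
    obtain ⟨h1, h2⟩ := h t ⟨i1, i2⟩ (by rwa [mem_ball, Real.dist_eq] at i3)
    simp [h1, h2, heq.1, heq.2]
  · have l1 := (hc₁.hasDerivAt ht₁).continuousAt.prodMk (hc₁.hasDerivAt' ht₁).continuousAt
    have l2 := (hc₂.hasDerivAt ht₂).continuousAt.prodMk (hc₂.hasDerivAt' ht₂).continuousAt
    filter_upwards [Filter.Tendsto.eventually_ne_of_ne l1 l2 heq] with t ht
    exact propext ⟨fun h ↦ absurd h ht, fun h ↦ absurd h heq⟩

/-- In a strongly causal Ptolemaic spacetime, two points are joined by at most one future timelike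
geodesic. -/
lemma IsFutureTimelikeGeodesicOn.eqOn [FiniteDimensional ℝ E] [T2Space M]
    (hS : S.StronglyCausal) (hP : S.Ptolemaic)
    (hσ : S.IsFutureTimelikeGeodesicOn σ (Icc 0 1)) (hγ : S.IsFutureTimelikeGeodesicOn γ (Icc 0 1))
    (h0 : σ 0 = γ 0) (h1 : σ 1 = γ 1) : EqOn σ γ (Icc 0 1) := by
  have m0 : (0 : ℝ) ∈ Icc (0 : ℝ) 1 := by simp
  have m1 : (1 : ℝ) ∈ Icc (0 : ℝ) 1 := by simp
  obtain ⟨κ, hκ, hσc⟩ := hσ.exists_speed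
  obtain ⟨κ', hκ', hγc⟩ := hγ.exists_speed
  have hσn : ∀ t ∈ Icc (0 : ℝ) 1, S.IsFutureGeodesicNear κ σ (Icc 0 1) t := fun t ht ↦ by
    obtain ⟨ρ, c, c', c'', hc, h⟩ := (hσc t ht).2 _ (chart_mem_atlas E (σ t)) (mem_chart_source E _)
    exact hc.isFutureGeodesicNear fun s hs hsI ↦ ⟨(h s hs hsI).1, (h s hs hsI).2.1⟩
  have hγn : ∀ t ∈ Icc (0 : ℝ) 1, S.IsFutureGeodesicNear κ' γ (Icc 0 1) t := fun t ht ↦ by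
    obtain ⟨ρ, c, c', c'', hc, h⟩ := (hγc t ht).2 _ (chart_mem_atlas E (γ t)) (mem_chart_source E _)
    exact hc.isFutureGeodesicNear fun s hs hsI ↦ ⟨(h s hs hsI).1, (h s hs hsI).2.1⟩
  -- Both geodesics maximise over a parameter interval of length one, so each speed equals the time
  -- separation of the common end points.
  obtain rfl : κ = κ' := by
    have t1 := timeSep_eq_of_isFutureGeodesicNear hS hP zero_le_one hσn
    rw [h0, h1, timeSep_eq_of_isFutureGeodesicNear hS hP zero_le_one hγn,
      ENNReal.ofReal_eq_ofReal_iff (by linarith) (by linarith)] at t1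
    linarith
  have he : chartAt E (γ 1) ∈ atlas E M := chart_mem_atlas E (γ 1)
  have hes : γ 1 ∈ (chartAt E (γ 1)).source := mem_chart_source E (γ 1)
  set e := chartAt E (γ 1)
  obtain ⟨ρ₁, c₁, c₁', c₁'', hc₁, h₁⟩ := (hσc 1 m1).2 e he (by rwa [h1])
  obtain ⟨ρ₂, c₂, c₂', c₂'', hc₂, h₂⟩ := (hγc 1 m1).2 e he hes
  have hρ₁ := hc₁.pos
  have hρ₂ := hc₂.pos
  obtain ⟨-, a2, a3⟩ := h₁ 1 m1 ⟨by linarith, by linarith⟩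
  obtain ⟨-, b2, b3⟩ := h₂ 1 m1 ⟨by linarith, by linarith⟩
  have hcorner : c₁' 1 = c₂' 1 := by
    refine hc₁.eq_of_corner hc₂ (by rw [← a2, ← b2, h1]) (η := min 1 (min ρ₁ ρ₂))
      (lt_min one_pos (lt_min hρ₁ hρ₂)) fun h hh hη ↦ ?_
    obtain ⟨hh1, hη⟩ := lt_min_iff.1 hη
    obtain ⟨hhρ₁, hhρ₂⟩ := lt_min_iff.1 hη
    -- The extension need not be assumed maximising: it is a geodesic, so the global result applies
    -- to it as well.
    obtain ⟨δ, hδ, hδh, hδn⟩ := exists_extension hγn hc₂ (fun t ht htI ↦ by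
      obtain ⟨i1, i2, -⟩ := h₂ t ht htI
      rw [← i2, e.left_inv i1]) hh hhρ₂
    have mh : 1 - h ∈ Icc (0 : ℝ) 1 := ⟨by linarith, by linarith⟩
    have hσh : e.symm (c₁ (1 - h)) = σ (1 - h) := by
      obtain ⟨i1, i2, -⟩ := h₁ (1 - h) mh ⟨by linarith, by linarith⟩
      rw [← i2, e.left_inv i1]
    have k0 : (0 : ℝ) ∈ Icc 0 (1 + h) := ⟨le_rfl, by linarith⟩
    have k1 : (1 : ℝ) ∈ Icc 0 (1 + h) := ⟨zero_le_one, by linarith⟩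
    have kh : 1 + h ∈ Icc 0 (1 + h) := ⟨by linarith, le_rfl⟩
    have s1 := timeSep_eq_of_isFutureGeodesicNear_of_mem hS hP ordConnected_Icc hσn m0 mh mh.1
    have s2 := timeSep_eq_of_isFutureGeodesicNear_of_mem hS hP ordConnected_Icc hδn k0 kh k0.2
    have l1 := causalLE_of_isFutureGeodesicNear ordConnected_Icc hσn m0 mh mh.1
    have l2 := causalLE_of_isFutureGeodesicNear ordConnected_Icc hσn mh m1 mh.2
    have l3 := causalLE_of_isFutureGeodesicNear ordConnected_Icc hδn k1 kh k1.2
    rw [hδ m1, ← h1] at l3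
    -- The route follows `σ` to `σ (1 - h)`, then `σ` to the corner and `δ` beyond. As `δ` maximises
    -- from the same starting point, at most `2 * κ * h` is left for the step across the corner.
    have hle := timeSep_add_le l1 (l2.trans l3)
    rw [hδ m0, ← h0] at s2
    rw [s1, s2, show κ * (1 + h - 0) = κ * (1 - h - 0) + 2 * κ * h by ring,
      ENNReal.ofReal_add (mul_nonneg hκ.le (by linarith)) (by positivity)] at hle
    rw [hσh, ← hδh]
    exact (ENNReal.add_le_add_iff_left ENNReal.ofReal_ne_top).1 hle
  have hv1 : (velocity (E := E) σ (Icc 0 1) 1 : E) = velocity (E := E) γ (Icc 0 1) 1 := by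
    rw [← a3, ← b3, h1] at hcorner
    exact (chartSymmDeriv_chartDeriv he hes _).symm.trans
      ((congrArg (chartSymmDeriv e (e (γ 1))) hcorner).trans (chartSymmDeriv_chartDeriv he hes _))
  intro t ht
  -- Agreement to first order is a locally constant proposition on `[0, 1]`, and it holds at time
  -- `1`.
  have := eq_of_eventually_eq (f := fun t ↦
    (σ t = γ t ∧ (velocity (E := E) σ (Icc 0 1) t : E) = velocity (E := E) γ (Icc 0 1) t))
    ordConnected_Icc (fun t₀ ht₀ ↦ eventually_velocity_eq_iff hσ hγ ht₀) m1 ht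
  exact (this.mp ⟨h1, hv1⟩).1

end

end Spacetime

theorem lemma4p5 {E : Type*} [NormedAddCommGroup E] [NormedSpace ℝ E] [FiniteDimensional ℝ E]
    {M : Type*} [TopologicalSpace M] [T2Space M] [ChartedSpace E M] [IsManifold 𝓘(ℝ, E) ∞ M]
    (S : Spacetime E M) (hcausal : S.StronglyCausal) (hptolemy : S.Ptolemaic) :
    (∀ (γ : ℝ → M) (J : Set ℝ), S.IsTimelikeGeodesicOn γ J →
      S.IsMaximisingTimelikeGeodesicOn γ J) ∧
    (∀ p : M, S.timelikeCutLocus p = ∅) ∧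
    (∀ (x y : M) (σ γ : ℝ → M),
      S.IsFutureTimelikeGeodesicOn σ (Icc 0 1) → S.IsMaximisingTimelikeGeodesicOn σ (Icc 0 1) →
      S.IsFutureTimelikeGeodesicOn γ (Icc 0 1) → S.IsMaximisingTimelikeGeodesicOn γ (Icc 0 1) →
      σ 0 = x → σ 1 = y → γ 0 = x → γ 1 = y → EqOn σ γ (Icc 0 1)) := by
  refine ⟨fun γ J hγ ↦ hγ.isMaximising hcausal hptolemy,
    Spacetime.timelikeCutLocus_eq_empty hcausal hptolemy, ?_⟩
  rintro x y σ γ hσ - hγ - hσ0 hσ1 hγ0 hγ1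
  exact hσ.eqOn hcausal hptolemy hγ (hσ0.trans hγ0.symm) (hσ1.trans hγ1.symm)
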